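/- Let $n\in\mathbb N$ and let $\Gamma\subset\mathbb C$ be a simple closed polygon with $n+2$ vertices, no three consecutive vertices being collinear (so every interior angle lies in $(0,\pi)\cup(\pi,2\pi)$). Call a vertex convex if the interior angle there is less than $\pi$, and concave if it is greater than $\pi$. Let $f$ map the unit disk $\mathbb D$ conformally onto the exterior of $\Gamma$ in $\widehat{\mathbb C}$ (the component of $\widehat{\mathbb C}\setminus\Gamma$ containing $\infty$), with $f(0)=\infty$. For $z\in\mathbb D$ let $$P_f(z)=z+\frac{2f'(z)}{f''(z)}$$ be the pole of the best Möbius approximation of $f$ at $z$, regarded as a meromorphic function on $\mathbb D$ ($P_f(z)=\infty$ where $f''(z)=0$, and $P_f$ is extended to $z=0$ by meromorphic continuation). Then there are integers $k,m\ge 0$ such that $\Gamma$ has exactly $k+2$ convex and exactly $m$ concave vertices, and there are finite Blaschke products $B_k$ and $B_m$, of degrees $k$ and $m$ and without common zeros in $\mathbb D$, with $$P_f(z)=\frac{z^3B_k(z)}{B_m(z)},\qquad z\in\mathbb D\setminus\{0\}.$$ Moreover, counting multiplicities in $\mathbb D$: (i) if $b\in\mathbb C$ and $|b|>1$, then $P_f$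 takes the value $b$ exactly $m$ times in $\mathbb D$; (ii) if $a\in\mathbb C$ and $|a|<1$, then $P_f$ takes the value $a$ exactly $k+3$ times in $\mathbb D$. -/

import Mathlib

open Set Filter Topology Metric

noncomputable section

/-! ### Polygons, their exteriors, convex and concave vertices -/

/-- The closed polygonal line is simple: the points `(1 - t) pᵢ + t pᵢ₊₁`, for `i` a (cyclic) index
and `0 ≤ t < 1`, are pairwise distinct. -/
def Polygon.IsSimple {N : ℕ} (p : Polygon ℂ N) : Prop :=
  ∀ i j : Fin N, ∀ s ∈ Ico (0 : ℝ) 1, ∀ t ∈ Ico (0 : ℝ) 1,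
    p.edgePath ℝ i s = p.edgePath ℝ j t → i = j ∧ s = t

/-- The exterior of a polygon in the finite plane: the unbounded connected component of the
complement of the boundary. -/
def Polygon.exterior {N : ℕ} (p : Polygon ℂ N) : Set ℂ :=
  {w | w ∈ (p.boundary ℝ)ᶜ ∧
    ¬ Bornology.IsBounded (connectedComponentIn (p.boundary ℝ)ᶜ w)}

/-- The closed sector at the vertex `pᵢ` spanned by the two sides meeting there. When these sides
are not parallel, it is the one of opening angle less than `π`. -/
def Polygon.closedSector {N : ℕ} [NeZero N] (p : Polygon ℂ N) (i : Fin N) : Set ℂ :=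
  {w | ∃ s t : ℝ, 0 ≤ s ∧ 0 ≤ t ∧ w = p i + s * (p (i - 1) - p i) + t * (p (i + 1) - p i)}

/-- The open sector at the vertex `pᵢ` between the two sides meeting there. -/
def Polygon.openSector {N : ℕ} [NeZero N] (p : Polygon ℂ N) (i : Fin N) : Set ℂ :=
  {w | ∃ s t : ℝ, 0 < s ∧ 0 < t ∧ w = p i + s * (p (i - 1) - p i) + t * (p (i + 1) - p i)}

/-- The vertex `pᵢ` is convex: the interior angle is less than `π`, i.e. near `pᵢ` the closed
polygonal region (the complement of the exterior) is the closed sector spanned by the sides. -/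
def Polygon.IsConvexVertex {N : ℕ} [NeZero N] (p : Polygon ℂ N) (i : Fin N) : Prop :=
  ∃ r > 0, p.exteriorᶜ ∩ ball (p i) r = p.closedSector i ∩ ball (p i) r

/-- The vertex `pᵢ` is concave: the interior angle is greater than `π`, i.e. near `pᵢ` the exterior
is the open sector (of angle less than `π`) between the sides. -/
def Polygon.IsConcaveVertex {N : ℕ} [NeZero N] (p : Polygon ℂ N) (i : Fin N) : Prop :=
  ∃ r > 0, p.exterior ∩ ball (p i) r = p.openSector i ∩ ball (p i) r

/-! ### Conformal maps onto the exterior -/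

/-- `f` maps the unit disk conformally onto the exterior (in the Riemann sphere, so including `∞`)
of the polygon `p`, with `f 0 = ∞`. The value that the Lean function takes at `0` is irrelevant;
on the punctured disk `f` is finite. -/
structure IsConformalOntoExterior {N : ℕ} (p : Polygon ℂ N) (f : ℂ → ℂ) : Prop where
  differentiableOn : DifferentiableOn ℂ f (ball 0 1 \ {0})
  injOn : InjOn f (ball 0 1 \ {0})
  image_eq : f '' (ball 0 1 \ {0}) = p.exterior
  tendsto_infinity : Tendsto f (𝓝[≠] 0) (Bornology.cobounded ℂ)

/-! ### Poles of best Möbius approximations -/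

/-- `P_f(ζ) = ζ + 2 f'(ζ) / f''(ζ)`, the pole of the best Möbius approximation of `f` at `ζ`.
It is used as a meromorphic function: where `f''(ζ) = 0` its value is `∞`, and at a pole of `f` it
is understood by meromorphic continuation. The values of the Lean function at such points are
irrelevant. -/
def bmaPole (f : ℂ → ℂ) (ζ : ℂ) : ℂ :=
  ζ + 2 * deriv f ζ / deriv (deriv f) ζ

/-- The multiplicity with which a meromorphic function `g` takes the value `b` at `z`: the order of
the zero of `g - b` at `z`, and `0` if there is no zero. It depends only on `g` in a punctured
neighbourhood of `z`, and is `⊤` if `g` is constantly `b` there. -/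
def valueMultiplicity (g : ℂ → ℂ) (b z : ℂ) : ℕ∞ :=
  WithTop.map Int.toNat (meromorphicOrderAt (fun w => g w - b) z)

/-- The number of times that `g` takes the value `b` in the unit disk, with multiplicities. -/
def valueCount (g : ℂ → ℂ) (b : ℂ) : ℕ∞ :=
  ∑' z : ball (0 : ℂ) 1, valueMultiplicity g b z

/-- `B` is a finite Blaschke product of degree `d`. -/
def IsBlaschkeProduct (d : ℕ) (B : ℂ → ℂ) : Prop :=
  ∃ (c : ℂ) (a : Fin d → ℂ), ‖c‖ = 1 ∧ (∀ i, ‖a i‖ < 1) ∧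
    ∀ z, B z = c * ∏ i, (z - a i) / (1 - starRingEnd ℂ (a i) * z)

end

/-! Put h = -(1 + z f''/f') (`negOneSubPreSchwarzian`). Then P_f = z (h - 1)/(h + 1), so everything
follows from an explicit formula for h.

Schwarz–Christoffel formula. If the exterior angle at the boundary point corresponding to ζ on the
unit circle is aπ, then, in a half-plane coordinate obtained by reflection, f is w₀ + u t^a. Hence
Re h differs from (a - 1)/2 · Re((ζ + z)/(ζ - z)) by a quantity tending to 0 at ζ
(`exists_boundary_point`). Interior points of sides have a = 1, so only the vertices contribute. By
the maximum principle h is the sum of these kernels over the vertices, with weights ν = a - 1 adding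
up to 2 (`exists_schwarzChristoffel`). A weight is positive at a convex vertex and negative at a
concave one.

Geometry. The formula needs the exterior to be a single sector at every boundary point. Near such a
point the boundary consists of two rays, so the exterior is one of the two sectors or both. Both is
impossible: a sum of logarithms (`windingLog`) is constant on the connected exterior but jumps by
2πi across a side (`isOneSided_exterior`). Connectedness of the boundary shows that every one of its
points is adherent to the exterior (`closure_diff_eq`).

Algebra. Write h = -A/B with B = ∏(z - ζᵢ); then P_f = -z (B + A)/(B - A). The Herglotz kernels are
purely imaginary on the circle, so S = B + A is the reflection of T = B - A, and S/T is a quotient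
of Blaschke products (`exists_blaschke_of_reflect`). As f has a simple pole at 0, h - 1 = O(z²), so
S has a double zero at 0; with the factor z this gives z³. By Rouché's theorem T has as many zeros
in the disk as there are negative weights, that is, m (`diskRootCount_nodePoly_sub_herglotzPoly`).
The degrees satisfy n + 2 = k + m + 2, whence there are k + 2 convex vertices. The value counts are
Rouché's theorem again, since P_f has modulus 1 on the circle (`valueCount_of_blaschke`). -/

/-! ### Reflection across the real axis -/

/-- A continuous function on a disk centred at `0` that is holomorphic off the real axis is
holomorphic. -/
theorem differentiableOn_ball_of_differentiableAt_of_im_ne_zero {M : ℂ → ℂ} {r : ℝ}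
    (hc : ContinuousOn M (ball 0 r))
    (hd : ∀ t ∈ ball (0 : ℂ) r, t.im ≠ 0 → DifferentiableAt ℂ M t) :
    DifferentiableOn ℂ M (ball 0 r) := by
  have key : ∀ z w : ℂ, Complex.Rectangle z w ⊆ ball 0 r → (z.im = 0 ∨ w.im = 0) →
      (((∫ x : ℝ in z.re..w.re, M (x + z.im * Complex.I)) -
        ∫ x : ℝ in z.re..w.re, M (x + w.im * Complex.I)) +
        Complex.I • ∫ y : ℝ in z.im..w.im, M (w.re + y * Complex.I)) -
        Complex.I • ∫ y : ℝ in z.im..w.im, M (z.re + y * Complex.I) = 0 := by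
    intro z w hzw h0
    refine Complex.integral_boundary_rect_eq_zero_of_continuousOn_of_differentiableOn M z w
      (hc.mono hzw) ?_
    intro t ht
    have h1 : t.im ≠ 0 := by
      have h2 := ht.2
      simp only [mem_preimage, mem_Ioo] at h2
      rcases h0 with h0 | h0 <;> rw [h0] at h2 <;> rintro h <;> rw [h] at h2
      · rcases le_total 0 w.im with h3 | h3
        · rw [min_eq_left h3] at h2; exact lt_irrefl _ h2.1
        · rw [max_eq_left h3] at h2; exact lt_irrefl _ h2.2
      · rcases le_total 0 z.im with h3 | h3
        · rw [min_eq_right h3] at h2; exact lt_irrefl _ h2.1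
        · rw [max_eq_right h3] at h2; exact lt_irrefl _ h2.2
    refine (hd t (hzw ?_) h1).differentiableWithinAt
    exact ⟨Ioo_subset_Icc_self ht.1, Ioo_subset_Icc_self ht.2⟩
  -- Morera's theorem. The integral around a rectangle is the sum of those around two oriented
  -- rectangles with a side on the real axis. Both stay in the disk, because moving a point
  -- vertically towards the axis decreases its modulus.
  refine (Complex.isConservativeOn_and_continuousOn_iff_isDifferentiableOn isOpen_ball).1
    ⟨fun z w hzw => ?_, hc⟩
  have habs : ∀ x ∈ uIcc z.re w.re, ∀ y' ∈ uIcc z.im w.im, ∀ y : ℝ, |y| ≤ |y'| →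
      (x + y * Complex.I : ℂ) ∈ ball (0 : ℂ) r := by
    intro x hx y' hy' y hy
    have h1 : (x + y' * Complex.I : ℂ) ∈ ball (0 : ℂ) r :=
      hzw ⟨by simpa using hx, by simpa using hy'⟩
    rw [mem_ball_zero_iff] at h1 ⊢
    refine lt_of_le_of_lt ?_ h1
    rw [Complex.norm_add_mul_I, Complex.norm_add_mul_I]
    exact Real.sqrt_le_sqrt (add_le_add le_rfl (sq_le_sq.2 hy))
  have hrect1 : Complex.Rectangle z (w.re : ℂ) ⊆ ball 0 r := by
    intro t ht
    have h2 : t.im ∈ uIcc z.im 0 := by simpa using ht.2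
    have h3 := habs t.re (by simpa using ht.1) z.im left_mem_uIcc t.im (by
      rcases mem_uIcc.1 h2 with h | h
      · rw [abs_of_nonpos h.2, abs_of_nonpos (h.1.trans h.2)]; linarith
      · rw [abs_of_nonneg h.1, abs_of_nonneg (h.1.trans h.2)]; linarith)
    rwa [Complex.re_add_im] at h3
  have hrect2 : Complex.Rectangle (z.re : ℂ) w ⊆ ball 0 r := by
    intro t ht
    have h2 : t.im ∈ uIcc 0 w.im := by simpa using ht.2
    have h3 := habs t.re (by simpa using ht.1) w.im right_mem_uIcc t.im (by
      rcases mem_uIcc.1 h2 with h | h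
      · rw [abs_of_nonneg h.1, abs_of_nonneg (h.1.trans h.2)]; linarith
      · rw [abs_of_nonpos h.2, abs_of_nonpos (h.1.trans h.2)]; linarith)
    rwa [Complex.re_add_im] at h3
  have k1 := key z w.re hrect1 (Or.inr (by simp))
  have k2 := key z.re w hrect2 (Or.inl (by simp))
  simp only [Complex.ofReal_re, Complex.ofReal_im] at k1 k2
  have hint : ∀ x ∈ uIcc z.re w.re, ∀ y' ∈ uIcc z.im w.im,
      IntervalIntegrable (fun y : ℝ => M (x + y * Complex.I)) MeasureTheory.volume 0 y' := by
    intro x hx y' hy'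
    refine ContinuousOn.intervalIntegrable (hc.comp (by fun_prop) ?_)
    intro y hy
    refine habs x hx y' hy' y ?_
    rcases mem_uIcc.1 hy with h | h
    · rw [abs_of_nonneg h.1, abs_of_nonneg (h.1.trans h.2)]; linarith
    · rw [abs_of_nonpos h.2, abs_of_nonpos (h.1.trans h.2)]; linarith
  have hw := intervalIntegral.integral_add_adjacent_intervals
    (hint w.re right_mem_uIcc z.im left_mem_uIcc).symm (hint w.re right_mem_uIcc w.im right_mem_uIcc)
  have hz := intervalIntegral.integral_add_adjacent_intervals
    (hint z.re left_mem_uIcc z.im left_mem_uIcc).symm (hint z.re left_mem_uIcc w.im right_mem_uIcc)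
  rw [← add_eq_zero_iff_eq_neg, Complex.wedgeIntegral_add_wedgeIntegral_eq, ← hw, ← hz]
  simp only [smul_eq_mul] at k1 k2 ⊢
  linear_combination k1 + k2

theorem convex_ball_inter_im_pos (r : ℝ) : Convex ℝ {t : ℂ | t ∈ ball (0 : ℂ) r ∧ 0 < t.im} :=
  (convex_ball _ _).inter (convex_halfSpace_im_gt 0)

theorem convex_ball_inter_im_neg (r : ℝ) : Convex ℝ {t : ℂ | t ∈ ball (0 : ℂ) r ∧ t.im < 0} :=
  (convex_ball _ _).inter (convex_halfSpace_im_lt 0)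

theorem isOpen_ball_inter_im_pos (r : ℝ) : IsOpen {t : ℂ | t ∈ ball (0 : ℂ) r ∧ 0 < t.im} :=
  isOpen_ball.inter (isOpen_lt continuous_const Complex.continuous_im)

theorem isOpen_ball_inter_im_neg (r : ℝ) : IsOpen {t : ℂ | t ∈ ball (0 : ℂ) r ∧ t.im < 0} :=
  isOpen_ball.inter (isOpen_lt Complex.continuous_im continuous_const)

/-- A bounded holomorphic function on a convex open set has a primitive that is the restriction
of a continuous function on the plane. -/
theorem exists_continuous_primitive {F : ℂ → ℂ} {U : Set ℂ} {C : ℝ} (hU : IsOpen U)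
    (hconv : Convex ℝ U) (hF : DifferentiableOn ℂ F U) (hC : ∀ t ∈ U, ‖F t‖ ≤ C) :
    ∃ M : ℂ → ℂ, Continuous M ∧ ∀ t ∈ U, HasDerivAt M (F t) t := by
  obtain ⟨M, hM⟩ := hconv.exists_forall_hasDerivWithinAt hF
  have hlip : LipschitzOnWith C.toNNReal M U :=
    hconv.lipschitzOnWith_of_nnnorm_hasDerivWithin_le hM
      (fun x hx => NNReal.le_toNNReal_of_coe_le (hC x hx))
  obtain ⟨M', hM', heq⟩ := hlip.extend_finite_dimension
  refine ⟨M', hM'.continuous, fun t ht => ?_⟩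
  exact ((hM t ht).hasDerivAt (hU.mem_nhds ht)).congr_of_eventuallyEq
    (Filter.mem_of_superset (hU.mem_nhds ht) fun s hs => (heq hs).symm)

/-- Two bounded holomorphic functions on the upper and the lower half of a disk whose difference
at conjugate points tends to zero at the real axis are restrictions of a single holomorphic
function. -/
theorem exists_differentiableOn_glue {Fp Fm : ℂ → ℂ} {r C : ℝ}
    (hp : DifferentiableOn ℂ Fp {t | t ∈ ball (0 : ℂ) r ∧ 0 < t.im})
    (hm : DifferentiableOn ℂ Fm {t | t ∈ ball (0 : ℂ) r ∧ t.im < 0})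
    (hpC : ∀ t ∈ ball (0 : ℂ) r, 0 < t.im → ‖Fp t‖ ≤ C)
    (hmC : ∀ t ∈ ball (0 : ℂ) r, t.im < 0 → ‖Fm t‖ ≤ C)
    (hlim : ∀ x : ℝ, |x| < r → Tendsto (fun t : ℂ => Fp t - Fm (starRingEnd ℂ t))
      (𝓝[{t | 0 < t.im}] (x : ℂ)) (𝓝 0)) :
    ∃ F : ℂ → ℂ, DifferentiableOn ℂ F (ball 0 r) ∧
      (∀ t ∈ ball (0 : ℂ) r, 0 < t.im → F t = Fp t) ∧
      (∀ t ∈ ball (0 : ℂ) r, t.im < 0 → F t = Fm t) := by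
  rcases le_or_gt r 0 with hr | hr
  · have : ball (0 : ℂ) r = ∅ := ball_eq_empty.2 hr
    exact ⟨0, by simp [this], by simp [this], by simp [this]⟩
  obtain ⟨Mp, hMpc, hMp⟩ := exists_continuous_primitive (isOpen_ball_inter_im_pos r)
    (convex_ball_inter_im_pos r) hp (fun t ht => hpC t ht.1 ht.2)
  obtain ⟨Mm, hMmc, hMm⟩ := exists_continuous_primitive (isOpen_ball_inter_im_neg r)
    (convex_ball_inter_im_neg r) hm (fun t ht => hmC t ht.1 ht.2)
  -- `Fp` and `Fm` need not have boundary values, but their primitives are Lipschitz and do. Their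
  -- jump Δ on the axis has zero derivative: x ↦ Mp(x + iy) - Mm(x - iy) has derivative Fp - Fm at
  -- conjugate points, which is small near x₀ for small y. So the primitives glue after adding a
  -- constant.
  set Δ : ℝ → ℂ := fun x => Mp x - Mm x with hΔ
  have hderiv : ∀ x ∈ Ioo (-r) r, HasDerivAt Δ 0 x := by
    intro x0 hx0
    rw [hasDerivAt_iff_isLittleO, Asymptotics.isLittleO_iff]
    intro ε hε
    have h1 := (Metric.tendsto_nhdsWithin_nhds.1 (hlim x0 (abs_lt.2 hx0))) ε hε
    obtain ⟨δ, hδ, h1⟩ := h1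
    have hδ' : 0 < min (δ / 2) (r - |x0|) :=
      lt_min (by linarith) (by have := abs_lt.2 hx0; linarith)
    filter_upwards [ball_mem_nhds x0 hδ'] with x hx
    rw [Real.ball_eq_Ioo, mem_Ioo] at hx
    have hlt : ∀ s ∈ uIcc x0 x, |s - x0| < min (δ / 2) (r - |x0|) := by
      intro s hs
      rw [abs_lt]
      rcases mem_uIcc.1 hs with h | h <;> constructor <;> linarith
    have hy : ∀ᶠ y : ℝ in 𝓝[>] 0,
        ‖(Mp (x + y * Complex.I) - Mm (x - y * Complex.I)) -
          (Mp (x0 + y * Complex.I) - Mm (x0 - y * Complex.I))‖ ≤ ε * ‖x - x0‖ := by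
      have h2 : ∀ᶠ y : ℝ in 𝓝[>] 0, y < δ / 2 :=
        eventually_nhdsWithin_of_eventually_nhds (eventually_lt_nhds (by linarith))
      have h3 : ∀ᶠ y : ℝ in 𝓝[>] 0, ∀ s ∈ uIcc x0 x, (s + y * Complex.I : ℂ) ∈ ball (0 : ℂ) r := by
        have hcont : Continuous fun p : ℝ × ℝ => (p.1 + p.2 * Complex.I : ℂ) := by fun_prop
        have h4 := isCompact_uIcc (a := x0) (b := x) |>.eventually_forall_of_forall_eventually
          (x₀ := (0 : ℝ)) (P := fun y s => (s + y * Complex.I : ℂ) ∈ ball (0 : ℂ) r) (by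
          intro s hs
          have hc' : Continuous fun p : ℝ × ℝ => (p.2 + p.1 * Complex.I : ℂ) := by fun_prop
          refine hc'.continuousAt.eventually (isOpen_ball.mem_nhds ?_)
          have h5 := hlt s hs
          have h6 : |s| < r := by
            have h7 := abs_sub_abs_le_abs_sub s x0
            have h8 := lt_of_lt_of_le h5 (min_le_right _ _)
            linarith
          simpa using h6)
        exact eventually_nhdsWithin_of_eventually_nhds h4
      filter_upwards [h2, h3, self_mem_nhdsWithin] with y hy2 hy3 hy0
      have hy0 : 0 < y := hy0
      have hconj : ∀ s : ℝ, (starRingEnd ℂ) (s + y * Complex.I : ℂ) = s - y * Complex.I := by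
        intro s; simp [sub_eq_add_neg]
      have hball' : ∀ s ∈ uIcc x0 x, (s - y * Complex.I : ℂ) ∈ ball (0 : ℂ) r := by
        intro s hs
        have := hy3 s hs
        rw [mem_ball_zero_iff] at this ⊢
        rw [← hconj, RCLike.norm_conj]
        exact this
      have hD : ∀ s ∈ uIcc x0 x, HasDerivWithinAt
          (fun s : ℝ => Mp (s + y * Complex.I) - Mm (s - y * Complex.I))
          (Fp (s + y * Complex.I) - Fm (s - y * Complex.I)) (uIcc x0 x) s := by
        intro s hs
        have a1 : HasDerivAt (fun s : ℂ => Mp (s + y * Complex.I))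
            (Fp (s + y * Complex.I)) (s : ℂ) := by
          have := (hMp (s + y * Complex.I) ⟨hy3 s hs, by simpa using hy0⟩)
          exact this.comp_add_const _ _
        have a2 : HasDerivAt (fun s : ℂ => Mm (s - y * Complex.I))
            (Fm (s - y * Complex.I)) (s : ℂ) := by
          have := (hMm (s - y * Complex.I) ⟨hball' s hs, by simpa using hy0⟩)
          exact this.comp_sub_const _ _
        exact ((a1.sub a2).comp_ofReal).hasDerivWithinAt
      refine Convex.norm_image_sub_le_of_norm_hasDerivWithin_le hD ?_ (convex_uIcc _ _)
        left_mem_uIcc right_mem_uIcc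
      intro s hs
      have h9 := @h1 (s + y * Complex.I) (by simpa using hy0) (by
        rw [dist_eq_norm]
        calc ‖(s + y * Complex.I - x0 : ℂ)‖ = ‖((s - x0 : ℝ) : ℂ) + y * Complex.I‖ := by
              congr 1; push_cast; ring
          _ ≤ ‖((s - x0 : ℝ) : ℂ)‖ + ‖(y * Complex.I : ℂ)‖ := norm_add_le _ _
          _ = |s - x0| + y := by
              rw [Complex.norm_real, norm_mul, Complex.norm_I, Complex.norm_real, mul_one,
                Real.norm_eq_abs, Real.norm_eq_abs, abs_of_pos hy0]
          _ < δ := by have := lt_of_lt_of_le (hlt s hs) (min_le_left _ _); linarith)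
      rw [hconj, dist_zero_right] at h9
      exact h9.le
    have hlim2 : Tendsto (fun y : ℝ => ‖(Mp (x + y * Complex.I) - Mm (x - y * Complex.I)) -
          (Mp (x0 + y * Complex.I) - Mm (x0 - y * Complex.I))‖) (𝓝[>] 0)
          (𝓝 ‖Δ x - Δ x0‖) := by
      have : Continuous fun y : ℝ => ‖(Mp (x + y * Complex.I) - Mm (x - y * Complex.I)) -
          (Mp (x0 + y * Complex.I) - Mm (x0 - y * Complex.I))‖ := by fun_prop
      have h := (this.tendsto 0).mono_left (nhdsWithin_le_nhds (s := Ioi 0))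
      simpa [hΔ] using h
    have := le_of_tendsto hlim2 hy
    simpa using this
  have hconst : ∀ x ∈ Ioo (-r) r, Δ x = Δ 0 := by
    intro x hx
    refine isOpen_Ioo.is_const_of_deriv_eq_zero isPreconnected_Ioo
      (fun y hy => (hderiv y hy).differentiableAt.differentiableWithinAt)
      (fun y hy => (hderiv y hy).deriv) hx ⟨by linarith, hr⟩
  set M : ℂ → ℂ := fun t => if 0 ≤ t.im then Mp t else Mm t + Δ 0 with hM
  have hMcont : ContinuousOn M (ball 0 r) := by
    rw [hM]
    refine ContinuousOn.if ?_ hMpc.continuousOn (hMmc.add continuous_const).continuousOn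
    intro t ht
    have h0 : t.im = 0 := by
      have h2 := ht.2
      rw [Complex.frontier_setOfPred_le_im] at h2
      exact h2
    have h1 : ((t.re : ℝ) : ℂ) = t := Complex.ext (by simp) (by simp [h0])
    have h2 := hconst t.re (by
      rw [mem_Ioo, ← abs_lt]
      exact lt_of_le_of_lt (Complex.abs_re_le_norm t) (mem_ball_zero_iff.1 ht.1))
    simp only [hΔ, h1] at h2 ⊢
    linear_combination h2
  have hMp' : ∀ t ∈ ball (0 : ℂ) r, 0 < t.im → HasDerivAt M (Fp t) t := by
    intro t ht h0
    refine (hMp t ⟨ht, h0⟩).congr_of_eventuallyEq ?_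
    filter_upwards [(isOpen_ball_inter_im_pos r).mem_nhds ⟨ht, h0⟩] with s hs
    simp [hM, hs.2.le]
  have hMm' : ∀ t ∈ ball (0 : ℂ) r, t.im < 0 → HasDerivAt M (Fm t) t := by
    intro t ht h0
    refine ((hMm t ⟨ht, h0⟩).add_const (Δ 0)).congr_of_eventuallyEq ?_
    filter_upwards [(isOpen_ball_inter_im_neg r).mem_nhds ⟨ht, h0⟩] with s hs
    simp [hM, not_le.2 hs.2]
  have hMd : DifferentiableOn ℂ M (ball 0 r) := by
    refine differentiableOn_ball_of_differentiableAt_of_im_ne_zero hMcont fun t ht h0 => ?_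
    rcases lt_or_gt_of_ne h0 with h | h
    · exact (hMm' t ht h).differentiableAt
    · exact (hMp' t ht h).differentiableAt
  exact ⟨deriv M, hMd.deriv isOpen_ball, fun t ht h => (hMp' t ht h).deriv,
    fun t ht h => (hMm' t ht h).deriv⟩

/-- **Schwarz reflection** for a function on a half disk whose modulus is less than one and tends
to one at the real axis. -/
theorem exists_reflection {G : ℂ → ℂ} {r : ℝ} (hr : 0 < r)
    (hG : DifferentiableOn ℂ G {t | t ∈ ball (0 : ℂ) r ∧ 0 < t.im})
    (hlt : ∀ t ∈ ball (0 : ℂ) r, 0 < t.im → ‖G t‖ < 1)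
    (hlim : ∀ x : ℝ, |x| < r → Tendsto (fun t => ‖G t‖) (𝓝[{t | 0 < t.im}] (x : ℂ)) (𝓝 1)) :
    ∃ ρ : ℝ, 0 < ρ ∧ ρ ≤ r ∧ ∃ F : ℂ → ℂ, DifferentiableOn ℂ F (ball 0 ρ) ∧
      (∀ t ∈ ball (0 : ℂ) ρ, 0 < t.im → F t = G t) ∧
      (∀ x : ℝ, |x| < ρ → ‖F x‖ = 1) ∧
      (∀ t ∈ ball (0 : ℂ) ρ, t.im < 0 → 1 < ‖F t‖) := by
  have h0 := hlim 0 (by simpa using hr)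
  have h1 : ∀ᶠ t in 𝓝[{t | 0 < t.im}] ((0 : ℝ) : ℂ), 1 / 2 < ‖G t‖ :=
    h0.eventually (lt_mem_nhds (by norm_num))
  obtain ⟨δ, hδ, h1⟩ := Metric.mem_nhdsWithin_iff.1 h1
  simp only [Complex.ofReal_zero] at h1
  set ρ := min δ r with hρ
  have hρ0 : 0 < ρ := lt_min hδ hr
  have hbig : ∀ t ∈ ball (0 : ℂ) ρ, 0 < t.im → 1 / 2 < ‖G t‖ := fun t ht hi =>
    h1 ⟨ball_subset_ball (min_le_left _ _) ht, hi⟩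
  have hsub : ball (0 : ℂ) ρ ⊆ ball 0 r := ball_subset_ball (min_le_right _ _)
  have hconjmem : ∀ t ∈ ball (0 : ℂ) ρ, starRingEnd ℂ t ∈ ball (0 : ℂ) ρ := by
    intro t ht
    rw [mem_ball_zero_iff] at ht ⊢
    rwa [RCLike.norm_conj]
  -- Reflection in the unit circle; the bound |G| > 1/2 keeps it below 2. At conjugate points the
  -- difference is (|G|² - 1)/conj G, which tends to 0 even though `G` itself is not known to
  -- converge.
  set Fm : ℂ → ℂ := fun t => (starRingEnd ℂ (G (starRingEnd ℂ t)))⁻¹ with hFm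
  have hFmd : DifferentiableOn ℂ Fm {t | t ∈ ball (0 : ℂ) ρ ∧ t.im < 0} := by
    intro t ht
    have hi : 0 < (starRingEnd ℂ t).im := by simpa using ht.2
    have hd : DifferentiableAt ℂ G (starRingEnd ℂ t) :=
      (hG _ ⟨hsub (hconjmem t ht.1), hi⟩).differentiableAt
        ((isOpen_ball_inter_im_pos r).mem_nhds ⟨hsub (hconjmem t ht.1), hi⟩)
    have hd' := hd.conj_conj
    rw [Complex.conj_conj] at hd'
    refine (DifferentiableAt.inv hd' ?_).differentiableWithinAt
    have := hbig _ (hconjmem t ht.1) hi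
    intro h
    have h3 : ‖G (starRingEnd ℂ t)‖ = 0 := by
      rw [← RCLike.norm_conj, ← norm_zero (E := ℂ), ← h]; rfl
    linarith
  obtain ⟨F, hFd, hFp, hFneg⟩ := exists_differentiableOn_glue (Fp := G) (Fm := Fm) (r := ρ) (C := 2)
    (hG.mono fun t ht => ⟨hsub ht.1, ht.2⟩) hFmd
    (fun t ht hi => by linarith [hlt t (hsub ht) hi])
    (by
      intro t ht hi
      have h2 := hbig _ (hconjmem t ht) (by simpa using hi)
      rw [hFm, norm_inv, RCLike.norm_conj, inv_le_comm₀ (by linarith) (by norm_num)]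
      linarith)
    (by
      intro x hx
      have hl := hlim x (hx.trans_le (min_le_right _ _))
      rw [tendsto_zero_iff_norm_tendsto_zero]
      have hl2 : Tendsto (fun t => |‖G t‖ ^ 2 - 1| / ‖G t‖) (𝓝[{t | 0 < t.im}] (x : ℂ))
          (𝓝 (|1 ^ 2 - 1| / 1)) :=
        (((hl.pow 2).sub_const 1).abs).div hl one_ne_zero
      rw [one_pow, sub_self, abs_zero, zero_div] at hl2
      refine hl2.congr' ?_
      have h3 : ∀ᶠ t in 𝓝[{t | 0 < t.im}] (x : ℂ), 1 / 2 < ‖G t‖ :=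
        hl.eventually (lt_mem_nhds (by norm_num))
      filter_upwards [h3] with t ht
      have hne : G t ≠ 0 := by
        intro h; rw [h, norm_zero] at ht; linarith
      have hne' : starRingEnd ℂ (G t) ≠ 0 := by simpa using hne
      have : G t - Fm (starRingEnd ℂ t) = ((‖G t‖ ^ 2 - 1 : ℝ) : ℂ) / starRingEnd ℂ (G t) := by
        rw [hFm]
        simp only [Complex.conj_conj]
        push_cast
        rw [← Complex.mul_conj']
        field_simp
      rw [this, norm_div, RCLike.norm_conj, Complex.norm_real, Real.norm_eq_abs])
  refine ⟨ρ, hρ0, min_le_right _ _, F, hFd, hFp, ?_, ?_⟩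
  · intro x hx
    have hxb : (x : ℂ) ∈ ball (0 : ℂ) ρ := by simpa using hx
    have hc : ContinuousAt F x := (hFd.differentiableAt (isOpen_ball.mem_nhds hxb)).continuousAt
    have hne : (𝓝[{t : ℂ | 0 < t.im}] (x : ℂ)).NeBot := by
      rw [← mem_closure_iff_nhdsWithin_neBot, Complex.closure_setOfPred_lt_im]
      simp
    refine tendsto_nhds_unique
      (hc.norm.tendsto.mono_left (nhdsWithin_le_nhds (s := {t : ℂ | 0 < t.im}))) ?_
    refine (hlim x (hx.trans_le (min_le_right _ _))).congr' ?_
    filter_upwards [self_mem_nhdsWithin, nhdsWithin_le_nhds (isOpen_ball.mem_nhds hxb)] with t h1 h2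
    rw [hFp t h2 h1]
  · intro t ht hi
    have hi' : 0 < (starRingEnd ℂ t).im := by simpa using hi
    have h1 := hbig _ (hconjmem t ht) hi'
    have h2 := hlt _ (hsub (hconjmem t ht)) hi'
    rw [hFneg t ht hi, hFm, norm_inv, RCLike.norm_conj]
    exact (one_lt_inv₀ (by linarith)).2 h2

/-- Meant for a zero of order n ≥ 2: the direction of argument ψ/n then lies in the open upper half
plane, and its n-th power has argument ψ. -/
theorem exists_angle_re_exp_mul_pos {κ : ℂ} (hκ : κ ≠ 0) :
    ∃ ψ : ℝ, 0 < ψ ∧ ψ < 2 * Real.pi ∧ 0 < (Complex.exp (ψ * Complex.I) * κ).re := by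
  have hpi := Real.pi_pos
  have hpos : 0 < ‖κ‖ := norm_pos_iff.2 hκ
  have hform : ∀ ψ : ℝ, (Complex.exp (ψ * Complex.I) * κ).re = ‖κ‖ * Real.cos (ψ + κ.arg) := by
    intro ψ
    conv_lhs => rw [← Complex.norm_mul_exp_arg_mul_I κ]
    rw [mul_left_comm, ← Complex.exp_add, ← add_mul, ← Complex.ofReal_add, Complex.re_ofReal_mul,
      Complex.exp_ofReal_mul_I_re]
  rcases lt_trichotomy κ.arg 0 with h | h | h
  · refine ⟨-κ.arg, by linarith, by linarith [Complex.neg_pi_lt_arg κ], ?_⟩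
    rw [hform]; simpa using hpos
  · refine ⟨Real.pi / 4, by linarith, by linarith, ?_⟩
    rw [hform, h, add_zero, Real.cos_pi_div_four]
    positivity
  · refine ⟨2 * Real.pi - κ.arg, by linarith [Complex.arg_le_pi κ], by linarith, ?_⟩
    rw [hform]; simpa using hpos

/-- A holomorphic function that maps a half disk into the unit disk and the centre to the unit
circle has non-vanishing derivative at the centre. -/
theorem deriv_ne_zero_of_norm_lt_one {F : ℂ → ℂ} {ρ : ℝ} (hρ : 0 < ρ)
    (hF : DifferentiableOn ℂ F (ball 0 ρ))
    (hlt : ∀ t ∈ ball (0 : ℂ) ρ, 0 < t.im → ‖F t‖ < 1) (h0 : ‖F 0‖ = 1) : deriv F 0 ≠ 0 := by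
  have han : AnalyticAt ℂ F 0 := hF.analyticAt (ball_mem_nhds 0 hρ)
  have hsub : AnalyticAt ℂ (fun t => F t - F 0) 0 := han.sub analyticAt_const
  -- At order n ≥ 2 the upper half plane contains a direction along which conj(F 0) · F is 1 plus a
  -- number with positive real part, which contradicts |F| < 1.
  have key : ∀ n : ℕ, 2 ≤ n → ∀ k : ℂ → ℂ, AnalyticAt ℂ k 0 → k 0 ≠ 0 →
      (∀ᶠ t in 𝓝 (0 : ℂ), F t - F 0 = t ^ n * k t) → False := by
    intro n hn k hk hk0 hev
    have hconj : starRingEnd ℂ (F 0) * F 0 = 1 := by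
      rw [Complex.conj_mul', h0]; simp
    have hF0 : starRingEnd ℂ (F 0) ≠ 0 := left_ne_zero_of_mul_eq_one hconj
    obtain ⟨ψ, hψ0, hψ1, hψ⟩ := exists_angle_re_exp_mul_pos (mul_ne_zero hF0 hk0)
    have hn0 : (0 : ℝ) < n := by positivity
    set e : ℂ := Complex.exp ((ψ / n : ℝ) * Complex.I) with he
    have hen : e ^ n = Complex.exp (ψ * Complex.I) := by
      rw [he, ← Complex.exp_nat_mul]
      congr 1
      have hn1 : (n : ℂ) ≠ 0 := by exact_mod_cast hn0.ne'
      push_cast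
      field_simp
    have hi : 0 < e.im := by
      rw [he, Complex.exp_ofReal_mul_I_im]
      refine Real.sin_pos_of_pos_of_lt_pi (by positivity) ?_
      rw [div_lt_iff₀ hn0]
      have : (2 : ℝ) ≤ n := by exact_mod_cast hn
      nlinarith [Real.pi_pos]
    have htend : Tendsto (fun s : ℝ => (s * e : ℂ)) (𝓝[>] 0) (𝓝 0) := by
      have : Continuous fun s : ℝ => (s * e : ℂ) := by fun_prop
      simpa using (this.tendsto 0).mono_left (nhdsWithin_le_nhds (s := Ioi 0))
    have hre : ∀ᶠ s : ℝ in 𝓝[>] 0,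
        0 < (Complex.exp (ψ * Complex.I) * (starRingEnd ℂ (F 0) * k (s * e))).re := by
      have hc : ContinuousAt (fun t => (Complex.exp (ψ * Complex.I) *
          (starRingEnd ℂ (F 0) * k t)).re) 0 := by
        have := hk.continuousAt
        fun_prop
      exact htend.eventually (hc.eventually (lt_mem_nhds hψ))
    obtain ⟨s, hs1, hs2, hs3, hs0⟩ := (hre.and ((htend.eventually hev).and
      ((htend.eventually (ball_mem_nhds 0 hρ)).and self_mem_nhdsWithin))).exists
    have hs0 : 0 < s := hs0
    have h1 := hlt _ hs3 (by simpa using mul_pos hs0 hi)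
    have h2 : starRingEnd ℂ (F 0) * F (s * e) = 1 + (s ^ n : ℝ) *
        (Complex.exp (ψ * Complex.I) * (starRingEnd ℂ (F 0) * k (s * e))) := by
      rw [← hen]
      push_cast
      linear_combination starRingEnd ℂ (F 0) * hs2 + hconj
    have h3 : (starRingEnd ℂ (F 0) * F (s * e)).re ≤ ‖F (s * e)‖ := by
      refine (Complex.re_le_norm _).trans ?_
      rw [norm_mul, RCLike.norm_conj, h0, one_mul]
    rw [h2, Complex.add_re, Complex.re_ofReal_mul, Complex.one_re] at h3
    have := mul_pos (pow_pos hs0 n) hs1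
    linarith
  intro hd
  rcases eq_or_ne (analyticOrderAt (fun t => F t - F 0) 0) ⊤ with htop | htop
  · rw [analyticOrderAt_eq_top] at htop
    have htend : Tendsto (fun s : ℝ => (s * Complex.I : ℂ)) (𝓝[>] 0) (𝓝 0) := by
      have : Continuous fun s : ℝ => (s * Complex.I : ℂ) := by fun_prop
      simpa using (this.tendsto 0).mono_left (nhdsWithin_le_nhds (s := Ioi 0))
    obtain ⟨s, hs1, hs2, hs0⟩ := ((htend.eventually htop).and
      ((htend.eventually (ball_mem_nhds 0 hρ)).and self_mem_nhdsWithin)).exists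
    have h1 := hlt _ hs2 (by simpa using hs0)
    rw [sub_eq_zero.1 hs1, h0] at h1
    exact lt_irrefl _ h1
  · obtain ⟨n, hn⟩ := ENat.ne_top_iff_exists.1 htop
    obtain ⟨k, hk, hk0, hev⟩ := (hsub.analyticOrderAt_eq_natCast).1 hn.symm
    simp only [sub_zero, smul_eq_mul] at hev
    rcases n with _ | _ | n
    · have := hev.self_of_nhds
      simp at this
      exact hk0 this.symm
    · have h1 : HasDerivAt (fun t : ℂ => t ^ (0 + 1) * k t) (k 0) 0 := by
        have := (hasDerivAt_id' (0 : ℂ)).fun_mul hk.differentiableAt.hasDerivAt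
        simpa using this
      have h2 : HasDerivAt (fun t => F t - F 0) (k 0) 0 := h1.congr_of_eventuallyEq hev
      have h3 := h2.deriv
      rw [deriv_sub_const, hd] at h3
      exact hk0 h3.symm
    · exact key (n + 2) (by omega) k hk hk0 hev

/-- Near a boundary point obtained by reflection, the points of the unit disk come from the upper
half plane. -/
theorem nhdsWithin_ball_le_map {F : ℂ → ℂ} {ρ : ℝ} (hρ : 0 < ρ)
    (hF : DifferentiableOn ℂ F (ball 0 ρ)) (hd : deriv F 0 ≠ 0)
    (hreal : ∀ x : ℝ, |x| < ρ → ‖F x‖ = 1)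
    (hneg : ∀ t ∈ ball (0 : ℂ) ρ, t.im < 0 → 1 < ‖F t‖) :
    𝓝[ball 0 1] (F 0) ≤ map F (𝓝[{t | 0 < t.im}] 0) := by
  have han : AnalyticAt ℂ F 0 := hF.analyticAt (ball_mem_nhds 0 hρ)
  rcases han.eventually_constant_or_nhds_le_map_nhds with h | h
  · exfalso
    apply hd
    have : F =ᶠ[𝓝 0] fun _ => F 0 := h
    rw [this.deriv_eq, deriv_const]
  · intro s hs
    rw [Filter.mem_map, mem_nhdsWithin_iff_exists_mem_nhds_inter] at hs
    obtain ⟨V, hV, hVs⟩ := hs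
    rw [mem_nhdsWithin_iff_exists_mem_nhds_inter]
    -- `F` is open at 0, and a value in the open disk can only come from the upper half: the axis
    -- goes to the circle and the lower half outside it.
    refine ⟨F '' (V ∩ ball 0 ρ), h (Filter.image_mem_map (inter_mem hV (ball_mem_nhds 0 hρ))), ?_⟩
    rintro _ ⟨⟨t, ⟨htV, htρ⟩, rfl⟩, hlt⟩
    rw [mem_ball_zero_iff] at hlt
    refine hVs ⟨htV, ?_⟩
    by_contra hi
    rw [mem_ofPred_eq, not_lt] at hi
    rcases lt_or_eq_of_le hi with hi | hi
    · exact lt_asymm hlt (hneg t htρ hi)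
    · have h1 : ((t.re : ℝ) : ℂ) = t := Complex.ext (by simp) (by simp [hi])
      have h2 := hreal t.re (lt_of_le_of_lt (Complex.abs_re_le_norm t) (mem_ball_zero_iff.1 htρ))
      rw [h1] at h2
      linarith

/-- The second order relation between the Taylor coefficients of a function that maps the real
axis into the unit circle. -/
theorem re_one_sub_deriv_dslope {F : ℂ → ℂ} {ρ : ℝ} (hρ : 0 < ρ)
    (hF : DifferentiableOn ℂ F (ball 0 ρ)) (hd : deriv F 0 ≠ 0)
    (hreal : ∀ x : ℝ, |x| < ρ → ‖F x‖ = 1) :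
    (1 - 2 * deriv (dslope F 0) 0 * F 0 / deriv F 0 ^ 2).re = 0 := by
  set k := dslope F 0 with hk
  have hkd : DifferentiableOn ℂ k (ball 0 ρ) :=
    (Complex.differentiableOn_dslope (ball_mem_nhds 0 hρ)).2 hF
  have hk0 : k 0 = deriv F 0 := dslope_same F 0
  set a := deriv F 0
  set b := deriv k 0
  have hFk : ∀ t, F t = F 0 + t * k t := by
    intro t
    have := sub_smul_dslope F 0 t
    rw [sub_zero, smul_eq_mul] at this
    rw [hk, this]; ring
  have h0 : ‖F 0‖ = 1 := by simpa using hreal 0 (by simpa using hρ)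
  have hkdiff : HasDerivAt k b 0 := (hkd.differentiableAt (ball_mem_nhds 0 hρ)).hasDerivAt
  have hkr : HasDerivAt (fun x : ℝ => k x) b 0 := by
    have : HasDerivAt k b ((0 : ℝ) : ℂ) := by simpa using hkdiff
    exact this.comp_ofReal
  -- For x ≠ 0 this is (|F x|² - 1)/x, so it vanishes. By continuity R(0) = 0, which says that
  -- conj(F 0) a is imaginary; R'(0) = 0 says that 2 Re(conj(F 0) b) + |a|² = 0.
  set R : ℝ → ℝ := fun x => 2 * (starRingEnd ℂ (F 0) * k x).re + x * Complex.normSq (k x) with hR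
  have hRne : ∀ x : ℝ, |x| < ρ → x ≠ 0 → R x = 0 := by
    intro x hx hx0
    have h1 := hreal x hx
    have h2 : Complex.normSq (F x) = 1 := by rw [Complex.normSq_eq_norm_sq, h1]; norm_num
    have h3 : Complex.normSq (F 0) = 1 := by rw [Complex.normSq_eq_norm_sq, h0]; norm_num
    rw [hFk, Complex.normSq_add, h3, Complex.normSq_mul, Complex.normSq_ofReal] at h2
    have h4 : x * R x = 0 := by
      rw [hR]
      simp only [Complex.mul_re, Complex.conj_re, Complex.conj_im, map_mul, Complex.conj_ofReal,
        Complex.ofReal_re, Complex.ofReal_im, Complex.mul_im] at h2 ⊢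
      linear_combination h2
    exact (mul_eq_zero.1 h4).resolve_left hx0
  have hRcont : ContinuousAt R 0 := by
    have := hkr.continuousAt
    have h1 : Continuous Complex.normSq := Complex.continuous_normSq
    rw [hR]
    exact (continuousAt_const.mul (Complex.continuous_re.continuousAt.comp
      (continuousAt_const.mul this))).add (continuousAt_id.mul (h1.continuousAt.comp this))
  have hev : R =ᶠ[𝓝[≠] 0] 0 := by
    filter_upwards [self_mem_nhdsWithin, nhdsWithin_le_nhds (ball_mem_nhds (0 : ℝ) hρ)] with x h1 h2
    exact hRne x (by simpa using h2) h1
  have hR0 : R 0 = 0 := by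
    refine tendsto_nhds_unique (hRcont.tendsto.mono_left (nhdsWithin_le_nhds (s := {0}ᶜ))) ?_
    exact tendsto_const_nhds.congr' hev.symm
  have hre : (starRingEnd ℂ (F 0) * a).re = 0 := by
    have := hR0
    simp only [hR, Complex.ofReal_zero, zero_mul, add_zero, hk0] at this
    linarith
  have hRz : R =ᶠ[𝓝 0] 0 := by
    filter_upwards [ball_mem_nhds (0 : ℝ) hρ] with x h2
    rcases eq_or_ne x 0 with rfl | h
    · exact hR0
    · exact hRne x (by simpa using h2) h
  have hRd : HasDerivAt R (2 * (starRingEnd ℂ (F 0) * b).re + Complex.normSq a) 0 := by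
    have h1 : HasDerivAt (fun x : ℝ => (starRingEnd ℂ (F 0) * k x).re)
        ((starRingEnd ℂ (F 0) * b).re) 0 :=
      Complex.reCLM.hasFDerivAt.comp_hasDerivAt (0 : ℝ) (hkr.const_mul (starRingEnd ℂ (F 0)))
    have h2 : HasDerivAt (fun x : ℝ => x * Complex.normSq (k x)) (Complex.normSq a) 0 := by
      have hc : ContinuousAt (fun x : ℝ => Complex.normSq (k x)) 0 :=
        Complex.continuous_normSq.continuousAt.comp hkr.continuousAt
      rw [hasDerivAt_iff_tendsto_slope]
      have h3 : Tendsto (fun x : ℝ => Complex.normSq (k x)) (𝓝[≠] 0) (𝓝 (Complex.normSq a)) := by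
        have := hc.tendsto.mono_left (nhdsWithin_le_nhds (s := {0}ᶜ))
        simpa [hk0] using this
      refine h3.congr' ?_
      filter_upwards [self_mem_nhdsWithin] with x hx
      rw [slope_def_field]
      have hx : x ≠ 0 := hx
      simp only [zero_mul, sub_zero]
      field_simp
    exact (h1.const_mul 2).add h2
  have hRd0 : 2 * (starRingEnd ℂ (F 0) * b).re + Complex.normSq a = 0 := by
    rw [← hRd.deriv, hRz.deriv_eq]
    exact deriv_const 0 (0 : ℝ)
  have hF0 : F 0 * starRingEnd ℂ (F 0) = 1 := by
    rw [Complex.mul_conj', h0]; simp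
  set lam : ℝ := (starRingEnd ℂ (F 0) * a).im with hlam
  have ha : a = F 0 * (lam * Complex.I) := by
    have : starRingEnd ℂ (F 0) * a = lam * Complex.I := by
      apply Complex.ext <;> simp [hre, ← hlam]
    rw [← this]; linear_combination (-a) * hF0
  have hF00 : F 0 ≠ 0 := left_ne_zero_of_mul_eq_one hF0
  have hlam0 : lam ≠ 0 := by
    intro h; apply hd; rw [ha, h]; simp
  have hquot : 2 * b * F 0 / a ^ 2 = ((-(2 / lam ^ 2) : ℝ) : ℂ) * (starRingEnd ℂ (F 0) * b) := by
    rw [ha]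
    have h1 : (lam : ℂ) ≠ 0 := by exact_mod_cast hlam0
    rw [mul_pow, mul_pow, Complex.I_sq]
    push_cast
    field_simp
    linear_combination b * hF0
  rw [Complex.sub_re, hquot, Complex.re_ofReal_mul, Complex.one_re]
  have hns : Complex.normSq a = lam ^ 2 := by
    rw [ha, Complex.normSq_mul, Complex.normSq_eq_norm_sq, h0, Complex.normSq_mul,
      Complex.normSq_ofReal, Complex.normSq_I]
    ring
  rw [hns] at hRd0
  field_simp
  linear_combination hRd0

/-! ### Univalent functions with a pole -/

/-- An injective holomorphic function has non-vanishing derivative. -/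
theorem AnalyticAt.deriv_ne_zero_of_injOn {f : ℂ → ℂ} {z₀ : ℂ} {U : Set ℂ} (hf : AnalyticAt ℂ f z₀)
    (hU : U ∈ 𝓝 z₀) (hinj : InjOn f U) : deriv f z₀ ≠ 0 := by
  intro hd
  have hsub : AnalyticAt ℂ (fun t => f t - f z₀) z₀ := hf.sub analyticAt_const
  rcases eq_or_ne (analyticOrderAt (fun t => f t - f z₀) z₀) ⊤ with htop | htop
  · rw [analyticOrderAt_eq_top] at htop
    have h1 : ∀ᶠ t in 𝓝[≠] z₀, f t - f z₀ = 0 ∧ t ∈ U :=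
      nhdsWithin_le_nhds (htop.and hU)
    obtain ⟨t, ⟨h2, h3⟩, h4⟩ := (h1.and self_mem_nhdsWithin).exists
    exact h4 (hinj h3 (mem_of_mem_nhds hU) (sub_eq_zero.1 h2))
  obtain ⟨n, hn⟩ := ENat.ne_top_iff_exists.1 htop
  obtain ⟨k, hk, hk0, hev⟩ := (hsub.analyticOrderAt_eq_natCast).1 hn.symm
  simp only [smul_eq_mul] at hev
  rcases n with _ | _ | m
  · have := hev.self_of_nhds
    simp at this
    exact hk0 this.symm
  · have h1 : HasDerivAt (fun t : ℂ => (t - z₀) ^ (0 + 1) * k t) (k z₀) z₀ := by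
      have := ((hasDerivAt_id' z₀).sub_const z₀).fun_mul hk.differentiableAt.hasDerivAt
      simpa using this
    have h2 : HasDerivAt (fun t => f t - f z₀) (k z₀) z₀ := h1.congr_of_eventuallyEq hev
    have h3 := h2.deriv
    rw [deriv_sub_const, hd] at h3
    exact hk0 h3.symm
  set n := m + 2 with hnm
  have hn0 : (n : ℂ) ≠ 0 := by exact_mod_cast (by omega : n ≠ 0)
  -- A local coordinate in which f = f(z₀) + k(z₀) φⁿ. Points with coordinates w and ωw, where ω is
  -- a primitive n-th root of unity, have the same image.
  set φ : ℂ → ℂ := fun z => (z - z₀) * (k z / k z₀) ^ ((n : ℂ)⁻¹) with hφ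
  have hratio : k z₀ / k z₀ = 1 := div_self hk0
  have hψ : AnalyticAt ℂ (fun z => (k z / k z₀) ^ ((n : ℂ)⁻¹)) z₀ := by
    refine AnalyticAt.cpow (hk.div analyticAt_const hk0) analyticAt_const ?_
    rw [hratio]; exact Complex.one_mem_slitPlane
  have hφa : AnalyticAt ℂ φ z₀ := (analyticAt_id.sub analyticAt_const).mul hψ
  have hφd : HasDerivAt φ 1 z₀ := by
    have := ((hasDerivAt_id' z₀).sub_const z₀).fun_mul hψ.differentiableAt.hasDerivAt
    simpa [hratio] using this
  have hφs : HasStrictDerivAt φ 1 z₀ := by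
    have := hφa.hasStrictDerivAt
    rwa [hφd.deriv] at this
  have hmap := hφs.map_nhds_eq one_ne_zero
  have hφ0 : φ z₀ = 0 := by simp [hφ]
  rw [hφ0] at hmap
  have hpow : ∀ z, φ z ^ n = (z - z₀) ^ n * (k z / k z₀) := by
    intro z
    rw [hφ]
    simp only [mul_pow]
    rw [Complex.cpow_nat_inv_pow _ (by omega)]
  set S := U ∩ {t | f t - f z₀ = (t - z₀) ^ n * k t} with hS
  have hSn : φ '' S ∈ 𝓝 (0 : ℂ) := by
    rw [← hmap]
    exact Filter.image_mem_map (inter_mem hU hev)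
  have hroot := Complex.isPrimitiveRoot_exp n (by omega)
  set ω := Complex.exp (2 * Real.pi * Complex.I / n) with hω
  have hω1 : ω ≠ 1 := hroot.ne_one (by omega)
  have hωn : ω ^ n = 1 := hroot.pow_eq_one
  have hωt : Tendsto (fun w : ℂ => ω * w) (𝓝 0) (𝓝 0) := by
    have : Continuous fun w : ℂ => ω * w := by fun_prop
    simpa using this.tendsto 0
  have hev2 : ∀ᶠ w in 𝓝[≠] (0 : ℂ), w ∈ φ '' S ∧ ω * w ∈ φ '' S :=
    nhdsWithin_le_nhds (Filter.Eventually.and hSn (hωt.eventually hSn))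
  obtain ⟨w, ⟨⟨z₁, hz₁, h1⟩, ⟨z₂, hz₂, h2⟩⟩, hw⟩ := (hev2.and self_mem_nhdsWithin).exists
  have hw : w ≠ 0 := hw
  have hfz : ∀ z ∈ S, f z = f z₀ + k z₀ * φ z ^ n := by
    intro z hz
    have h3 : f z - f z₀ = (z - z₀) ^ n * k z := hz.2
    rw [hpow]
    field_simp
    linear_combination h3
  have heq : f z₁ = f z₂ := by
    rw [hfz z₁ hz₁, hfz z₂ hz₂, h1, h2, mul_pow, hωn, one_mul]
  have := hinj hz₁.1 hz₂.1 heq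
  rw [this, h2] at h1
  apply hω1
  have h5 : (ω - 1) * w = 0 := by linear_combination h1
  exact sub_eq_zero.1 ((mul_eq_zero.1 h5).resolve_right hw)

theorem isOpen_puncturedBall : IsOpen (ball (0 : ℂ) 1 \ {0}) :=
  isOpen_ball.sdiff isClosed_singleton

/-- A holomorphic injective function on the punctured unit disk with a pole at the origin. -/
structure IsUnivalentWithPole (f : ℂ → ℂ) : Prop where
  differentiableOn : DifferentiableOn ℂ f (ball 0 1 \ {0})
  injOn : InjOn f (ball 0 1 \ {0})
  tendsto_infinity : Tendsto f (𝓝[≠] 0) (Bornology.cobounded ℂ)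

namespace IsUnivalentWithPole

variable {f : ℂ → ℂ}

theorem analyticAt (hf : IsUnivalentWithPole f) {z : ℂ} (hz : z ∈ ball (0 : ℂ) 1 \ {0}) :
    AnalyticAt ℂ f z :=
  hf.differentiableOn.analyticAt (isOpen_puncturedBall.mem_nhds hz)

theorem deriv_ne_zero (hf : IsUnivalentWithPole f) {z : ℂ} (hz : z ∈ ball (0 : ℂ) 1 \ {0}) :
    deriv f z ≠ 0 :=
  (hf.analyticAt hz).deriv_ne_zero_of_injOn (isOpen_puncturedBall.mem_nhds hz) hf.injOn

theorem exists_inverse (hf : IsUnivalentWithPole f) :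
    ∃ g : ℂ → ℂ, (∀ z ∈ ball (0 : ℂ) 1 \ {0}, g (f z) = z) ∧
      DifferentiableOn ℂ g (f '' (ball 0 1 \ {0})) := by
  have hleft : ∀ z ∈ ball (0 : ℂ) 1 \ {0}, Function.invFunOn f (ball 0 1 \ {0}) (f z) = z :=
    fun z hz => hf.injOn.leftInvOn_invFunOn hz
  refine ⟨Function.invFunOn f (ball 0 1 \ {0}), hleft, ?_⟩
  rintro _ ⟨z, hz, rfl⟩
  have hs := (hf.analyticAt hz).hasStrictDerivAt
  have := hs.to_local_left_inverse (g := Function.invFunOn f (ball 0 1 \ {0}))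
    (hf.deriv_ne_zero hz) (by
      filter_upwards [isOpen_puncturedBall.mem_nhds hz] with y hy using hleft y hy)
  exact this.hasDerivAt.differentiableAt.differentiableWithinAt

theorem isOpen_image (hf : IsUnivalentWithPole f) : IsOpen (f '' (ball 0 1 \ {0})) := by
  rw [isOpen_iff_mem_nhds]
  rintro _ ⟨z, hz, rfl⟩
  rw [← (hf.analyticAt hz).hasStrictDerivAt.map_nhds_eq (hf.deriv_ne_zero hz)]
  exact Filter.image_mem_map (isOpen_puncturedBall.mem_nhds hz)

/-- Near the pole, `f` is the inverse of a holomorphic function with a simple zero. -/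
theorem exists_reciprocal (hf : IsUnivalentWithPole f) :
    ∃ W : ℂ → ℂ, AnalyticAt ℂ W 0 ∧ W 0 = 0 ∧ deriv W 0 ≠ 0 ∧
      ∀ᶠ z in 𝓝[≠] 0, W z ≠ 0 ∧ f z = (W z)⁻¹ := by
  have h1 : ∀ᶠ z in 𝓝[≠] (0 : ℂ), f z ≠ 0 := by
    have := hf.tendsto_infinity.eventually (Bornology.eventually_ne_cobounded 0)
    exact this
  have h2 : ∀ᶠ z in 𝓝[≠] (0 : ℂ), z ∈ ball (0 : ℂ) 1 \ {0} := by
    rw [eventually_nhdsWithin_iff]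
    filter_upwards [ball_mem_nhds (0 : ℂ) one_pos] with z hz h0 using ⟨hz, h0⟩
  set W : ℂ → ℂ := Function.update (fun z => (f z)⁻¹) 0 0 with hW
  have hWne : ∀ z, z ≠ 0 → W z = (f z)⁻¹ := fun z hz => by rw [hW, Function.update_of_ne hz]
  have hW0 : W 0 = 0 := by rw [hW, Function.update_self]
  have hWa : AnalyticAt ℂ W 0 := by
    refine Complex.analyticAt_of_differentiable_on_punctured_nhds_of_continuousAt ?_ ?_
    · filter_upwards [h1, h2] with z hz1 hz2
      have hz0 : z ≠ 0 := hz2.2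
      refine (((hf.analyticAt hz2).differentiableAt).inv hz1).congr_of_eventuallyEq ?_
      filter_upwards [isOpen_ne.mem_nhds hz0] with y hy
      exact hWne y hy
    · rw [hW, continuousAt_update_same]
      exact tendsto_inv₀_cobounded.comp hf.tendsto_infinity
  refine ⟨W, hWa, hW0, ?_, ?_⟩
  · obtain ⟨V, hV, hVs⟩ := mem_nhdsWithin_iff_exists_mem_nhds_inter.1 (h1.and h2)
    refine hWa.deriv_ne_zero_of_injOn hV ?_
    intro x hx y hy hxy
    by_cases hx0 : x = 0 <;> by_cases hy0 : y = 0
    · rw [hx0, hy0]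
    · rw [hx0, hW0, hWne y hy0] at hxy
      exact absurd (inv_eq_zero.1 hxy.symm) (hVs ⟨hy, hy0⟩).1
    · rw [hy0, hW0, hWne x hx0] at hxy
      exact absurd (inv_eq_zero.1 hxy) (hVs ⟨hx, hx0⟩).1
    · rw [hWne x hx0, hWne y hy0] at hxy
      exact hf.injOn (hVs ⟨hx, hx0⟩).2 (hVs ⟨hy, hy0⟩).2 (inv_injective hxy)
  · filter_upwards [h1, self_mem_nhdsWithin] with z hz hz0
    rw [hWne z hz0]
    exact ⟨inv_ne_zero hz, (inv_inv _).symm⟩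

/-- `f` is bounded away from its pole. -/
theorem exists_bound (hf : IsUnivalentWithPole f) :
    ∃ δ R : ℝ, 0 < δ ∧ δ < 1 ∧ ∀ z : ℂ, δ ≤ ‖z‖ → ‖z‖ < 1 → ‖f z‖ ≤ R := by
  obtain ⟨W, hWa, hW0, hWd, hev⟩ := hf.exists_reciprocal
  obtain ⟨V, hV, hVs⟩ := mem_nhdsWithin_iff_exists_mem_nhds_inter.1 hev
  set S := V ∩ ball (0 : ℂ) (1 / 2) with hS
  have hSn : W '' S ∈ 𝓝 (0 : ℂ) := by
    have := hWa.hasStrictDerivAt.map_nhds_eq hWd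
    rw [hW0] at this
    rw [← this]
    exact Filter.image_mem_map (inter_mem hV (ball_mem_nhds 0 (by norm_num)))
  obtain ⟨ε, hε, hball⟩ := Metric.mem_nhds_iff.1 hSn
  -- All finite values of modulus above ε⁻¹ are already taken at points with |z| < 1/2; by
  -- injectivity they are not taken elsewhere.
  refine ⟨1 / 2, ε⁻¹, by norm_num, by norm_num, fun z hz1 hz2 => ?_⟩
  by_contra hlt
  rw [not_le] at hlt
  have hfz : f z ≠ 0 := by
    intro h; rw [h, norm_zero] at hlt; exact absurd hlt (not_lt.2 (inv_pos.2 hε).le)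
  have : (f z)⁻¹ ∈ ball (0 : ℂ) ε := by
    rw [mem_ball_zero_iff, norm_inv]
    exact inv_lt_of_inv_lt₀ hε hlt
  obtain ⟨y, hy, hyW⟩ := hball this
  have hy0 : y ≠ 0 := by
    rintro rfl
    rw [hW0] at hyW
    exact hfz (inv_eq_zero.1 hyW.symm)
  have h3 := (hVs ⟨hy.1, hy0⟩).2
  rw [hyW, inv_inv] at h3
  have hynorm := mem_ball_zero_iff.1 hy.2
  have h4 := hf.injOn (x₁ := y) (x₂ := z) ⟨by rw [mem_ball_zero_iff]; linarith, hy0⟩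
    ⟨by rw [mem_ball_zero_iff]; exact hz2, by rintro rfl; rw [norm_zero] at hz1; linarith⟩ h3
  rw [h4] at hynorm
  linarith

/-- The inverse of `f` has modulus tending to one at the points that `f` omits. -/
theorem tendsto_norm_inverse (hf : IsUnivalentWithPole f) {g : ℂ → ℂ}
    (hg : ∀ z ∈ ball (0 : ℂ) 1 \ {0}, g (f z) = z) {w : ℂ} (hw : w ∉ f '' (ball 0 1 \ {0})) :
    Tendsto (fun y => ‖g y‖) (𝓝[f '' (ball 0 1 \ {0})] w) (𝓝 1) := by
  rw [tendsto_order]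
  constructor
  · intro ρ hρ
    -- Otherwise some ultrafilter converges to w while `g` converges along it to a point z of the
    -- closed disk of radius ρ < 1. If z = 0, then f tends to ∞ instead of w; if z ≠ 0, then f(z) =
    -- w, an omitted value.
    by_contra hcon
    rw [not_eventually] at hcon
    have hne := Filter.frequently_iff_neBot.1 hcon
    obtain ⟨U, hU'⟩ := Ultrafilter.exists_le
      (𝓝[f '' (ball 0 1 \ {0})] w ⊓ 𝓟 {y | ¬ρ < ‖g y‖})
    have hUle := hU'.trans inf_le_left
    have hU : ∀ᶠ y in (U : Filter ℂ), ¬ρ < ‖g y‖ := Filter.le_principal_iff.1 (hU'.trans inf_le_right)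
    have hUE : ∀ᶠ y in (U : Filter ℂ), y ∈ f '' (ball 0 1 \ {0}) := hUle self_mem_nhdsWithin
    have hUw : Tendsto id (U : Filter ℂ) (𝓝 w) := hUle.trans nhdsWithin_le_nhds
    have hgmem : ∀ᶠ y in (U : Filter ℂ), g y ∈ closedBall (0 : ℂ) ρ := by
      filter_upwards [hU] with y hy
      rw [mem_closedBall_zero_iff]
      exact not_lt.1 hy
    have hfg : ∀ᶠ y in (U : Filter ℂ), f (g y) = y ∧ g y ∈ ball (0 : ℂ) 1 \ {0} := by
      filter_upwards [hUE] with y hy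
      obtain ⟨z, hz, rfl⟩ := hy
      rw [hg z hz]
      exact ⟨rfl, hz⟩
    obtain ⟨z, hz, hUz⟩ := (isCompact_closedBall (0 : ℂ) ρ).ultrafilter_le_nhds (U.map g)
      (by rw [Filter.le_principal_iff]; exact hgmem)
    have hUz : Tendsto g (U : Filter ℂ) (𝓝 z) := hUz
    have hfgw : Tendsto (fun y => f (g y)) (U : Filter ℂ) (𝓝 w) :=
      hUw.congr' (by filter_upwards [hfg] with y hy using hy.1.symm)
    rcases eq_or_ne z 0 with rfl | hz0
    · have h1 : Tendsto g (U : Filter ℂ) (𝓝[≠] 0) :=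
        tendsto_nhdsWithin_iff.2 ⟨hUz, by filter_upwards [hfg] with y hy using hy.2.2⟩
      have h2 := hf.tendsto_infinity.comp h1
      have h3 := (Metric.disjoint_nhds_cobounded w)
      exact (inferInstance : (map (fun y => f (g y)) (U : Filter ℂ)).NeBot).ne
        (disjoint_self.1 (h3.mono hfgw h2))
    · have hzD : z ∈ ball (0 : ℂ) 1 \ {0} :=
        ⟨by rw [mem_ball_zero_iff]; exact lt_of_le_of_lt (mem_closedBall_zero_iff.1 hz) hρ, hz0⟩
      have h1 := (hf.analyticAt hzD).continuousAt.tendsto.comp hUz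
      exact hw ⟨z, hzD, tendsto_nhds_unique h1 hfgw⟩
  · intro ρ hρ
    filter_upwards [self_mem_nhdsWithin] with y hy
    obtain ⟨z, hz, rfl⟩ := hy
    rw [hg z hz]
    exact lt_trans (mem_ball_zero_iff.1 hz.1) hρ

end IsUnivalentWithPole

/-! ### Local expansions of -(1 + z f''/f') at the pole and at boundary points -/

/-- The function `-(1 + z f'' / f')`. -/
noncomputable def negOneSubPreSchwarzian (f : ℂ → ℂ) (z : ℂ) : ℂ :=
  -(1 + z * deriv (deriv f) z / deriv f z)

/-- This and the next two formulas express F, F', F'' through k = `dslope F 0`, so that poles at t =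
0 cancel by algebra, without power series. -/
theorem eq_add_mul_dslope (F : ℂ → ℂ) (t : ℂ) : F t = F 0 + t * dslope F 0 t := by
  have := sub_smul_dslope F 0 t
  rw [sub_zero, smul_eq_mul] at this
  rw [this]; ring

theorem deriv_eq_of_dslope {F : ℂ → ℂ} {ρ : ℝ} (hρ : 0 < ρ) (hF : DifferentiableOn ℂ F (ball 0 ρ))
    {t : ℂ} (ht : t ∈ ball (0 : ℂ) ρ) :
    deriv F t = dslope F 0 t + t * deriv (dslope F 0) t := by
  have hk : DifferentiableOn ℂ (dslope F 0) (ball 0 ρ) :=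
    (Complex.differentiableOn_dslope (ball_mem_nhds 0 hρ)).2 hF
  have h1 : HasDerivAt (fun t => F 0 + t * dslope F 0 t)
      (1 * dslope F 0 t + t * deriv (dslope F 0) t) t :=
    ((hasDerivAt_id' t).fun_mul
      (hk.differentiableAt (isOpen_ball.mem_nhds ht)).hasDerivAt).const_add (F 0)
  have h2 : F = fun t => F 0 + t * dslope F 0 t := funext (eq_add_mul_dslope F)
  rw [← h2] at h1
  rw [h1.deriv, one_mul]

theorem deriv_deriv_eq_of_dslope {F : ℂ → ℂ} {ρ : ℝ} (hρ : 0 < ρ)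
    (hF : DifferentiableOn ℂ F (ball 0 ρ)) {t : ℂ} (ht : t ∈ ball (0 : ℂ) ρ) :
    deriv (deriv F) t = 2 * deriv (dslope F 0) t + t * deriv (deriv (dslope F 0)) t := by
  have hk : DifferentiableOn ℂ (dslope F 0) (ball 0 ρ) :=
    (Complex.differentiableOn_dslope (ball_mem_nhds 0 hρ)).2 hF
  have hk' := hk.deriv isOpen_ball
  have h1 : HasDerivAt (fun t => dslope F 0 t + t * deriv (dslope F 0) t)
      (deriv (dslope F 0) t + (1 * deriv (dslope F 0) t + t * deriv (deriv (dslope F 0)) t)) t :=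
    (hk.differentiableAt (isOpen_ball.mem_nhds ht)).hasDerivAt.fun_add ((hasDerivAt_id' t).fun_mul
      (hk'.differentiableAt (isOpen_ball.mem_nhds ht)).hasDerivAt)
  have h2 : deriv F =ᶠ[𝓝 t] fun t => dslope F 0 t + t * deriv (dslope F 0) t := by
    filter_upwards [isOpen_ball.mem_nhds ht] with s hs using deriv_eq_of_dslope hρ hF hs
  rw [h2.deriv_eq, h1.deriv]
  ring

namespace IsUnivalentWithPole

variable {f : ℂ → ℂ}

/-- For f = c/z + c₀ + c₁z + … the constant term drops out of f', so f''/f' = -2/z + O(z) and h = 1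
+ O(z²). This is the source of two of the three zeros of P_f at the origin. In the proof f = 1/W
with W = zk, and the quotient is 2k'/k - W''/W'. -/
theorem tendsto_negOneSubPreSchwarzian_zero (hf : IsUnivalentWithPole f) :
    Tendsto (fun z => (negOneSubPreSchwarzian f z - 1) / z) (𝓝[≠] 0) (𝓝 0) := by
  obtain ⟨W, hWa, hW0, hWd, hev⟩ := hf.exists_reciprocal
  obtain ⟨ρ, hρ, hWρ⟩ := hWa.exists_ball_analyticOnNhd
  have hWdiff : DifferentiableOn ℂ W (ball 0 ρ) := hWρ.differentiableOn
  have hk : DifferentiableOn ℂ (dslope W 0) (ball 0 ρ) :=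
    (Complex.differentiableOn_dslope (ball_mem_nhds 0 hρ)).2 hWdiff
  set k := dslope W 0 with hkdef
  have hk0 : k 0 = deriv W 0 := dslope_same W 0
  have hkc : ContinuousAt k 0 := (hk.differentiableAt (ball_mem_nhds 0 hρ)).continuousAt
  have hk'c : ContinuousAt (deriv k) 0 :=
    ((hk.deriv isOpen_ball).differentiableAt (ball_mem_nhds 0 hρ)).continuousAt
  have hW'c : ContinuousAt (deriv W) 0 :=
    ((hWdiff.deriv isOpen_ball).differentiableAt (ball_mem_nhds 0 hρ)).continuousAt
  have hW''c : ContinuousAt (deriv (deriv W)) 0 :=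
    (((hWdiff.deriv isOpen_ball).deriv isOpen_ball).differentiableAt
      (ball_mem_nhds 0 hρ)).continuousAt
  have hlim : Tendsto (fun z => 2 * deriv k z / k z - deriv (deriv W) z / deriv W z)
      (𝓝[≠] 0) (𝓝 0) := by
    have hc : ContinuousAt (fun z => 2 * deriv k z / k z - deriv (deriv W) z / deriv W z) 0 :=
      ((continuousAt_const.mul hk'c).div hkc (by rwa [hk0])).sub (hW''c.div hW'c hWd)
    have h0 : 2 * deriv k 0 / k 0 - deriv (deriv W) 0 / deriv W 0 = 0 := by
      rw [deriv_deriv_eq_of_dslope hρ hWdiff (mem_ball_self hρ), hk0, ← hkdef]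
      simp
    have := hc.tendsto.mono_left (nhdsWithin_le_nhds (s := {0}ᶜ))
    rwa [h0] at this
  refine hlim.congr' ?_
  have hev2 : ∀ᶠ z in 𝓝[≠] (0 : ℂ), ∀ᶠ y in 𝓝 z, W y ≠ 0 ∧ f y = (W y)⁻¹ := by
    rw [eventually_nhdsWithin_iff] at hev ⊢
    filter_upwards [hev.eventually_nhds] with z hz hz0
    filter_upwards [hz, isOpen_ne.mem_nhds hz0] with y hy hy0 using hy hy0
  have hk_ne : ∀ᶠ z in 𝓝[≠] (0 : ℂ), k z ≠ 0 :=
    nhdsWithin_le_nhds (hkc.eventually_ne (by rwa [hk0]))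
  have hW'_ne : ∀ᶠ z in 𝓝[≠] (0 : ℂ), deriv W z ≠ 0 :=
    nhdsWithin_le_nhds (hW'c.eventually_ne hWd)
  filter_upwards [hev2, hk_ne, hW'_ne, self_mem_nhdsWithin,
    nhdsWithin_le_nhds (ball_mem_nhds (0 : ℂ) hρ)] with z hz hkz hWz hz0 hzρ
  have hz0 : z ≠ 0 := hz0
  have hWz0 : W z ≠ 0 := hz.self_of_nhds.1
  have hd1 : ∀ y ∈ ball (0 : ℂ) ρ, HasDerivAt W (deriv W y) y := fun y hy =>
    (hWdiff.differentiableAt (isOpen_ball.mem_nhds hy)).hasDerivAt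
  have hd2 : HasDerivAt (deriv W) (deriv (deriv W) z) z :=
    ((hWdiff.deriv isOpen_ball).differentiableAt (isOpen_ball.mem_nhds hzρ)).hasDerivAt
  have hf1 : deriv f =ᶠ[𝓝 z] fun y => -deriv W y / W y ^ 2 := by
    filter_upwards [hz.eventually_nhds, isOpen_ball.mem_nhds hzρ] with y hy hyρ
    have h1 : f =ᶠ[𝓝 y] fun y => (W y)⁻¹ := by filter_upwards [hy] with x hx using hx.2
    rw [h1.deriv_eq, ((hd1 y hyρ).fun_inv hy.self_of_nhds.1).deriv]
  have hf2 := hf1.deriv_eq.trans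
    (hd2.fun_neg.fun_div ((hd1 z hzρ).fun_pow 2) (pow_ne_zero 2 hWz0)).deriv
  have hkey : W z = z * k z := by rw [eq_add_mul_dslope W z, hW0, zero_add]
  have hW1 : deriv W z = k z + z * deriv k z := deriv_eq_of_dslope hρ hWdiff hzρ
  have hf1z : deriv f z = -deriv W z / W z ^ 2 := hf1.self_of_nhds
  rw [negOneSubPreSchwarzian, hf2, hf1z]
  have hW1' : z * deriv k z = deriv W z - k z := by rw [hW1]; ring
  have : deriv k z = (deriv W z - k z) / z := by rw [← hW1']; field_simp
  rw [this, hkey]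
  generalize deriv W z = A at *
  generalize deriv (deriv W) z = B
  generalize k z = K at *
  field_simp
  ring

/-- The behaviour of `-(1 + z f'' / f')` at a boundary point where `f` composed with a conformal
map of a half disk is a power. -/
theorem tendsto_negOneSubPreSchwarzian_sub (hf : IsUnivalentWithPole f) {F : ℂ → ℂ} {ρ α : ℝ}
    {w₀ u : ℂ} (hρ : 0 < ρ) (hα : α ≠ 0) (hu : u ≠ 0)
    (hF : DifferentiableOn ℂ F (ball 0 ρ)) (hd : deriv F 0 ≠ 0)
    (hmaps : ∀ t ∈ ball (0 : ℂ) ρ, 0 < t.im → F t ∈ ball (0 : ℂ) 1 \ {0})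
    (hfF : ∀ t ∈ ball (0 : ℂ) ρ, 0 < t.im → f (F t) = w₀ + u * t ^ (α : ℂ)) :
    Tendsto (fun t => negOneSubPreSchwarzian f (F t) -
        (α - 1) / 2 * ((F 0 + F t) / (F 0 - F t))) (𝓝[{t | 0 < t.im}] 0)
      (𝓝 (((-(1 + (α - 1) / 2) : ℝ) : ℂ) *
        (1 - 2 * deriv (dslope F 0) 0 * F 0 / deriv F 0 ^ 2))) := by
  set k := dslope F 0 with hkdef
  have hk : DifferentiableOn ℂ k (ball 0 ρ) :=
    (Complex.differentiableOn_dslope (ball_mem_nhds 0 hρ)).2 hF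
  have hk0 : k 0 = deriv F 0 := dslope_same F 0
  have hkc : ContinuousAt k 0 := (hk.differentiableAt (ball_mem_nhds 0 hρ)).continuousAt
  have hk'c : ContinuousAt (deriv k) 0 :=
    ((hk.deriv isOpen_ball).differentiableAt (ball_mem_nhds 0 hρ)).continuousAt
  have hFc : ContinuousAt F 0 := (hF.differentiableAt (ball_mem_nhds 0 hρ)).continuousAt
  have hF'c : ContinuousAt (deriv F) 0 :=
    ((hF.deriv isOpen_ball).differentiableAt (ball_mem_nhds 0 hρ)).continuousAt
  have hF''c : ContinuousAt (deriv (deriv F)) 0 :=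
    (((hF.deriv isOpen_ball).deriv isOpen_ball).differentiableAt
      (ball_mem_nhds 0 hρ)).continuousAt
  have hk00 : k 0 ≠ 0 := by rwa [hk0]
  -- The given difference after its 1/t poles have cancelled. It is continuous at 0 because k(0) =
  -- F'(0) ≠ 0.
  set Ψ : ℂ → ℂ := fun t => -1 + F t * deriv (deriv F) t / deriv F t ^ 2 -
    (α - 1) * ((k t ^ 2 - 2 * F 0 * deriv k t - t * k t * deriv k t) /
      (2 * k t * deriv F t)) with hΨ
  have hlim : Tendsto Ψ (𝓝[{t | 0 < t.im}] 0) (𝓝 (((-(1 + (α - 1) / 2) : ℝ) : ℂ) *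
        (1 - 2 * deriv k 0 * F 0 / deriv F 0 ^ 2))) := by
    have hc : ContinuousAt Ψ 0 := by
      refine (continuousAt_const.add ((hFc.mul hF''c).div (hF'c.pow 2) (pow_ne_zero 2 hd))).sub
        (continuousAt_const.mul (ContinuousAt.div ?_ ?_ ?_))
      · exact ((hkc.pow 2).sub (continuousAt_const.mul hk'c)).sub
          ((continuousAt_id.mul hkc).mul hk'c)
      · exact (continuousAt_const.mul hkc).mul hF'c
      · exact mul_ne_zero (mul_ne_zero two_ne_zero hk00) hd
    have h0 : Ψ 0 = ((-(1 + (α - 1) / 2) : ℝ) : ℂ) *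
        (1 - 2 * deriv k 0 * F 0 / deriv F 0 ^ 2) := by
      rw [hΨ]
      simp only
      rw [deriv_deriv_eq_of_dslope hρ hF (mem_ball_self hρ), hk0, ← hkdef]
      push_cast
      field_simp
      ring
    have := hc.tendsto.mono_left (nhdsWithin_le_nhds (s := {t : ℂ | 0 < t.im}))
    rwa [h0] at this
  refine hlim.congr' ?_
  have hk_ne : ∀ᶠ z in 𝓝[{t : ℂ | 0 < t.im}] (0 : ℂ), k z ≠ 0 :=
    nhdsWithin_le_nhds (hkc.eventually_ne hk00)
  have hF'_ne : ∀ᶠ z in 𝓝[{t : ℂ | 0 < t.im}] (0 : ℂ), deriv F z ≠ 0 :=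
    nhdsWithin_le_nhds (hF'c.eventually_ne hd)
  filter_upwards [hk_ne, hF'_ne, self_mem_nhdsWithin,
    nhdsWithin_le_nhds (ball_mem_nhds (0 : ℂ) hρ)] with t hkt hFt hti htρ
  have hti : 0 < t.im := hti
  have hslit : ∀ s : ℂ, 0 < s.im → s ∈ Complex.slitPlane := fun s hs => Or.inr hs.ne'
  have ht0 : t ≠ 0 := by rintro rfl; simp at hti
  have hopen := isOpen_ball_inter_im_pos ρ
  have hF1 : ∀ s ∈ ball (0 : ℂ) ρ, HasDerivAt F (deriv F s) s := fun s hs =>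
    (hF.differentiableAt (isOpen_ball.mem_nhds hs)).hasDerivAt
  have hF2 : HasDerivAt (deriv F) (deriv (deriv F) t) t :=
    ((hF.deriv isOpen_ball).differentiableAt (isOpen_ball.mem_nhds htρ)).hasDerivAt
  have e1 : ∀ s ∈ ball (0 : ℂ) ρ, 0 < s.im →
      deriv f (F s) * deriv F s = u * (α * s ^ ((α : ℂ) - 1)) := by
    intro s hs hsi
    have h1 : HasDerivAt (fun s => f (F s)) (deriv f (F s) * deriv F s) s :=
      ((hf.analyticAt (hmaps s hs hsi)).differentiableAt.hasDerivAt).comp s (hF1 s hs)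
    have h2 : HasDerivAt (fun s => w₀ + u * s ^ (α : ℂ)) (u * (α * s ^ ((α : ℂ) - 1))) s := by
      have := ((hasDerivAt_id' s).cpow_const (c := (α : ℂ)) (hslit s hsi))
      simpa using (this.const_mul u).const_add w₀
    have h3 : (fun s => f (F s)) =ᶠ[𝓝 s] fun s => w₀ + u * s ^ (α : ℂ) := by
      filter_upwards [hopen.mem_nhds ⟨hs, hsi⟩] with y hy using hfF y hy.1 hy.2
    exact h1.unique (h2.congr_of_eventuallyEq h3)
  have e2 : deriv (deriv f) (F t) * deriv F t * deriv F t + deriv f (F t) * deriv (deriv F) t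
      = u * (α * (((α : ℂ) - 1) * t ^ ((α : ℂ) - 1 - 1))) := by
    have h1 : HasDerivAt (fun s => deriv f (F s) * deriv F s)
        (deriv (deriv f) (F t) * deriv F t * deriv F t + deriv f (F t) * deriv (deriv F) t) t :=
      (((hf.analyticAt (hmaps t htρ hti)).deriv.differentiableAt.hasDerivAt).comp t
        (hF1 t htρ)).fun_mul hF2
    have h2 : HasDerivAt (fun s => u * (α * s ^ ((α : ℂ) - 1)))
        (u * (α * (((α : ℂ) - 1) * t ^ ((α : ℂ) - 1 - 1)))) t := by
      have := ((hasDerivAt_id' t).cpow_const (c := (α : ℂ) - 1) (hslit t hti))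
      simpa using (this.const_mul (α : ℂ)).const_mul u
    have h3 : (fun s => deriv f (F s) * deriv F s) =ᶠ[𝓝 t]
        fun s => u * (α * s ^ ((α : ℂ) - 1)) := by
      filter_upwards [hopen.mem_nhds ⟨htρ, hti⟩] with y hy using e1 y hy.1 hy.2
    exact h1.unique (h2.congr_of_eventuallyEq h3)
  have e1 := e1 t htρ hti
  rw [Complex.cpow_sub _ _ ht0, Complex.cpow_one] at e1 e2
  rw [Complex.cpow_sub _ _ ht0, Complex.cpow_one] at e2
  have hP : t ^ (α : ℂ) ≠ 0 := by simp [Complex.cpow_eq_zero_iff, ht0]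
  have hα' : (α : ℂ) ≠ 0 := by exact_mod_cast hα
  have hf' : deriv f (F t) ≠ 0 := hf.deriv_ne_zero (hmaps t htρ hti)
  have hFk := eq_add_mul_dslope F t
  rw [← hkdef] at hFk
  have hFk' := deriv_eq_of_dslope hρ hF htρ
  rw [← hkdef] at hFk'
  have hdk : deriv k t = (deriv F t - k t) / t := by rw [hFk']; field_simp; ring
  rw [hΨ, negOneSubPreSchwarzian]
  simp only
  -- The logarithmic derivative of f'(F) F' = uα t^(α-1).
  have hquot : deriv (deriv f) (F t) / deriv f (F t) =
      ((α - 1) / t - deriv (deriv F) t / deriv F t) / deriv F t := by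
    have h1 : deriv f (F t) = u * (α * (t ^ (α : ℂ) / t)) / deriv F t := by
      rw [← e1]; field_simp
    have h2 : deriv (deriv f) (F t) = (u * (α * (((α : ℂ) - 1) * (t ^ (α : ℂ) / t / t))) -
        deriv f (F t) * deriv (deriv F) t) / deriv F t / deriv F t := by
      rw [← e2]; field_simp; ring
    rw [h2, h1]
    field_simp
  rw [mul_div_assoc (F t) (deriv (deriv f) (F t)), hquot, hFk, hdk]
  generalize deriv F t = A at *
  generalize deriv (deriv F) t = B
  generalize k t = K at *
  generalize F 0 = Z
  have : Z - (Z + t * K) ≠ 0 := by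
    rw [sub_add_cancel_left]; exact neg_ne_zero.2 (mul_ne_zero ht0 hkt)
  field_simp
  ring

end IsUnivalentWithPole

/-! ### Boundary behaviour at sectors -/

/-- The open circular sector with vertex `w₀`, radius `r` and angle `β`, with first side in the
direction `u`. -/
def circularSector (w₀ u : ℂ) (β r : ℝ) : Set ℂ :=
  {w | ∃ s φ : ℝ, 0 < s ∧ s < r ∧ 0 < φ ∧ φ < β ∧ w = w₀ + s * (u * Complex.exp (φ * Complex.I))}

theorem cpow_ofReal_eq_polar {t : ℂ} (ht : t ≠ 0) (α : ℝ) :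
    t ^ (α : ℂ) = ((‖t‖ ^ α : ℝ) : ℂ) * Complex.exp ((t.arg * α : ℝ) * Complex.I) := by
  rw [Complex.cpow_def_of_ne_zero ht, Complex.log, add_mul, Complex.exp_add,
    Real.rpow_def_of_pos (norm_pos_iff.2 ht)]
  push_cast
  congr 2
  ring

/-- On the negative axis the principal logarithm is continuous only from above, where its argument
is π; the approach from the upper half plane is essential. -/
theorem tendsto_cpow_nhdsWithin_im_pos (x : ℝ) {α : ℝ} (hα : 0 < α) :
    Tendsto (fun t : ℂ => t ^ (α : ℂ)) (𝓝[{t | 0 < t.im}] (x : ℂ)) (𝓝 ((x : ℂ) ^ (α : ℂ))) := by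
  have hα' : (α : ℂ) ≠ 0 := by exact_mod_cast hα.ne'
  rcases lt_trichotomy x 0 with h | h | h
  · have h0 : (x : ℂ) ≠ 0 := by exact_mod_cast h.ne
    have h1 : Tendsto Complex.log (𝓝[{t | 0 < t.im}] (x : ℂ)) (𝓝 (Complex.log x)) :=
      (Complex.continuousWithinAt_log_of_re_neg_of_im_zero (by simpa using h) (by simp)).mono
        (fun t (ht : 0 < t.im) => ht.le)
    have h2 : Tendsto (fun t => Complex.exp (Complex.log t * α)) (𝓝[{t | 0 < t.im}] (x : ℂ))
        (𝓝 (Complex.exp (Complex.log x * α))) :=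
      (Complex.continuous_exp.tendsto _).comp (h1.mul_const _)
    rw [Complex.cpow_def_of_ne_zero h0]
    refine h2.congr' ?_
    filter_upwards [self_mem_nhdsWithin] with t ht
    rw [Complex.cpow_def_of_ne_zero]
    rintro rfl
    exact lt_irrefl (0 : ℝ) ht
  · subst h
    rw [Complex.ofReal_zero, Complex.zero_cpow hα', tendsto_zero_iff_norm_tendsto_zero]
    have h1 : Tendsto (fun t : ℂ => ‖t‖ ^ α) (𝓝[{t | 0 < t.im}] 0) (𝓝 0) := by
      have : Continuous fun t : ℂ => ‖t‖ ^ α := continuous_norm.rpow_const fun _ => Or.inr hα.le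
      have := (this.tendsto 0).mono_left (nhdsWithin_le_nhds (s := {t : ℂ | 0 < t.im}))
      simpa [Real.zero_rpow hα.ne'] using this
    refine h1.congr' ?_
    filter_upwards [self_mem_nhdsWithin] with t ht
    have h0 : t ≠ 0 := by
      rintro rfl
      exact lt_irrefl (0 : ℝ) ht
    rw [Complex.norm_cpow_real]
  · exact ((continuousAt_cpow_const (Or.inl (by simpa using h))).tendsto).mono_left
      nhdsWithin_le_nhds

theorem polar_unique {s ρ φ θ : ℝ} (hs : 0 < s) (hρ : 0 ≤ ρ) (hφθ : |φ - θ| < 2 * Real.pi)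
    (h : (s : ℂ) * Complex.exp (φ * Complex.I) = ρ * Complex.exp (θ * Complex.I)) :
    s = ρ ∧ φ = θ := by
  have h1 : s = ρ := by
    have := congrArg norm h
    simpa [Complex.norm_exp_ofReal_mul_I, abs_of_pos hs, abs_of_nonneg hρ] using this
  refine ⟨h1, ?_⟩
  rw [← h1] at h
  have h2 := mul_left_cancel₀ (by exact_mod_cast hs.ne' : (s : ℂ) ≠ 0) h
  obtain ⟨n, hn⟩ := Complex.exp_eq_exp_iff_exists_int.1 h2
  have h3 : φ = θ + n * (2 * Real.pi) := by
    have := congrArg Complex.im hn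
    simpa using this
  have h4 : n = 0 := by
    rw [h3, add_sub_cancel_left, abs_mul, abs_of_pos (by positivity : (0 : ℝ) < 2 * Real.pi)] at hφθ
    have h5 : |(n : ℝ)| < 1 := by
      by_contra hcon
      rw [not_lt] at hcon
      nlinarith [Real.pi_pos]
    exact Int.abs_lt_one_iff.1 (by exact_mod_cast h5)
  rw [h3, h4]; simp

/-- The power map takes the upper half plane near `0` onto a sector. -/
theorem nhdsWithin_sector_le_map {E : Set ℂ} {w₀ u : ℂ} {α r : ℝ} (hα : 0 < α)
    (hr : 0 < r) (hu : ‖u‖ = 1)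
    (hE : E ∩ ball w₀ r = circularSector w₀ u (α * Real.pi) r) :
    𝓝[E] w₀ ≤ map (fun t : ℂ => w₀ + u * t ^ (α : ℂ)) (𝓝[{t | 0 < t.im}] 0) := by
  intro S hS
  obtain ⟨δ, hδ, hSδ⟩ := Metric.mem_nhdsWithin_iff.1 (Filter.mem_map.1 hS)
  rw [Metric.mem_nhdsWithin_iff]
  refine ⟨min r (δ ^ α), lt_min hr (Real.rpow_pos_of_pos hδ α), ?_⟩
  rintro w ⟨hw, hwE⟩
  have hw' : w ∈ circularSector w₀ u (α * Real.pi) r := by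
    rw [← hE]
    exact ⟨hwE, ball_subset_ball (min_le_left _ _) hw⟩
  obtain ⟨s, φ, hs, hsr, hφ0, hφ, rfl⟩ := hw'
  have hsδ : s < δ ^ α := by
    rw [mem_ball, dist_eq_norm, add_sub_cancel_left, norm_mul, norm_mul, hu,
      Complex.norm_exp_ofReal_mul_I, Complex.norm_real, Real.norm_of_nonneg hs.le, mul_one,
      mul_one] at hw
    exact lt_of_lt_of_le hw (min_le_right _ _)
  have hφα : φ / α < Real.pi := by rw [div_lt_iff₀ hα]; linarith
  have hφα0 : 0 < φ / α := by positivity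
  set t : ℂ := ((s ^ α⁻¹ : ℝ) : ℂ) * Complex.exp ((φ / α : ℝ) * Complex.I) with ht
  have hsα : 0 < s ^ α⁻¹ := Real.rpow_pos_of_pos hs _
  have htn : ‖t‖ = s ^ α⁻¹ := by
    rw [ht, norm_mul, Complex.norm_exp_ofReal_mul_I, Complex.norm_real,
      Real.norm_of_nonneg hsα.le, mul_one]
  have hta : t.arg = φ / α := by
    rw [ht, Complex.exp_mul_I, Complex.arg_mul_cos_add_sin_mul_I hsα
      ⟨by linarith [Real.pi_pos], hφα.le⟩]
  have ht0 : t ≠ 0 := norm_pos_iff.1 (by rw [htn]; exact hsα)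
  have hti : 0 < t.im := by
    rw [ht, Complex.im_ofReal_mul, Complex.exp_ofReal_mul_I_im]
    exact mul_pos hsα (Real.sin_pos_of_pos_of_lt_pi hφα0 hφα)
  have htb : t ∈ ball (0 : ℂ) δ := by
    rw [mem_ball_zero_iff, htn]
    calc s ^ α⁻¹ < (δ ^ α) ^ α⁻¹ := Real.rpow_lt_rpow hs.le hsδ (inv_pos.2 hα)
      _ = δ := by rw [← Real.rpow_mul hδ.le, mul_inv_cancel₀ hα.ne', Real.rpow_one]
  have := hSδ ⟨htb, hti⟩
  rw [mem_preimage, cpow_ofReal_eq_polar ht0, htn, hta, ← Real.rpow_mul hs.le,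
    inv_mul_cancel₀ hα.ne', Real.rpow_one, div_mul_cancel₀ _ hα.ne'] at this
  convert this using 2
  ring

namespace IsUnivalentWithPole

variable {f : ℂ → ℂ}

/-- The boundary correspondence at a boundary point where the image is a sector. -/
theorem exists_boundary_point (hf : IsUnivalentWithPole f) {g : ℂ → ℂ}
    (hg : ∀ z ∈ ball (0 : ℂ) 1 \ {0}, g (f z) = z)
    (hgd : DifferentiableOn ℂ g (f '' (ball 0 1 \ {0}))) {w₀ u : ℂ} {α r : ℝ}
    (hα : 0 < α) (hα2 : α < 2) (hr : 0 < r) (hu : ‖u‖ = 1)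
    (hE : f '' (ball 0 1 \ {0}) ∩ ball w₀ r = circularSector w₀ u (α * Real.pi) r) :
    ∃ ζ : ℂ, ‖ζ‖ = 1 ∧ Tendsto f (𝓝[ball 0 1] ζ) (𝓝 w₀) ∧
      Tendsto g (𝓝[f '' (ball 0 1 \ {0})] w₀) (𝓝 ζ) ∧
      Tendsto (fun z => (negOneSubPreSchwarzian f z - (α - 1) / 2 * ((ζ + z) / (ζ - z))).re)
        (𝓝[ball 0 1] ζ) (𝓝 0) := by
  set E := f '' (ball 0 1 \ {0}) with hEdef
  have hEo : IsOpen E := hf.isOpen_image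
  have hgE : ∀ w ∈ E, g w ∈ ball (0 : ℂ) 1 \ {0} ∧ f (g w) = w := by
    rintro _ ⟨z, hz, rfl⟩
    rw [hg z hz]
    exact ⟨hz, rfl⟩
  -- τ carries the upper half disk of radius R = r^(1/α) into the sector of angle απ, so g ∘ τ is a
  -- function on a half disk to which reflection applies.
  set τ : ℂ → ℂ := fun t => w₀ + u * t ^ (α : ℂ) with hτ
  set R : ℝ := r ^ α⁻¹ with hR
  have hR0 : 0 < R := Real.rpow_pos_of_pos hr _
  have hRα : ∀ t : ℂ, ‖t‖ < R → ‖t‖ ^ α < r := by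
    intro t ht
    calc ‖t‖ ^ α < R ^ α := Real.rpow_lt_rpow (norm_nonneg t) ht hα
      _ = r := by rw [hR, ← Real.rpow_mul hr.le, inv_mul_cancel₀ hα.ne', Real.rpow_one]
  have hne0 : ∀ t : ℂ, 0 < t.im → t ≠ 0 := by
    rintro t ht rfl; exact lt_irrefl (0 : ℝ) ht
  have hτE : ∀ t ∈ ball (0 : ℂ) R, 0 < t.im → τ t ∈ E := by
    intro t ht hti
    have h1 : τ t ∈ circularSector w₀ u (α * Real.pi) r := by
      refine ⟨‖t‖ ^ α, t.arg * α, Real.rpow_pos_of_pos (norm_pos_iff.2 (hne0 t hti)) α,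
        hRα t (mem_ball_zero_iff.1 ht), ?_, ?_, ?_⟩
      · refine mul_pos (lt_of_le_of_ne (Complex.arg_nonneg_iff.2 hti.le) ?_) hα
        intro h0
        have := (Complex.arg_eq_zero_iff.1 h0.symm).2
        linarith
      · rw [mul_comm]
        refine mul_lt_mul_of_pos_left (lt_of_le_of_ne (Complex.arg_le_pi t) ?_) hα
        intro h0
        have := (Complex.arg_eq_pi_iff.1 h0).2
        linarith
      · rw [hτ]
        simp only
        rw [cpow_ofReal_eq_polar (hne0 t hti)]
        ring
    rw [← hE] at h1
    exact h1.1
  have hτd : ∀ t : ℂ, 0 < t.im → DifferentiableAt ℂ τ t := by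
    intro t ht
    have := ((hasDerivAt_id' t).cpow_const (c := (α : ℂ)) (Or.inr ht.ne'))
    exact ((this.const_mul u).const_add w₀).differentiableAt
  have hGd : DifferentiableOn ℂ (fun t => g (τ t)) {t | t ∈ ball (0 : ℂ) R ∧ 0 < t.im} := by
    intro t ht
    exact ((hgd.differentiableAt (hEo.mem_nhds (hτE t ht.1 ht.2))).comp t
      (hτd t ht.2)).differentiableWithinAt
  have hlim : ∀ x : ℝ, |x| < R →
      Tendsto (fun t => ‖g (τ t)‖) (𝓝[{t | 0 < t.im}] (x : ℂ)) (𝓝 1) := by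
    intro x hx
    have hxR : ‖(x : ℂ)‖ < R := by simpa using hx
    -- The real axis goes to the sides of the sector, at the angles 0 and απ. As α < 2, these differ
    -- by less than 2π from any angle strictly between them, so polar coordinates separate the sides
    -- from the open sector.
    have h1 : τ x ∉ E := by
      intro h
      have hb : τ x ∈ ball w₀ r := by
        rw [mem_ball, dist_eq_norm, hτ]
        simp only [add_sub_cancel_left]
        rw [norm_mul, hu, one_mul, Complex.norm_cpow_real]
        exact hRα _ hxR
      have h2 : τ x ∈ circularSector w₀ u (α * Real.pi) r := by
        rw [← hE]; exact ⟨h, hb⟩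
      obtain ⟨s, φ, hs, hsr, hφ0, hφ, heq⟩ := h2
      have hu0 : u ≠ 0 := norm_pos_iff.1 (by rw [hu]; exact one_pos)
      have h3 : (s : ℂ) * Complex.exp (φ * Complex.I) = (x : ℂ) ^ (α : ℂ) := by
        rw [hτ] at heq
        have h4 : u * (x : ℂ) ^ (α : ℂ) = u * (s * Complex.exp (φ * Complex.I)) := by
          have := add_left_cancel heq
          rw [this]; ring
        exact (mul_left_cancel₀ hu0 h4).symm
      have hα' : (α : ℂ) ≠ 0 := by exact_mod_cast hα.ne'
      rcases lt_trichotomy x 0 with h | h | h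
      · rw [cpow_ofReal_eq_polar (by exact_mod_cast h.ne), Complex.arg_ofReal_of_neg h] at h3
        have := (polar_unique hs (Real.rpow_nonneg (norm_nonneg _) _) ?_ h3).2
        · linarith
        · rw [abs_lt]; constructor <;> nlinarith [Real.pi_pos]
      · rw [h, Complex.ofReal_zero, Complex.zero_cpow hα'] at h3
        exact (mul_ne_zero (by exact_mod_cast hs.ne') (Complex.exp_ne_zero _)) h3
      · rw [cpow_ofReal_eq_polar (by exact_mod_cast h.ne'), Complex.arg_ofReal_of_nonneg h.le,
          zero_mul] at h3
        have := (polar_unique hs (Real.rpow_nonneg (norm_nonneg _) _) ?_ h3).2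
        · linarith
        · rw [abs_lt]; constructor <;> nlinarith [Real.pi_pos]
    refine (hf.tendsto_norm_inverse hg h1).comp ?_
    refine tendsto_nhdsWithin_iff.2 ⟨?_, ?_⟩
    · exact ((tendsto_cpow_nhdsWithin_im_pos x hα).const_mul u).const_add w₀
    · filter_upwards [self_mem_nhdsWithin,
        nhdsWithin_le_nhds (isOpen_ball.mem_nhds (mem_ball_zero_iff.2 hxR))] with t h1 h2
      exact hτE t h2 h1
  obtain ⟨ρ, hρ, hρR, F, hFd, hFG, hFreal, hFneg⟩ := exists_reflection hR0 hGd
    (fun t ht hi => mem_ball_zero_iff.1 (hgE _ (hτE t ht hi)).1.1) hlim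
  have hsub : ball (0 : ℂ) ρ ⊆ ball 0 R := ball_subset_ball hρR
  have hζ : ‖F 0‖ = 1 := by simpa using hFreal 0 (by simpa using hρ)
  have hFmem : ∀ t ∈ ball (0 : ℂ) ρ, 0 < t.im → F t ∈ ball (0 : ℂ) 1 \ {0} := by
    intro t ht hi
    rw [hFG t ht hi]
    exact (hgE _ (hτE t (hsub ht) hi)).1
  have hfF : ∀ t ∈ ball (0 : ℂ) ρ, 0 < t.im → f (F t) = w₀ + u * t ^ (α : ℂ) := by
    intro t ht hi
    rw [hFG t ht hi]
    exact (hgE _ (hτE t (hsub ht) hi)).2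
  have hd := deriv_ne_zero_of_norm_lt_one hρ hFd
    (fun t ht hi => mem_ball_zero_iff.1 (hFmem t ht hi).1) hζ
  have hle := nhdsWithin_ball_le_map hρ hFd hd hFreal hFneg
  have hu0 : u ≠ 0 := norm_pos_iff.1 (by rw [hu]; exact one_pos)
  have hτ0 : Tendsto τ (𝓝[{t | 0 < t.im}] 0) (𝓝 w₀) := by
    have hα' : (α : ℂ) ≠ 0 := by exact_mod_cast hα.ne'
    have := ((tendsto_cpow_nhdsWithin_im_pos 0 hα).const_mul u).const_add w₀
    simpa [Complex.zero_cpow hα'] using this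
  refine ⟨F 0, hζ, ?_, ?_, ?_⟩
  · refine Tendsto.mono_left ?_ hle
    rw [tendsto_map'_iff]
    refine hτ0.congr' ?_
    filter_upwards [self_mem_nhdsWithin, nhdsWithin_le_nhds (ball_mem_nhds (0 : ℂ) hρ)] with t h1 h2
    exact (hfF t h2 h1).symm
  · refine Tendsto.mono_left ?_ (nhdsWithin_sector_le_map hα hr hu hE)
    rw [tendsto_map'_iff]
    have hc : ContinuousAt F 0 := (hFd.differentiableAt (ball_mem_nhds 0 hρ)).continuousAt
    refine (hc.tendsto.mono_left (nhdsWithin_le_nhds (s := {t : ℂ | 0 < t.im}))).congr' ?_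
    filter_upwards [self_mem_nhdsWithin, nhdsWithin_le_nhds (ball_mem_nhds (0 : ℂ) hρ)] with t h1 h2
    exact hFG t h2 h1
  · refine Tendsto.mono_left ?_ hle
    rw [tendsto_map'_iff]
    have h1 := hf.tendsto_negOneSubPreSchwarzian_sub hρ hα.ne' hu0 hFd hd hFmem hfF
    have h2 := (Complex.continuous_re.tendsto _).comp h1
    rw [Complex.re_ofReal_mul, re_one_sub_deriv_dslope hρ hFd hd hFreal, mul_zero] at h2
    exact h2

end IsUnivalentWithPole

/-! ### The Schwarz–Christoffel formula -/

/-- A point of the unit circle is a limit of points of the punctured unit disk. -/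
theorem neBot_nhdsWithin_ball {ζ : ℂ} (hζ : ‖ζ‖ = 1) : (𝓝[ball (0 : ℂ) 1] ζ).NeBot := by
  rw [← mem_closure_iff_nhdsWithin_neBot, closure_ball _ one_ne_zero]
  simp [hζ]

/-- A holomorphic function on the unit disk whose real part is small near the unit circle has small
real part. -/
theorem re_le_of_tendsto_re {H : ℂ → ℂ} (hH : DifferentiableOn ℂ H (ball 0 1))
    (hlim : ∀ ζ : ℂ, ‖ζ‖ = 1 → Tendsto (fun z => (H z).re) (𝓝[ball 0 1] ζ) (𝓝 0))
    {z₀ : ℂ} (hz₀ : z₀ ∈ ball (0 : ℂ) 1) : (H z₀).re ≤ 0 := by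
  refine le_of_forall_pos_le_add fun ε hε => ?_
  rw [zero_add]
  have h1 : ∀ ζ ∈ sphere (0 : ℂ) 1, ∃ V : Set ℂ, IsOpen V ∧ ζ ∈ V ∧
      ∀ z ∈ V ∩ ball 0 1, (H z).re < ε := by
    intro ζ hζ
    have h2 := (hlim ζ (mem_sphere_zero_iff_norm.1 hζ)).eventually (gt_mem_nhds hε)
    obtain ⟨V, hV, hζV, hVs⟩ := mem_nhdsWithin.1 h2
    exact ⟨V, hV, hζV, fun z hz => hVs hz⟩
  choose! V hVo hV hVε using h1
  set W := ⋃ ζ ∈ sphere (0 : ℂ) 1, V ζ with hW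
  have hWo : IsOpen W := isOpen_biUnion hVo
  have hWε : ∀ z ∈ ball (0 : ℂ) 1, z ∈ W → (H z).re < ε := by
    intro z hz hzW
    obtain ⟨ζ, hζ, hzV⟩ := mem_iUnion₂.1 hzW
    exact hVε ζ hζ z ⟨hzV, hz⟩
  -- Outside `W` only a compact part of the open disk remains. A circle of radius ρ < 1 beyond it
  -- and beyond z₀ lies in `W`, and the maximum principle applies to exp H.
  have hK : IsCompact (insert z₀ (closedBall (0 : ℂ) 1 \ W)) :=
    ((isCompact_closedBall 0 1).diff hWo).insert z₀
  obtain ⟨z₁, hz₁, hmax⟩ := hK.exists_isMaxOn ⟨z₀, mem_insert _ _⟩ continuous_norm.continuousOn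
  have hz₁lt : ‖z₁‖ < 1 := by
    rcases hz₁ with rfl | hz₁
    · exact mem_ball_zero_iff.1 hz₀
    · refine lt_of_le_of_ne (mem_closedBall_zero_iff.1 hz₁.1) fun h => hz₁.2 ?_
      have : z₁ ∈ sphere (0 : ℂ) 1 := mem_sphere_zero_iff_norm.2 h
      exact mem_iUnion₂.2 ⟨z₁, this, hV z₁ this⟩
  obtain ⟨ρ, hρ1, hρ2⟩ := exists_between hz₁lt
  have hρ0 : 0 < ρ := lt_of_le_of_lt (norm_nonneg _) hρ1
  have hcl : closedBall (0 : ℂ) ρ ⊆ ball 0 1 := closedBall_subset_ball hρ2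
  have hdiff : DiffContOnCl ℂ (fun z => Complex.exp (H z)) (ball 0 ρ) := by
    refine DifferentiableOn.diffContOnCl ?_
    rw [closure_ball _ hρ0.ne']
    exact (hH.mono hcl).cexp
  have hbd := Complex.norm_le_of_forall_mem_frontier_norm_le isBounded_ball hdiff
    (C := Real.exp ε) (by
      intro z hz
      rw [frontier_ball _ hρ0.ne', mem_sphere_zero_iff_norm] at hz
      rw [Complex.norm_exp]
      refine Real.exp_le_exp.2 (hWε z (by rw [mem_ball_zero_iff, hz]; exact hρ2) ?_).le
      by_contra hzW
      have := hmax (mem_insert_of_mem _ ⟨mem_closedBall_zero_iff.2 (by rw [hz]; exact hρ2.le), hzW⟩)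
      have : ‖z‖ ≤ ‖z₁‖ := this
      linarith)
    (z := z₀) (by
      rw [closure_ball _ hρ0.ne', mem_closedBall_zero_iff]
      have : ‖z₀‖ ≤ ‖z₁‖ := hmax (mem_insert _ _)
      linarith)
  rw [Complex.norm_exp] at hbd
  exact Real.exp_le_exp.1 hbd

/-- The bound for H and for -H makes the real part vanish identically, and the open mapping theorem
does the rest. -/
theorem eq_const_of_tendsto_re {H : ℂ → ℂ} (hH : DifferentiableOn ℂ H (ball 0 1))
    (hlim : ∀ ζ : ℂ, ‖ζ‖ = 1 → Tendsto (fun z => (H z).re) (𝓝[ball 0 1] ζ) (𝓝 0)) :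
    (H 0).re = 0 ∧ ∀ z ∈ ball (0 : ℂ) 1, H z = H 0 := by
  have hre : ∀ z ∈ ball (0 : ℂ) 1, (H z).re = 0 := by
    intro z hz
    refine le_antisymm (re_le_of_tendsto_re hH hlim hz) ?_
    have h1 := re_le_of_tendsto_re (H := fun z => -H z) hH.neg (by
      intro ζ hζ
      simpa using (hlim ζ hζ).neg) hz
    simpa using h1
  refine ⟨hre 0 (mem_ball_self one_pos), fun z hz => ?_⟩
  obtain ⟨c, hc⟩ := (hH.analyticOnNhd isOpen_ball).eq_const_of_re_eq_const
    (c₀ := 0) (fun z hz => hre z hz) isOpen_ball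
    ⟨⟨0, mem_ball_self one_pos⟩, (convex_ball (0 : ℂ) 1).isPreconnected⟩
  rw [hc z hz, hc 0 (mem_ball_self one_pos)]

namespace IsUnivalentWithPole

variable {f : ℂ → ℂ}

/-- Every point of the unit circle corresponds to a boundary point. -/
theorem exists_preimage_of_circle (hf : IsUnivalentWithPole f) {g : ℂ → ℂ}
    (hg : ∀ z ∈ ball (0 : ℂ) 1 \ {0}, g (f z) = z)
    (hgd : DifferentiableOn ℂ g (f '' (ball 0 1 \ {0}))) {Z : ℂ → ℂ}
    (hZ : ∀ w ∈ closure (f '' (ball 0 1 \ {0})) \ f '' (ball 0 1 \ {0}),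
      Tendsto g (𝓝[f '' (ball 0 1 \ {0})] w) (𝓝 (Z w)))
    {ζ : ℂ} (hζ : ‖ζ‖ = 1) :
    ∃ w ∈ closure (f '' (ball 0 1 \ {0})) \ f '' (ball 0 1 \ {0}), Z w = ζ := by
  set E := f '' (ball 0 1 \ {0}) with hE
  have hEo : IsOpen E := hf.isOpen_image
  have := neBot_nhdsWithin_ball hζ
  -- Since f is bounded near the circle, it converges along an ultrafilter tending to ζ. The limit
  -- is not in the image: there `g` is continuous with values of modulus less than 1, while |ζ| = 1.
  obtain ⟨U, hU⟩ := Ultrafilter.exists_le (𝓝[ball (0 : ℂ) 1] ζ)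
  have hUζ : Tendsto id (U : Filter ℂ) (𝓝 ζ) := hU.trans nhdsWithin_le_nhds
  obtain ⟨δ, R, hδ, hδ1, hR⟩ := hf.exists_bound
  have hnorm : Tendsto (fun z : ℂ => ‖z‖) (U : Filter ℂ) (𝓝 1) := by
    have := hUζ.norm
    rwa [hζ] at this
  have hUball : ∀ᶠ z in (U : Filter ℂ), z ∈ ball (0 : ℂ) 1 := hU self_mem_nhdsWithin
  have hUδ : ∀ᶠ z in (U : Filter ℂ), δ < ‖z‖ := hnorm.eventually (lt_mem_nhds hδ1)
  have hUD : ∀ᶠ z in (U : Filter ℂ), z ∈ ball (0 : ℂ) 1 \ {0} := by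
    filter_upwards [hUball, hUδ] with z h1 h2
    refine ⟨h1, ?_⟩
    rintro rfl
    rw [norm_zero] at h2
    linarith
  have hUR : ∀ᶠ z in (U : Filter ℂ), f z ∈ closedBall (0 : ℂ) R := by
    filter_upwards [hUball, hUδ] with z h1 h2
    exact mem_closedBall_zero_iff.2 (hR z h2.le (mem_ball_zero_iff.1 h1))
  obtain ⟨w, -, hUw⟩ := (isCompact_closedBall (0 : ℂ) R).ultrafilter_le_nhds (U.map f)
    (by rw [Filter.le_principal_iff]; exact hUR)
  have hUw : Tendsto f (U : Filter ℂ) (𝓝 w) := hUw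
  have hUE : ∀ᶠ z in (U : Filter ℂ), f z ∈ E := by
    filter_upwards [hUD] with z hz using mem_image_of_mem f hz
  have hgf : Tendsto (fun z => g (f z)) (U : Filter ℂ) (𝓝 ζ) :=
    hUζ.congr' (by filter_upwards [hUD] with z hz using (hg z hz).symm)
  have hwE : w ∉ E := by
    rintro ⟨z, hz, rfl⟩
    have hc : ContinuousAt g (f z) :=
      (hgd.differentiableAt (hEo.mem_nhds (mem_image_of_mem f hz))).continuousAt
    have h1 := tendsto_nhds_unique (hc.tendsto.comp hUw) hgf
    rw [hg z hz] at h1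
    have h2 := mem_ball_zero_iff.1 hz.1
    rw [h1, hζ] at h2
    exact lt_irrefl _ h2
  have hw : w ∈ closure E \ E := ⟨mem_closure_of_tendsto hUw hUE, hwE⟩
  exact ⟨w, hw, tendsto_nhds_unique
    ((hZ w hw).comp (tendsto_nhdsWithin_iff.2 ⟨hUw, hUE⟩)) hgf⟩

theorem tendsto_negOneSubPreSchwarzian (hf : IsUnivalentWithPole f) :
    Tendsto (negOneSubPreSchwarzian f) (𝓝[≠] 0) (𝓝 1) := by
  have h1 : Tendsto (fun z : ℂ => z) (𝓝[≠] 0) (𝓝 0) := nhdsWithin_le_nhds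
  have h2 := (hf.tendsto_negOneSubPreSchwarzian_zero.mul h1).add_const 1
  rw [zero_mul, zero_add] at h2
  refine h2.congr' ?_
  filter_upwards [self_mem_nhdsWithin] with z hz
  have hz : z ≠ 0 := hz
  field_simp
  ring

theorem differentiableOn_negOneSubPreSchwarzian (hf : IsUnivalentWithPole f) :
    DifferentiableOn ℂ (negOneSubPreSchwarzian f) (ball 0 1 \ {0}) := by
  have h1 := hf.differentiableOn.deriv isOpen_puncturedBall
  have h2 := h1.deriv isOpen_puncturedBall
  exact (((differentiableOn_id.mul h2).div h1 fun z hz => hf.deriv_ne_zero hz).const_add 1).neg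

theorem differentiableOn_update_negOneSubPreSchwarzian (hf : IsUnivalentWithPole f) :
    DifferentiableOn ℂ (Function.update (negOneSubPreSchwarzian f) 0 1) (ball 0 1) := by
  have h1 : ∀ z ∈ ball (0 : ℂ) 1 \ {0},
      DifferentiableAt ℂ (Function.update (negOneSubPreSchwarzian f) 0 1) z := by
    intro z hz
    refine (hf.differentiableOn_negOneSubPreSchwarzian.differentiableAt
      (isOpen_puncturedBall.mem_nhds hz)).congr_of_eventuallyEq ?_
    filter_upwards [isOpen_puncturedBall.mem_nhds hz] with y hy
    exact Function.update_of_ne hy.2 _ _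
  intro z hz
  rcases eq_or_ne z 0 with rfl | hz0
  · refine (Complex.analyticAt_of_differentiable_on_punctured_nhds_of_continuousAt ?_
      ?_).differentiableAt.differentiableWithinAt
    · rw [eventually_nhdsWithin_iff]
      filter_upwards [isOpen_ball.mem_nhds hz] with y hy hy0 using h1 y ⟨hy, hy0⟩
    · rw [continuousAt_update_same]
      exact hf.tendsto_negOneSubPreSchwarzian
  · exact (h1 z ⟨hz, hz0⟩).differentiableWithinAt

/-- **Schwarz–Christoffel formula** for a function with a pole whose image is bounded by sectors,
all but finitely many of which are half disks. -/
theorem exists_schwarzChristoffel (hf : IsUnivalentWithPole f) {N : ℕ} {p : Fin N → ℂ}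
    (hp : Function.Injective p) {a : ℂ → ℝ}
    (hpE : ∀ i, p i ∈ closure (f '' (ball 0 1 \ {0})) \ f '' (ball 0 1 \ {0}))
    (hsec : ∀ w ∈ closure (f '' (ball 0 1 \ {0})) \ f '' (ball 0 1 \ {0}), 0 < a w ∧ a w < 2 ∧
      ∃ u : ℂ, ∃ r : ℝ, ‖u‖ = 1 ∧ 0 < r ∧
        f '' (ball 0 1 \ {0}) ∩ ball w r = circularSector w u (a w * Real.pi) r)
    (ha : ∀ w ∈ closure (f '' (ball 0 1 \ {0})) \ f '' (ball 0 1 \ {0}),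
      w ∉ range p → a w = 1) :
    ∃ ζ : Fin N → ℂ, Function.Injective ζ ∧ (∀ i, ‖ζ i‖ = 1) ∧ ∑ i, (a (p i) - 1) = 2 ∧
      ∀ z ∈ ball (0 : ℂ) 1 \ {0}, negOneSubPreSchwarzian f z =
        ∑ i, ((a (p i) - 1 : ℝ) : ℂ) / 2 * ((ζ i + z) / (ζ i - z)) := by
  obtain ⟨g, hg, hgd⟩ := hf.exists_inverse
  have hbd : ∀ w ∈ closure (f '' (ball 0 1 \ {0})) \ f '' (ball 0 1 \ {0}), ∃ ζ : ℂ, ‖ζ‖ = 1 ∧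
      Tendsto f (𝓝[ball 0 1] ζ) (𝓝 w) ∧
      Tendsto g (𝓝[f '' (ball 0 1 \ {0})] w) (𝓝 ζ) ∧
      Tendsto (fun z => (negOneSubPreSchwarzian f z -
        (a w - 1) / 2 * ((ζ + z) / (ζ - z))).re) (𝓝[ball 0 1] ζ) (𝓝 0) := by
    intro w hw
    obtain ⟨h0, h2, u, r, hu, hr, hE⟩ := hsec w hw
    exact hf.exists_boundary_point hg hgd h0 h2 hr hu hE
  choose! Z hZn hZf hZg hZh using hbd
  have hZinj : ∀ w ∈ closure (f '' (ball 0 1 \ {0})) \ f '' (ball 0 1 \ {0}),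
      ∀ w' ∈ closure (f '' (ball 0 1 \ {0})) \ f '' (ball 0 1 \ {0}), Z w = Z w' → w = w' := by
    intro w hw w' hw' h
    have := neBot_nhdsWithin_ball (hZn w hw)
    have h1 := hZf w' hw'
    rw [← h] at h1
    exact tendsto_nhds_unique (hZf w hw) h1
  set ζ : Fin N → ℂ := fun i => Z (p i) with hζ
  have hζinj : Function.Injective ζ := fun i j h => hp (hZinj _ (hpE i) _ (hpE j) h)
  have hζn : ∀ i, ‖ζ i‖ = 1 := fun i => hZn _ (hpE i)
  have hden : ∀ i, ∀ z ∈ ball (0 : ℂ) 1, ζ i - z ≠ 0 := by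
    intro i z hz h
    have h1 := mem_ball_zero_iff.1 hz
    rw [← sub_eq_zero.1 h, hζn i] at h1
    exact lt_irrefl _ h1
  set K : Fin N → ℂ → ℂ := fun i z => ((a (p i) - 1 : ℝ) : ℂ) / 2 * ((ζ i + z) / (ζ i - z)) with hK
  -- A kernel has vanishing real part on the circle away from its own node. At a node the remaining
  -- kernel cancels the singularity of h; every other point of the circle has a = 1. So Re H tends
  -- to 0 at the whole circle.
  set H : ℂ → ℂ := fun z =>
    Function.update (negOneSubPreSchwarzian f) 0 1 z - ∑ i, K i z with hH
  have hHd : DifferentiableOn ℂ H (ball 0 1) := by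
    refine hf.differentiableOn_update_negOneSubPreSchwarzian.sub
      (DifferentiableOn.fun_sum fun i _ => ?_)
    exact (((differentiableOn_const _).add differentiableOn_id).div
      ((differentiableOn_const _).sub differentiableOn_id) (hden i)).const_mul _
  have hKlim : ∀ i, ∀ η : ℂ, ‖η‖ = 1 → ζ i ≠ η →
      Tendsto (fun z => (K i z).re) (𝓝[ball 0 1] η) (𝓝 0) := by
    intro i η hη hne
    have hne' : ζ i - η ≠ 0 := sub_ne_zero.2 hne
    have hc : ContinuousAt (fun z => (K i z).re) η := by
      refine Complex.continuous_re.continuousAt.comp (continuousAt_const.mul ?_)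
      exact (continuousAt_const.add continuousAt_id).div (continuousAt_const.sub continuousAt_id)
        hne'
    have h0 : (K i η).re = 0 := by
      have h1 : (ζ i + η) / (ζ i - η) =
          ((ζ i + η) * starRingEnd ℂ (ζ i - η)) / (Complex.normSq (ζ i - η) : ℝ) := by
        rw [Complex.normSq_eq_conj_mul_self, mul_comm (starRingEnd ℂ (ζ i - η)),
          mul_div_mul_right]
        exact (map_ne_zero (starRingEnd ℂ)).2 hne'
      rw [hK]
      simp only
      rw [h1, show ((a (p i) - 1 : ℝ) : ℂ) / 2 = (((a (p i) - 1) / 2 : ℝ) : ℂ) by push_cast; rfl,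
        Complex.re_ofReal_mul, Complex.div_ofReal_re]
      have h2 : ((ζ i + η) * starRingEnd ℂ (ζ i - η)).re = 0 := by
        have h3 : Complex.normSq (ζ i) = 1 := by rw [Complex.normSq_eq_norm_sq, hζn]; norm_num
        have h4 : Complex.normSq η = 1 := by rw [Complex.normSq_eq_norm_sq, hη]; norm_num
        rw [Complex.normSq_apply] at h3 h4
        simp only [map_sub, Complex.mul_re, Complex.add_re, Complex.sub_re, Complex.conj_re,
          Complex.add_im, Complex.sub_im, Complex.conj_im]
        linear_combination h3 - h4
      rw [h2, zero_div, mul_zero]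
    have := hc.tendsto.mono_left (nhdsWithin_le_nhds (s := ball (0 : ℂ) 1))
    rwa [h0] at this
  have hHlim : ∀ η : ℂ, ‖η‖ = 1 → Tendsto (fun z => (H z).re) (𝓝[ball 0 1] η) (𝓝 0) := by
    intro η hη
    obtain ⟨w, hw, rfl⟩ := hf.exists_preimage_of_circle hg hgd (Z := Z) (fun w hw => hZg w hw) hη
    have hne0 : ∀ᶠ z in 𝓝[ball (0 : ℂ) 1] (Z w), z ≠ 0 :=
      nhdsWithin_le_nhds (isOpen_ne.mem_nhds (norm_pos_iff.1 (by rw [hη]; exact one_pos)))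
    by_cases hwp : w ∈ range p
    · obtain ⟨i, rfl⟩ := hwp
      have h1 := (hZh _ hw).sub (tendsto_finsetSum (Finset.univ.erase i)
        fun j hj => hKlim j (Z (p i)) hη fun h => (Finset.ne_of_mem_erase hj) (hζinj h))
      simp only [Finset.sum_const_zero, sub_zero] at h1
      refine h1.congr' ?_
      filter_upwards [hne0] with z hz
      rw [hH]
      simp only
      rw [Function.update_of_ne hz, ← Finset.add_sum_erase _ _ (Finset.mem_univ i), Complex.sub_re,
        Complex.sub_re, Complex.add_re, Complex.re_sum, hK]
      simp only [Complex.ofReal_sub, Complex.ofReal_one, hζ]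
      ring
    · have h1 := (hZh _ hw).sub (tendsto_finsetSum Finset.univ
        fun j _ => hKlim j (Z w) hη fun h => hwp ⟨j, hZinj _ (hpE j) _ hw h⟩)
      simp only [Finset.sum_const_zero, sub_zero] at h1
      refine h1.congr' ?_
      filter_upwards [hne0] with z hz
      rw [hH]
      simp only
      rw [Function.update_of_ne hz, ha w hw hwp, Complex.sub_re, Complex.sub_re, Complex.re_sum]
      simp
  obtain ⟨hre, hconst⟩ := eq_const_of_tendsto_re hHd hHlim
  have hζ0 : ∀ i, ζ i ≠ 0 := fun i => norm_pos_iff.1 (by rw [hζn]; exact one_pos)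
  -- The constant H(0) is real by this formula and has real part 0, so it vanishes. This yields both
  -- the formula for h and the angle sum.
  have hH0 : H 0 = ((1 - (∑ i, (a (p i) - 1)) / 2 : ℝ) : ℂ) := by
    rw [hH, hK]
    simp only [Function.update_self, add_zero, sub_zero]
    push_cast
    congr 1
    rw [Finset.sum_div]
    refine Finset.sum_congr rfl fun i _ => ?_
    rw [div_self (hζ0 i), mul_one]
  rw [hH0, Complex.ofReal_re] at hre
  refine ⟨ζ, hζinj, hζn, by linarith, fun z hz => ?_⟩
  have h1 := hconst z hz.1
  rw [hH0, hre, Complex.ofReal_zero, hH] at h1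
  simp only at h1
  rw [Function.update_of_ne hz.2] at h1
  exact sub_eq_zero.1 h1

end IsUnivalentWithPole

/-! ### Complements of curves with corners -/

theorem exists_polar (z : ℂ) :
    ∃ φ : ℝ, 0 ≤ φ ∧ φ < 2 * Real.pi ∧ z = ‖z‖ * Complex.exp (φ * Complex.I) := by
  rcases le_or_gt 0 z.arg with h | h
  · exact ⟨z.arg, h, by linarith [Complex.arg_le_pi z, Real.pi_pos],
      (Complex.norm_mul_exp_arg_mul_I z).symm⟩
  · refine ⟨z.arg + 2 * Real.pi, by linarith [Complex.neg_pi_lt_arg z, Real.pi_pos], by linarith, ?_⟩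
    push_cast
    rw [add_mul, Complex.exp_add, Complex.exp_two_pi_mul_I, mul_one,
      Complex.norm_mul_exp_arg_mul_I]

theorem exists_polar_around {u : ℂ} (hu : ‖u‖ = 1) (w₀ w : ℂ) :
    ∃ φ : ℝ, 0 ≤ φ ∧ φ < 2 * Real.pi ∧
      w = w₀ + (‖w - w₀‖ : ℝ) * (u * Complex.exp (φ * Complex.I)) := by
  have hu0 : u ≠ 0 := norm_pos_iff.1 (by rw [hu]; exact one_pos)
  obtain ⟨φ, h0, h1, h2⟩ := exists_polar ((w - w₀) / u)
  refine ⟨φ, h0, h1, ?_⟩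
  rw [norm_div, hu, div_one] at h2
  have : w - w₀ = u * (‖w - w₀‖ * Complex.exp (φ * Complex.I)) := by
    rw [← h2]; field_simp
  linear_combination this

theorem norm_polar_sub {u : ℂ} (hu : ‖u‖ = 1) (w₀ : ℂ) {s : ℝ} (hs : 0 ≤ s) (φ : ℝ) :
    dist (w₀ + s * (u * Complex.exp (φ * Complex.I))) w₀ = s := by
  rw [dist_eq_norm, add_sub_cancel_left, norm_mul, norm_mul, hu, Complex.norm_exp_ofReal_mul_I,
    Complex.norm_real, Real.norm_of_nonneg hs, mul_one, mul_one]

theorem isPreconnected_circularSector (w₀ u : ℂ) (β r : ℝ) :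
    IsPreconnected (circularSector w₀ u β r) := by
  have h1 : circularSector w₀ u β r =
      (fun q : ℝ × ℝ => w₀ + q.1 * (u * Complex.exp (q.2 * Complex.I))) '' (Ioo 0 r ×ˢ Ioo 0 β) := by
    ext w
    constructor
    · rintro ⟨s, φ, h1, h2, h3, h4, rfl⟩
      exact ⟨(s, φ), ⟨⟨h1, h2⟩, ⟨h3, h4⟩⟩, rfl⟩
    · rintro ⟨⟨s, φ⟩, ⟨⟨h1, h2⟩, ⟨h3, h4⟩⟩, rfl⟩
      exact ⟨s, φ, h1, h2, h3, h4, rfl⟩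
  rw [h1]
  exact (isPreconnected_Ioo.prod isPreconnected_Ioo).image _ (by fun_prop)

/-- Near `w₀` the set `Γ` consists of the two rays from `w₀` in the directions `u` and
`u * exp (iγ)`. -/
structure IsCornerAt (Γ : Set ℂ) (w₀ u : ℂ) (γ r : ℝ) : Prop where
  norm_eq : ‖u‖ = 1
  pos : 0 < r
  angle_pos : 0 < γ
  angle_lt : γ < 2 * Real.pi
  mem : w₀ ∈ Γ
  mem_iff : ∀ s φ : ℝ, 0 < s → s < r → 0 ≤ φ → φ < 2 * Real.pi →
    (w₀ + s * (u * Complex.exp (φ * Complex.I)) ∈ Γ ↔ φ = 0 ∨ φ = γ)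

namespace IsCornerAt

variable {Γ : Set ℂ} {w₀ u : ℂ} {γ r : ℝ}

/-- Both sectors of a corner are described by angles measured from the same direction u. -/
theorem mem_sector_right_iff {w : ℂ} :
    w ∈ circularSector w₀ (u * Complex.exp (γ * Complex.I)) (2 * Real.pi - γ) r ↔
      ∃ s φ : ℝ, 0 < s ∧ s < r ∧ γ < φ ∧ φ < 2 * Real.pi ∧
        w = w₀ + s * (u * Complex.exp (φ * Complex.I)) := by
  constructor
  · rintro ⟨s, φ, h1, h2, h3, h4, rfl⟩
    refine ⟨s, γ + φ, h1, h2, by linarith, by linarith, ?_⟩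
    push_cast
    rw [add_mul, Complex.exp_add]; ring
  · rintro ⟨s, φ, h1, h2, h3, h4, rfl⟩
    refine ⟨s, φ - γ, h1, h2, by linarith, by linarith, ?_⟩
    rw [mul_assoc u, ← Complex.exp_add]
    push_cast
    ring_nf

theorem ball_diff_eq (h : IsCornerAt Γ w₀ u γ r) :
    ball w₀ r \ Γ = circularSector w₀ u γ r ∪
      circularSector w₀ (u * Complex.exp (γ * Complex.I)) (2 * Real.pi - γ) r := by
  ext w
  rw [mem_union, mem_sector_right_iff]
  constructor
  · rintro ⟨hw, hwΓ⟩
    obtain ⟨φ, h0, h1, h2⟩ := exists_polar_around h.norm_eq w₀ w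
    have hs : 0 < ‖w - w₀‖ := by
      rw [norm_pos_iff, sub_ne_zero]
      rintro rfl
      exact hwΓ h.mem
    have hsr : ‖w - w₀‖ < r := by rwa [← dist_eq_norm]
    have hmem := h.mem_iff _ φ hs hsr h0 h1
    rw [← h2] at hmem
    have hne := mt hmem.2 hwΓ
    rw [not_or] at hne
    rcases lt_or_gt_of_ne hne.2 with h3 | h3
    · exact Or.inl ⟨_, φ, hs, hsr, lt_of_le_of_ne h0 (Ne.symm hne.1), h3, h2⟩
    · exact Or.inr ⟨_, φ, hs, hsr, h3, h1, h2⟩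
  · have hγ := h.angle_pos
    have hγ' := h.angle_lt
    rintro (⟨s, φ, h1, h2, h3, h4, rfl⟩ | ⟨s, φ, h1, h2, h3, h4, rfl⟩)
    · refine ⟨by rw [mem_ball, norm_polar_sub h.norm_eq _ h1.le]; exact h2, fun hΓ => ?_⟩
      rcases (h.mem_iff s φ h1 h2 h3.le (by linarith)).1 hΓ with h5 | h5 <;> linarith
    · refine ⟨by rw [mem_ball, norm_polar_sub h.norm_eq _ h1.le]; exact h2, fun hΓ => ?_⟩
      rcases (h.mem_iff s φ h1 h2 (by linarith) (by linarith)).1 hΓ with h5 | h5 <;> linarith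

/-- A nearby point of a corner is in the closure of each of the two sectors. -/
theorem subset_closure (h : IsCornerAt Γ w₀ u γ r) : Γ ∩ ball w₀ r ⊆
    closure (circularSector w₀ u γ r) ∩
      closure (circularSector w₀ (u * Complex.exp (γ * Complex.I)) (2 * Real.pi - γ) r) := by
  have hγ := h.angle_pos
  have hγ' := h.angle_lt
  have key : ∀ s φ : ℝ, 0 ≤ s → s < r → ∀ a b : ℝ, a < b → φ ∈ Icc a b → ∀ S : Set ℂ,
      (∀ s φ : ℝ, 0 < s → s < r → a < φ → φ < b →
        w₀ + s * (u * Complex.exp (φ * Complex.I)) ∈ S) →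
      w₀ + s * (u * Complex.exp (φ * Complex.I)) ∈ closure S := by
    intro s φ hs hsr a b hab hφ S hS
    have h1 : (s, φ) ∈ closure (Ioo 0 r ×ˢ Ioo a b) := by
      rw [closure_prod_eq, closure_Ioo h.pos.ne, closure_Ioo hab.ne]
      exact ⟨⟨hs, hsr.le⟩, hφ⟩
    have hc : Continuous fun q : ℝ × ℝ =>
        w₀ + (q.1 : ℂ) * (u * Complex.exp (q.2 * Complex.I)) := by fun_prop
    have hmaps : MapsTo (fun q : ℝ × ℝ => w₀ + (q.1 : ℂ) * (u * Complex.exp (q.2 * Complex.I)))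
        (Ioo 0 r ×ˢ Ioo a b) S := by
      rintro ⟨s', φ'⟩ ⟨h2, h3⟩
      exact hS s' φ' h2.1 h2.2 h3.1 h3.2
    have := map_mem_closure hc h1 hmaps
    exact this
  rintro w ⟨hwΓ, hw⟩
  obtain ⟨φ, h0, h1, h2⟩ := exists_polar_around h.norm_eq w₀ w
  have hsr : ‖w - w₀‖ < r := by rwa [← dist_eq_norm]
  have hkey : ∀ ψ : ℝ, w = w₀ + (‖w - w₀‖ : ℝ) * (u * Complex.exp (ψ * Complex.I)) →
      ∀ a b : ℝ, a < b → ψ ∈ Icc a b → ∀ S : Set ℂ,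
      (∀ s φ : ℝ, 0 < s → s < r → a < φ → φ < b →
        w₀ + s * (u * Complex.exp (φ * Complex.I)) ∈ S) → w ∈ closure S := by
    intro ψ hψ a b hab hψ' S hS
    have := key ‖w - w₀‖ ψ (norm_nonneg _) hsr a b hab hψ' S hS
    rwa [← hψ] at this
  have hL : ∀ s φ : ℝ, 0 < s → s < r → 0 < φ → φ < γ →
      w₀ + s * (u * Complex.exp (φ * Complex.I)) ∈ circularSector w₀ u γ r :=
    fun s φ h1 h2 h3 h4 => ⟨s, φ, h1, h2, h3, h4, rfl⟩
  have hR : ∀ s φ : ℝ, 0 < s → s < r → γ < φ → φ < 2 * Real.pi →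
      w₀ + s * (u * Complex.exp (φ * Complex.I)) ∈
        circularSector w₀ (u * Complex.exp (γ * Complex.I)) (2 * Real.pi - γ) r :=
    fun s φ h1 h2 h3 h4 => mem_sector_right_iff.2 ⟨s, φ, h1, h2, h3, h4, rfl⟩
  have hφ : φ = 0 ∨ φ = γ ∨ ‖w - w₀‖ = 0 := by
    rcases (norm_nonneg (w - w₀)).eq_or_lt with h3 | h3
    · exact Or.inr (Or.inr h3.symm)
    · have := (h.mem_iff _ φ h3 hsr h0 h1).1 (by rwa [← h2])
      tauto
  rcases hφ with rfl | rfl | h3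
  -- Seen from the second sector, the ray in the direction u has angle 2π rather than 0.
  · refine ⟨hkey 0 h2 0 γ hγ ⟨le_rfl, hγ.le⟩ _ hL, hkey (2 * Real.pi) ?_ γ (2 * Real.pi) hγ'
      ⟨hγ'.le, le_rfl⟩ _ hR⟩
    push_cast
    rw [Complex.exp_two_pi_mul_I]
    simpa using h2
  · exact ⟨hkey φ h2 0 φ hγ ⟨hγ.le, le_rfl⟩ _ hL, hkey φ h2 φ (2 * Real.pi) hγ'
      ⟨le_rfl, hγ'.le⟩ _ hR⟩
  · have h4 : ∀ ψ : ℝ, w = w₀ + (‖w - w₀‖ : ℝ) * (u * Complex.exp (ψ * Complex.I)) := by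
      intro ψ
      rw [h3]
      simpa [sub_eq_zero] using h3
    exact ⟨hkey γ (h4 γ) 0 γ hγ ⟨hγ.le, le_rfl⟩ _ hL, hkey γ (h4 γ) γ (2 * Real.pi) hγ'
      ⟨le_rfl, hγ'.le⟩ _ hR⟩

end IsCornerAt

/-- A union of components of the complement of `Γ` that does not contain both sides of `Γ`. -/
structure IsOneSided (Γ E : Set ℂ) : Prop where
  disjoint : Disjoint E Γ
  subset_of_preconnected : ∀ S : Set ℂ, IsPreconnected S → Disjoint S Γ → (S ∩ E).Nonempty → S ⊆ E
  not_subset : ∀ w₀ ∈ Γ, ∀ r > 0, ¬ ball w₀ r \ Γ ⊆ E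

namespace IsOneSided

variable {Γ E : Set ℂ} {w₀ u : ℂ} {γ r : ℝ}

/-- Near a corner in its closure, a one-sided set is one of the two sectors. -/
theorem inter_ball_eq (hE : IsOneSided Γ E) (h : IsCornerAt Γ w₀ u γ r) (hw₀ : w₀ ∈ closure E) :
    E ∩ ball w₀ r = circularSector w₀ u γ r ∨ E ∩ ball w₀ r =
      circularSector w₀ (u * Complex.exp (γ * Complex.I)) (2 * Real.pi - γ) r := by
  set S₁ := circularSector w₀ u γ r with hS₁
  set S₂ := circularSector w₀ (u * Complex.exp (γ * Complex.I)) (2 * Real.pi - γ) r with hS₂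
  have hU : ball w₀ r \ Γ = S₁ ∪ S₂ := h.ball_diff_eq
  have hEU : E ∩ ball w₀ r ⊆ S₁ ∪ S₂ := by
    rw [← hU]
    exact fun w hw => ⟨hw.2, fun hΓ => hE.disjoint.le_bot ⟨hw.1, hΓ⟩⟩
  have hd₁ : Disjoint S₁ Γ := disjoint_left.2 fun w hw =>
    (hU.symm.subset (Or.inl hw)).2
  have hd₂ : Disjoint S₂ Γ := disjoint_left.2 fun w hw =>
    (hU.symm.subset (Or.inr hw)).2
  have hb₁ : S₁ ⊆ ball w₀ r := fun w hw => (hU.symm.subset (Or.inl hw)).1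
  have hb₂ : S₂ ⊆ ball w₀ r := fun w hw => (hU.symm.subset (Or.inr hw)).1
  have hsub₁ := hE.subset_of_preconnected S₁ (isPreconnected_circularSector _ _ _ _) hd₁
  have hsub₂ := hE.subset_of_preconnected S₂ (isPreconnected_circularSector _ _ _ _) hd₂
  obtain ⟨w, hwb, hwE⟩ := mem_closure_iff.1 hw₀ (ball w₀ r) isOpen_ball (mem_ball_self h.pos)
  have hnot : ¬ (S₁ ⊆ E ∧ S₂ ⊆ E) := fun h12 => hE.not_subset w₀ h.mem r h.pos (by
    rw [hU]; exact union_subset h12.1 h12.2)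
  rcases hEU ⟨hwE, hwb⟩ with hw | hw
  · left
    have h1 := hsub₁ ⟨w, hw, hwE⟩
    refine Subset.antisymm (fun y hy => ?_) (subset_inter h1 hb₁)
    rcases hEU hy with hy' | hy'
    · exact hy'
    · exact absurd ⟨h1, hsub₂ ⟨y, hy', hy.1⟩⟩ hnot
  · right
    have h1 := hsub₂ ⟨w, hw, hwE⟩
    refine Subset.antisymm (fun y hy => ?_) (subset_inter h1 hb₂)
    rcases hEU hy with hy' | hy'
    · exact absurd ⟨hsub₁ ⟨y, hy', hy.1⟩, h1⟩ hnot
    · exact hy'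

/-- A small disk around a point off Γ is connected, so if it meets E it lies in E. -/
theorem diff_subset (hE : IsOneSided Γ E) (hΓ : IsClosed Γ) : closure E \ E ⊆ Γ := by
  rintro w ⟨hw, hwE⟩
  by_contra hwΓ
  obtain ⟨ε, hε, hb⟩ := Metric.isOpen_iff.1 hΓ.isOpen_compl w hwΓ
  obtain ⟨y, hyb, hyE⟩ := mem_closure_iff.1 hw (ball w ε) isOpen_ball (mem_ball_self hε)
  exact hwE (hE.subset_of_preconnected _ (convex_ball w ε).isPreconnected
    (disjoint_left.2 hb) ⟨y, hyb, hyE⟩ (mem_ball_self hε))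

/-- The part of Γ adherent to E is closed in Γ. It is also open in Γ: near an adherent corner E is
one of the two sectors, and each sector has all nearby points of Γ in its closure. It is nonempty
because E is not clopen, so it is all of the connected set Γ. -/
theorem closure_diff_eq (hE : IsOneSided Γ E) (hΓ : IsClosed Γ) (hconn : IsPreconnected Γ)
    (hEo : IsOpen E) (hEne : E.Nonempty) (hΓne : Γ.Nonempty)
    (hcorner : ∀ w ∈ Γ, ∃ u γ r, IsCornerAt Γ w u γ r) : closure E \ E = Γ := by
  refine Subset.antisymm (hE.diff_subset hΓ) fun w hw => ⟨?_, fun hwE => hE.disjoint.le_bot ⟨hwE, hw⟩⟩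
  choose! u γ r hc using hcorner
  have hfr : (closure E \ E).Nonempty := by
    by_contra hemp
    rw [not_nonempty_iff_eq_empty, Set.sdiff_eq_empty] at hemp
    have hcl : IsClopen E := ⟨isClosed_of_closure_subset hemp, hEo⟩
    rcases isClopen_iff.1 hcl with h | h
    · exact hEne.ne_empty h
    · obtain ⟨y, hy⟩ := hΓne
      exact hE.disjoint.le_bot ⟨by rw [h]; trivial, hy⟩
  obtain ⟨y, hy⟩ := hfr
  by_contra hwE
  set V := ⋃ x ∈ Γ ∩ closure E, ball x (r x) with hV
  obtain ⟨x, hx, hxV, hxE⟩ := hconn V (closure E)ᶜ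
    (isOpen_biUnion fun _ _ => isOpen_ball) isClosed_closure.isOpen_compl
    (fun x hx => by
      by_cases h : x ∈ closure E
      · exact Or.inl (mem_iUnion₂.2 ⟨x, ⟨hx, h⟩, mem_ball_self (hc x hx).pos⟩)
      · exact Or.inr h)
    ⟨y, hE.diff_subset hΓ hy, mem_iUnion₂.2 ⟨y, ⟨hE.diff_subset hΓ hy, hy.1⟩,
      mem_ball_self (hc y (hE.diff_subset hΓ hy)).pos⟩⟩ ⟨w, hw, hwE⟩
  obtain ⟨x₀, hx₀, hxb⟩ := mem_iUnion₂.1 hxV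
  have h1 := (hc x₀ hx₀.1).subset_closure ⟨hx, hxb⟩
  rcases hE.inter_ball_eq (hc x₀ hx₀.1) hx₀.2 with h2 | h2
  · rw [← h2] at h1
    exact hxE (closure_mono inter_subset_left h1.1)
  · rw [← h2] at h1
    exact hxE (closure_mono inter_subset_left h1.2)

end IsOneSided

/-! ### Corners of polygons -/

/-- Two segments issuing from `w₀` and a closed set not containing `w₀` form a corner. -/
theorem exists_isCornerAt {Γ K : Set ℂ} {w₀ u : ℂ} {γ ρ₁ ρ₂ : ℝ} (hu : ‖u‖ = 1) (hγ : 0 < γ)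
    (hγ' : γ < 2 * Real.pi) (hρ₁ : 0 < ρ₁) (hρ₂ : 0 < ρ₂) (hK : IsClosed K) (hw₀ : w₀ ∉ K)
    (hΓ : ∀ w, w ∈ Γ ↔ (∃ τ ∈ Icc (0 : ℝ) 1, w = w₀ + τ * (ρ₁ * u)) ∨
      (∃ τ ∈ Icc (0 : ℝ) 1, w = w₀ + τ * (ρ₂ * (u * Complex.exp (γ * Complex.I)))) ∨ w ∈ K) :
    ∃ r, IsCornerAt Γ w₀ u γ r := by
  obtain ⟨r, hr, hrK⟩ := Metric.isOpen_iff.1 hK.isOpen_compl w₀ hw₀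
  have hu0 : u ≠ 0 := norm_pos_iff.1 (by rw [hu]; exact one_pos)
  refine ⟨min r (min ρ₁ ρ₂), hu, lt_min hr (lt_min hρ₁ hρ₂), hγ, hγ',
    (hΓ _).2 (Or.inl ⟨0, ⟨le_rfl, zero_le_one⟩, by simp⟩), ?_⟩
  intro s φ hs hsr h0 h1
  have hsr1 : s < r := lt_of_lt_of_le hsr (min_le_left _ _)
  have hsρ₁ : s < ρ₁ := lt_of_lt_of_le hsr ((min_le_right _ _).trans (min_le_left _ _))
  have hsρ₂ : s < ρ₂ := lt_of_lt_of_le hsr ((min_le_right _ _).trans (min_le_right _ _))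
  have hray : ∀ ρ θ : ℝ, 0 < ρ → s < ρ → 0 ≤ θ → θ < 2 * Real.pi →
      ((∃ τ ∈ Icc (0 : ℝ) 1, w₀ + s * (u * Complex.exp (φ * Complex.I)) =
        w₀ + τ * (ρ * (u * Complex.exp (θ * Complex.I)))) ↔ φ = θ) := by
    intro ρ θ hρ hsρ hθ hθ'
    constructor
    · rintro ⟨τ, hτ, h⟩
      have h2 : (s : ℂ) * Complex.exp (φ * Complex.I) =
          ((τ * ρ : ℝ) : ℂ) * Complex.exp (θ * Complex.I) := by
        refine mul_left_cancel₀ hu0 ?_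
        push_cast
        linear_combination h
      exact (polar_unique hs (mul_nonneg hτ.1 hρ.le)
        (by rw [abs_lt]; constructor <;> linarith) h2).2
    · rintro rfl
      refine ⟨s / ρ, ⟨by positivity, (div_le_one hρ).2 hsρ.le⟩, ?_⟩
      have : (ρ : ℂ) ≠ 0 := by exact_mod_cast hρ.ne'
      push_cast
      field_simp
  have hnK : w₀ + s * (u * Complex.exp (φ * Complex.I)) ∉ K :=
    hrK (by rw [mem_ball, norm_polar_sub hu _ hs.le]; exact hsr1)
  have e1 := hray ρ₁ 0 hρ₁ hsρ₁ le_rfl (by linarith)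
  have e2 := hray ρ₂ γ hρ₂ hsρ₂ hγ.le hγ'
  simp only [Complex.ofReal_zero, zero_mul, Complex.exp_zero, mul_one] at e1
  rw [hΓ, e1, e2]
  tauto

/-- Polar description of an open convex cone. -/
theorem mem_open_cone_iff {w₀ u : ℂ} {γ ρ₁ ρ₂ : ℝ} (hu : ‖u‖ = 1) (hγ : 0 < γ)
    (hγ' : γ < Real.pi) (hρ₁ : 0 < ρ₁) (hρ₂ : 0 < ρ₂) {s φ : ℝ} (hs : 0 < s) (h0 : 0 ≤ φ)
    (h1 : φ < 2 * Real.pi) :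
    ((∃ x y : ℝ, 0 < x ∧ 0 < y ∧ w₀ + s * (u * Complex.exp (φ * Complex.I)) =
      w₀ + x * (ρ₁ * u) + y * (ρ₂ * (u * Complex.exp (γ * Complex.I)))) ↔ 0 < φ ∧ φ < γ) ∧
    ((∃ x y : ℝ, 0 ≤ x ∧ 0 ≤ y ∧ w₀ + s * (u * Complex.exp (φ * Complex.I)) =
      w₀ + x * (ρ₁ * u) + y * (ρ₂ * (u * Complex.exp (γ * Complex.I)))) ↔ φ ≤ γ) := by
  have hu0 : u ≠ 0 := norm_pos_iff.1 (by rw [hu]; exact one_pos)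
  have hsγ : 0 < Real.sin γ := Real.sin_pos_of_pos_of_lt_pi hγ hγ'
  -- Cramer's rule for the coordinates along the two sides. Since sin γ > 0, their signs are those
  -- of sin(γ - φ) and sin φ.
  have hcoord : ∀ x y : ℝ, w₀ + s * (u * Complex.exp (φ * Complex.I)) =
      w₀ + x * (ρ₁ * u) + y * (ρ₂ * (u * Complex.exp (γ * Complex.I))) ↔
      (x * ρ₁ * Real.sin γ = s * Real.sin (γ - φ) ∧ y * ρ₂ * Real.sin γ = s * Real.sin φ) := by
    intro x y
    have h2 : w₀ + s * (u * Complex.exp (φ * Complex.I)) =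
      w₀ + x * (ρ₁ * u) + y * (ρ₂ * (u * Complex.exp (γ * Complex.I))) ↔
      (s : ℂ) * Complex.exp (φ * Complex.I) = x * ρ₁ + y * ρ₂ * Complex.exp (γ * Complex.I) := by
      constructor
      · intro h
        refine mul_left_cancel₀ hu0 ?_
        linear_combination h
      · intro h
        linear_combination u * h
    rw [h2, Complex.ext_iff]
    have e1 : (x * ρ₁ + y * ρ₂ * Complex.exp (γ * Complex.I) : ℂ) =
        ((x * ρ₁ : ℝ) : ℂ) + ((y * ρ₂ : ℝ) : ℂ) * Complex.exp (γ * Complex.I) := by push_cast; ring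
    rw [e1, Complex.add_re, Complex.add_im, Complex.re_ofReal_mul, Complex.re_ofReal_mul,
      Complex.im_ofReal_mul, Complex.im_ofReal_mul, Complex.exp_ofReal_mul_I_re,
      Complex.exp_ofReal_mul_I_im, Complex.exp_ofReal_mul_I_re,
      Complex.exp_ofReal_mul_I_im, Complex.ofReal_re, Complex.ofReal_im, Real.sin_sub]
    constructor
    · rintro ⟨h3, h4⟩
      refine ⟨?_, by linear_combination -h4⟩
      linear_combination -Real.sin γ * h3 + Real.cos γ * h4
    · rintro ⟨h3, h4⟩
      refine ⟨?_, by linear_combination -h4⟩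
      refine mul_right_cancel₀ hsγ.ne' ?_
      linear_combination -h3 - Real.cos γ * h4
  have hex : ∃ x y : ℝ, x * ρ₁ * Real.sin γ = s * Real.sin (γ - φ) ∧
      y * ρ₂ * Real.sin γ = s * Real.sin φ :=
    ⟨s * Real.sin (γ - φ) / (ρ₁ * Real.sin γ), s * Real.sin φ / (ρ₂ * Real.sin γ),
      by field_simp, by field_simp⟩
  simp only [hcoord]
  have hxs : ∀ x ρ t : ℝ, 0 < ρ → x * ρ * Real.sin γ = s * t →
      ((0 < x ↔ 0 < t) ∧ (0 ≤ x ↔ 0 ≤ t)) := by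
    intro x ρ t hρ h
    have hc : 0 < ρ * Real.sin γ := mul_pos hρ hsγ
    have e : x * (ρ * Real.sin γ) = s * t := by linarith
    refine ⟨?_, ?_⟩
    · rw [← mul_pos_iff_of_pos_right hc, e, mul_pos_iff_of_pos_left hs]
    · rw [← mul_nonneg_iff_of_pos_right hc, e, mul_nonneg_iff_of_pos_left hs]
  obtain ⟨x, y, hx, hy⟩ := hex
  constructor
  · constructor
    · rintro ⟨x, y, hx0, hy0, hx, hy⟩
      have h3 := (hxs x ρ₁ _ hρ₁ hx).1.1 hx0
      have h4 := (hxs y ρ₂ _ hρ₂ hy).1.1 hy0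
      have hφπ : φ < Real.pi := by
        by_contra hcon
        have h5 : Real.sin (φ - Real.pi) < 0 := by rw [Real.sin_sub_pi]; linarith
        have := Real.sin_nonneg_of_nonneg_of_le_pi (x := φ - Real.pi) (by linarith) (by linarith)
        linarith
      refine ⟨lt_of_le_of_ne h0 ?_, ?_⟩
      · rintro rfl; rw [Real.sin_zero] at h4; exact lt_irrefl _ h4
      · by_contra hcon
        have := Real.sin_nonneg_of_nonneg_of_le_pi (x := φ - γ) (by linarith) (by linarith)
        rw [← neg_sub, Real.sin_neg] at this
        linarith
    · rintro ⟨h2, h3⟩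
      exact ⟨x, y, (hxs x ρ₁ _ hρ₁ hx).1.2 (Real.sin_pos_of_pos_of_lt_pi (by linarith)
        (by linarith)), (hxs y ρ₂ _ hρ₂ hy).1.2 (Real.sin_pos_of_pos_of_lt_pi h2 (by linarith)),
        hx, hy⟩
  · constructor
    · rintro ⟨x, y, hx0, hy0, hx, hy⟩
      have h3 := (hxs x ρ₁ _ hρ₁ hx).2.1 hx0
      have h4 := (hxs y ρ₂ _ hρ₂ hy).2.1 hy0
      by_contra hcon
      rw [not_le] at hcon
      rcases lt_or_ge Real.pi φ with h5 | h5
      · have := Real.sin_pos_of_pos_of_lt_pi (x := φ - Real.pi) (by linarith) (by linarith)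
        rw [Real.sin_sub_pi] at this
        linarith
      · have := Real.sin_pos_of_pos_of_lt_pi (x := φ - γ) (by linarith) (by linarith)
        rw [← neg_sub, Real.sin_neg] at this
        linarith
    · intro h2
      exact ⟨x, y, (hxs x ρ₁ _ hρ₁ hx).2.2 (Real.sin_nonneg_of_nonneg_of_le_pi (by linarith)
        (by linarith)), (hxs y ρ₂ _ hρ₂ hy).2.2 (Real.sin_nonneg_of_nonneg_of_le_pi h0
        (by linarith)), hx, hy⟩

/-- Two vectors that are not parallel span, in one of the two orders, a positively oriented
angle less than `π`. -/
theorem exists_angle_between {a b : ℂ} (ha : a ≠ 0) (hb : (b / a).im ≠ 0) :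
    ∃ u : ℂ, ∃ γ : ℝ, ‖u‖ = 1 ∧ 0 < γ ∧ γ < Real.pi ∧
      ((a = ‖a‖ * u ∧ b = ‖b‖ * (u * Complex.exp (γ * Complex.I))) ∨
      (b = ‖b‖ * u ∧ a = ‖a‖ * (u * Complex.exp (γ * Complex.I)))) := by
  have hb0 : b ≠ 0 := by rintro rfl; simp at hb
  have hna : (‖a‖ : ℂ) ≠ 0 := by exact_mod_cast (norm_pos_iff.2 ha).ne'
  have hnb : (‖b‖ : ℂ) ≠ 0 := by exact_mod_cast (norm_pos_iff.2 hb0).ne'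
  have hpol := Complex.norm_mul_exp_arg_mul_I (b / a)
  rw [norm_div, Complex.ofReal_div] at hpol
  have h1 : b = ‖b‖ * (a / ‖a‖ * Complex.exp ((b / a).arg * Complex.I)) := by
    field_simp at hpol ⊢
    linear_combination -hpol
  have hunit : ∀ z : ℂ, z ≠ 0 → ‖z / ‖z‖‖ = 1 := by
    intro z hz
    rw [norm_div, Complex.norm_real, norm_norm, div_self (norm_pos_iff.2 hz).ne']
  have hargπ : (b / a).arg ≠ Real.pi := fun h => hb (Complex.arg_eq_pi_iff.1 h).2
  have harg0 : (b / a).arg ≠ 0 := fun h => hb (Complex.arg_eq_zero_iff.1 h).2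
  rcases lt_or_gt_of_ne harg0 with h | h
  · refine ⟨b / ‖b‖, -(b / a).arg, hunit b hb0, by linarith,
      by linarith [Complex.neg_pi_lt_arg (b / a)], Or.inr ⟨by field_simp, ?_⟩⟩
    have h2 : b * ‖a‖ = ‖b‖ * a * Complex.exp ((b / a).arg * Complex.I) := by
      field_simp at hpol
      linear_combination -hpol
    push_cast
    rw [neg_mul, Complex.exp_neg]
    have he := Complex.exp_ne_zero ((b / a).arg * Complex.I)
    generalize Complex.exp ((b / a).arg * Complex.I) = e at *
    field_simp
    linear_combination -h2
  · exact ⟨a / ‖a‖, (b / a).arg, hunit a ha, h,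
      lt_of_le_of_ne (Complex.arg_le_pi _) hargπ, Or.inl ⟨by field_simp, h1⟩⟩

namespace Polygon

variable {n : ℕ} {p : Polygon ℂ (n + 2)}

theorem edgePath_apply (p : Polygon ℂ (n + 2)) (i : Fin (n + 2)) (t : ℝ) :
    p.edgePath ℝ i t = p i + t * (p (i + 1) - p i) := by
  rw [edgePath, AffineMap.lineMap_apply, finRotate_apply]
  simp [add_comm]

theorem mem_edgeSet_iff (p : Polygon ℂ (n + 2)) (i : Fin (n + 2)) (w : ℂ) :
    w ∈ p.edgeSet ℝ i ↔ ∃ t ∈ Icc (0 : ℝ) 1, w = p i + t * (p (i + 1) - p i) := by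
  rw [edgeSet_eq_image_edgePath]
  constructor
  · rintro ⟨t, ht, rfl⟩
    exact ⟨t, ht, p.edgePath_apply i t⟩
  · rintro ⟨t, ht, rfl⟩
    exact ⟨t, ht, p.edgePath_apply i t⟩

theorem isCompact_edgeSet (p : Polygon ℂ (n + 2)) (i : Fin (n + 2)) :
    IsCompact (p.edgeSet ℝ i) := by
  rw [edgeSet_eq_image_edgePath]
  refine isCompact_Icc.image ?_
  have : (p.edgePath ℝ i : ℝ → ℂ) = fun t : ℝ => p i + t * (p (i + 1) - p i) :=
    funext (p.edgePath_apply i)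
  rw [this]
  fun_prop

theorem isClosed_boundary (p : Polygon ℂ (n + 2)) : IsClosed (p.boundary ℝ) :=
  isClosed_iUnion_of_finite fun i => (p.isCompact_edgeSet i).isClosed

theorem vertex_mem_edgeSet (p : Polygon ℂ (n + 2)) (i : Fin (n + 2)) : p i ∈ p.edgeSet ℝ i :=
  (p.mem_edgeSet_iff i _).2 ⟨0, ⟨le_rfl, zero_le_one⟩, by simp⟩

theorem vertex_mem_edgeSet' (p : Polygon ℂ (n + 2)) (i : Fin (n + 2)) :
    p (i + 1) ∈ p.edgeSet ℝ i :=
  (p.mem_edgeSet_iff i _).2 ⟨1, ⟨zero_le_one, le_rfl⟩, by simp⟩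

theorem edgeSet_subset_boundary (p : Polygon ℂ (n + 2)) (i : Fin (n + 2)) :
    p.edgeSet ℝ i ⊆ p.boundary ℝ := subset_iUnion _ i

theorem vertex_mem_boundary (p : Polygon ℂ (n + 2)) (i : Fin (n + 2)) : p i ∈ p.boundary ℝ :=
  p.edgeSet_subset_boundary i (p.vertex_mem_edgeSet i)

theorem isPreconnected_boundary (p : Polygon ℂ (n + 2)) : IsPreconnected (p.boundary ℝ) := by
  have hedge : ∀ i, IsPreconnected (p.edgeSet ℝ i) := fun i => by
    rw [edgeSet, affineSegment_eq_segment]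
    exact (convex_segment _ _).isPreconnected
  have hstep : ∀ i, (p.edgeSet ℝ i ∩ p.edgeSet ℝ (i + 1)).Nonempty := fun i =>
    ⟨p (i + 1), p.vertex_mem_edgeSet' i, p.vertex_mem_edgeSet (i + 1)⟩
  have hzero : ∀ i : Fin (n + 2), Relation.ReflTransGen
      (fun i j : Fin (n + 2) => (p.edgeSet ℝ i ∩ p.edgeSet ℝ j).Nonempty) 0 i := by
    intro i
    induction i using Fin.induction with
    | zero => exact Relation.ReflTransGen.refl
    | succ i ih =>
      refine ih.tail ?_
      have := hstep i.castSucc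
      rwa [Fin.coeSucc_eq_succ] at this
  refine IsPreconnected.iUnion_of_reflTransGen hedge fun i j => ?_
  refine Relation.ReflTransGen.trans ?_ (hzero j)
  have hsymm : Std.Symm fun i j : Fin (n + 2) => (p.edgeSet ℝ i ∩ p.edgeSet ℝ j).Nonempty :=
    ⟨fun i j h => by rw [inter_comm]; exact h⟩
  exact Relation.ReflTransGen.stdSymm.symm _ _ (hzero i)

theorem exists_edgePath_eq (p : Polygon ℂ (n + 2)) {w : ℂ} (hw : w ∈ p.boundary ℝ) :
    ∃ i, ∃ s ∈ Ico (0 : ℝ) 1, w = p i + s * (p (i + 1) - p i) := by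
  obtain ⟨i, hi⟩ := mem_iUnion.1 hw
  obtain ⟨t, ht, rfl⟩ := (p.mem_edgeSet_iff i w).1 hi
  rcases lt_or_eq_of_le ht.2 with h | rfl
  · exact ⟨i, t, ⟨ht.1, h⟩, rfl⟩
  · exact ⟨i + 1, 0, ⟨le_rfl, zero_lt_one⟩, by simp⟩

/-- Simplicity concerns half-open sides. Closing side j adds the point p (j + 1), which has
parameter 0 on side j + 1; hence the second alternative. -/
theorem IsSimple.eq_of_mem_edgeSet (hp : p.IsSimple) {i j : Fin (n + 2)} {s : ℝ}
    (hs : s ∈ Ico (0 : ℝ) 1) (h : p i + s * (p (i + 1) - p i) ∈ p.edgeSet ℝ j) :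
    j = i ∨ (s = 0 ∧ j + 1 = i) := by
  obtain ⟨t, ht, h⟩ := (p.mem_edgeSet_iff j _).1 h
  rcases lt_or_eq_of_le ht.2 with h1 | rfl
  · left
    exact (hp i j s hs t ⟨ht.1, h1⟩ (by rw [edgePath_apply, edgePath_apply, h])).1.symm
  · right
    have h2 : p.edgePath ℝ i s = p.edgePath ℝ (j + 1) 0 := by
      rw [edgePath_apply, edgePath_apply, h]; simp
    have := hp i (j + 1) s hs 0 ⟨le_rfl, zero_lt_one⟩ h2
    exact ⟨this.2, this.1.symm⟩

theorem IsSimple.injective (hp : p.IsSimple) : Function.Injective p.vertices := by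
  intro i j h
  exact (hp i j 0 ⟨le_rfl, zero_lt_one⟩ 0 ⟨le_rfl, zero_lt_one⟩ (by
    rw [edgePath_apply, edgePath_apply]; simpa using h)).1

theorem IsSimple.side_ne_zero (hp : p.IsSimple) (i : Fin (n + 2)) : p (i + 1) - p i ≠ 0 := by
  intro h
  have := hp.injective (sub_eq_zero.1 h)
  simp at this

theorem isClosed_other_edges (p : Polygon ℂ (n + 2)) (s : Set (Fin (n + 2))) :
    IsClosed (⋃ j ∈ s, p.edgeSet ℝ j) :=
  s.toFinite.isClosed_biUnion fun j _ => (p.isCompact_edgeSet j).isClosed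

theorem mem_boundary_iff_of_split (p : Polygon ℂ (n + 2)) (s : Set (Fin (n + 2))) (w : ℂ) :
    w ∈ p.boundary ℝ ↔ (∃ j ∈ sᶜ, w ∈ p.edgeSet ℝ j) ∨ w ∈ ⋃ j ∈ s, p.edgeSet ℝ j := by
  rw [boundary, mem_iUnion, mem_iUnion₂]
  constructor
  · rintro ⟨j, hj⟩
    by_cases h : j ∈ s
    · exact Or.inr ⟨j, h, hj⟩
    · exact Or.inl ⟨j, h, hj⟩
  · rintro (⟨j, -, hj⟩ | ⟨j, -, hj⟩) <;> exact ⟨j, hj⟩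

/-- An interior point of a side is a corner of angle `π`. -/
theorem IsSimple.exists_isCornerAt_side (hp : p.IsSimple) (i : Fin (n + 2)) {s : ℝ}
    (hs : s ∈ Ioo (0 : ℝ) 1) :
    ∃ u r, IsCornerAt (p.boundary ℝ) (p i + s * (p (i + 1) - p i)) u Real.pi r := by
  set d := p (i + 1) - p i with hd
  have hd0 : d ≠ 0 := hp.side_ne_zero i
  have hdn : 0 < ‖d‖ := norm_pos_iff.2 hd0
  have hdn' : (‖d‖ : ℂ) ≠ 0 := by exact_mod_cast hdn.ne'
  obtain ⟨r, hr⟩ := exists_isCornerAt (Γ := p.boundary ℝ) (K := ⋃ j ∈ ({i}ᶜ : Set (Fin (n + 2))),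
      p.edgeSet ℝ j) (w₀ := p i + s * d) (u := d / ‖d‖) (γ := Real.pi) (ρ₁ := (1 - s) * ‖d‖)
    (ρ₂ := s * ‖d‖) (by rw [norm_div, Complex.norm_real, norm_norm, div_self hdn.ne'])
    Real.pi_pos (by linarith [Real.pi_pos]) (mul_pos (by linarith [hs.2]) hdn)
    (mul_pos hs.1 hdn) (p.isClosed_other_edges _)
    (by
      intro h
      obtain ⟨j, hj, h⟩ := mem_iUnion₂.1 h
      rcases hp.eq_of_mem_edgeSet ⟨hs.1.le, hs.2⟩ h with h1 | h1
      · exact hj h1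
      · exact hs.1.ne' h1.1)
    (by
      intro w
      rw [p.mem_boundary_iff_of_split {i}ᶜ, ← or_assoc]
      refine or_congr ?_ Iff.rfl
      simp only [compl_compl, mem_singleton_iff, exists_eq_left]
      rw [mem_edgeSet_iff, ← hd, Complex.exp_pi_mul_I]
      have e1 : ∀ τ : ℝ, (p i + s * d + τ * (((1 - s) * ‖d‖ : ℝ) * (d / ‖d‖)) : ℂ) =
          p i + ((s + τ * (1 - s) : ℝ) : ℂ) * d := by
        intro τ; push_cast; field_simp; ring
      have e2 : ∀ τ : ℝ, (p i + s * d + τ * ((s * ‖d‖ : ℝ) * (d / ‖d‖ * -1)) : ℂ) =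
          p i + ((s - τ * s : ℝ) : ℂ) * d := by
        intro τ; push_cast; field_simp; ring
      simp only [e1, e2]
      have hs0 := hs.1
      have hs1 : 0 < 1 - s := by linarith [hs.2]
      constructor
      · rintro ⟨t, ht, rfl⟩
        rcases le_total s t with h | h
        · refine Or.inl ⟨(t - s) / (1 - s), ⟨div_nonneg (by linarith) hs1.le,
            (div_le_one hs1).2 (by linarith [ht.2])⟩, ?_⟩
          rw [div_mul_cancel₀ _ hs1.ne']; ring_nf
        · refine Or.inr ⟨(s - t) / s, ⟨div_nonneg (by linarith) hs0.le,
            (div_le_one hs0).2 (by linarith [ht.1])⟩, ?_⟩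
          rw [div_mul_cancel₀ _ hs0.ne']; ring_nf
      · rintro (⟨τ, hτ, rfl⟩ | ⟨τ, hτ, rfl⟩)
        · exact ⟨_, ⟨by nlinarith [hτ.1], by nlinarith [hτ.2]⟩, rfl⟩
        · exact ⟨_, ⟨by nlinarith [hτ.2], by nlinarith [hτ.1]⟩, rfl⟩)
  exact ⟨_, r, hr⟩

/-- A real quotient would put the two neighbours of p i on a line through it. The nondegeneracy
condition is used at i - 1, as it names the first of three consecutive vertices. -/
theorem HasNondegenerateVertices.im_ne_zero (hv : p.HasNondegenerateVertices ℝ)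
    (hp : p.IsSimple) (i : Fin (n + 2)) :
    ((p (i + 1) - p i) / (p (i - 1) - p i)).im ≠ 0 := by
  intro him
  have h1 := hv (i - 1)
  have e1 : i - 1 + 1 = i := sub_add_cancel i 1
  have e2 : i - 1 + 2 = i + 1 := by
    have : (2 : Fin (n + 2)) = 1 + 1 := by apply Fin.ext; simp [Fin.val_add]
    rw [this, ← add_assoc, e1]
  rw [e1, e2, affineIndependent_iff_not_collinear_set] at h1
  apply h1
  have hd := hp.side_ne_zero (i - 1)
  rw [e1] at hd
  have hd' : p (i - 1) - p i ≠ 0 := by rw [← neg_sub]; exact neg_ne_zero.2 hd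
  rw [collinear_iff_of_mem (p₀ := p i) (by simp)]
  refine ⟨p (i - 1) - p i, ?_⟩
  have hq : p (i + 1) - p i =
      (((p (i + 1) - p i) / (p (i - 1) - p i)).re : ℂ) * (p (i - 1) - p i) := by
    have : ((((p (i + 1) - p i) / (p (i - 1) - p i)).re : ℝ) : ℂ) =
        (p (i + 1) - p i) / (p (i - 1) - p i) := Complex.ext (by simp) (by simp [him])
    rw [this, div_mul_cancel₀ _ hd']
  rintro w (rfl | rfl | rfl)
  · exact ⟨1, by simp⟩
  · exact ⟨0, by simp⟩
  · refine ⟨((p (i + 1) - p i) / (p (i - 1) - p i)).re, ?_⟩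
    rw [vadd_eq_add, Complex.real_smul, ← hq, sub_add_cancel]

/-- A vertex is a corner of angle less than `π`, whose sides are the sides of the polygon. -/
theorem IsSimple.exists_isCornerAt_vertex (hp : p.IsSimple) (hv : p.HasNondegenerateVertices ℝ)
    (i : Fin (n + 2)) :
    ∃ u γ r, IsCornerAt (p.boundary ℝ) (p i) u γ r ∧ γ < Real.pi ∧ ∃ ρ₁ ρ₂ : ℝ, 0 < ρ₁ ∧ 0 < ρ₂ ∧
      ((p (i - 1) - p i = ρ₁ * u ∧ p (i + 1) - p i = ρ₂ * (u * Complex.exp (γ * Complex.I))) ∨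
      (p (i + 1) - p i = ρ₁ * u ∧ p (i - 1) - p i = ρ₂ * (u * Complex.exp (γ * Complex.I)))) := by
  have e1 : i - 1 + 1 = i := sub_add_cancel i 1
  have hd := hp.side_ne_zero (i - 1)
  rw [e1] at hd
  have hd' : p (i - 1) - p i ≠ 0 := by rw [← neg_sub]; exact neg_ne_zero.2 hd
  have hd2 := hp.side_ne_zero i
  obtain ⟨u, γ, hu, hγ, hγ', hab⟩ := exists_angle_between hd' (hv.im_ne_zero hp i)
  have hK : p i ∉ ⋃ j ∈ ({i, i - 1}ᶜ : Set (Fin (n + 2))), p.edgeSet ℝ j := by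
    intro h
    obtain ⟨j, hj, h⟩ := mem_iUnion₂.1 h
    have h0 : p i = p i + ((0 : ℝ) : ℂ) * (p (i + 1) - p i) := by simp
    rw [h0] at h
    rcases hp.eq_of_mem_edgeSet ⟨le_rfl, zero_lt_one⟩ h with h1 | h1
    · exact hj (Or.inl h1)
    · exact hj (Or.inr (eq_sub_of_add_eq h1.2))
  have hedge1 : ∀ w, w ∈ p.edgeSet ℝ i ↔
      ∃ τ ∈ Icc (0 : ℝ) 1, w = p i + τ * (p (i + 1) - p i) := p.mem_edgeSet_iff i
  have hedge2 : ∀ w, w ∈ p.edgeSet ℝ (i - 1) ↔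
      ∃ τ ∈ Icc (0 : ℝ) 1, w = p i + τ * (p (i - 1) - p i) := by
    intro w
    rw [mem_edgeSet_iff, e1]
    constructor
    · rintro ⟨t, ht, rfl⟩
      exact ⟨1 - t, ⟨by linarith [ht.2], by linarith [ht.1]⟩, by push_cast; ring⟩
    · rintro ⟨t, ht, rfl⟩
      exact ⟨1 - t, ⟨by linarith [ht.2], by linarith [ht.1]⟩, by push_cast; ring⟩
  have hΓ : ∀ w, w ∈ p.boundary ℝ ↔ (w ∈ p.edgeSet ℝ i ∨ w ∈ p.edgeSet ℝ (i - 1)) ∨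
      w ∈ ⋃ j ∈ ({i, i - 1}ᶜ : Set (Fin (n + 2))), p.edgeSet ℝ j := by
    intro w
    rw [p.mem_boundary_iff_of_split {i, i - 1}ᶜ]
    refine or_congr ?_ Iff.rfl
    simp
  rcases hab with ⟨ha, hb⟩ | ⟨hb, ha⟩
  · obtain ⟨r, hr⟩ := exists_isCornerAt (Γ := p.boundary ℝ) (w₀ := p i) hu hγ
      (by linarith [Real.pi_pos]) (norm_pos_iff.2 hd') (norm_pos_iff.2 hd2)
      (p.isClosed_other_edges _) hK (by
        intro w
        rw [hΓ, hedge1, hedge2, ← ha, ← hb]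
        rw [or_assoc, or_left_comm])
    exact ⟨u, γ, r, hr, hγ', _, _, norm_pos_iff.2 hd', norm_pos_iff.2 hd2, Or.inl ⟨ha, hb⟩⟩
  · obtain ⟨r, hr⟩ := exists_isCornerAt (Γ := p.boundary ℝ) (w₀ := p i) hu hγ
      (by linarith [Real.pi_pos]) (norm_pos_iff.2 hd2) (norm_pos_iff.2 hd')
      (p.isClosed_other_edges _) hK (by
        intro w
        rw [hΓ, hedge1, hedge2, ← ha, ← hb]
        rw [or_assoc])
    exact ⟨u, γ, r, hr, hγ', _, _, norm_pos_iff.2 hd2, norm_pos_iff.2 hd', Or.inr ⟨hb, ha⟩⟩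

/-! ### The exterior lies on one side of the polygon: a winding argument -/

theorem disjoint_exterior_boundary (p : Polygon ℂ (n + 2)) :
    Disjoint p.exterior (p.boundary ℝ) := disjoint_left.2 fun _ hw => hw.1

theorem subset_exterior_of_isPreconnected (p : Polygon ℂ (n + 2)) {S : Set ℂ}
    (hS : IsPreconnected S) (hd : Disjoint S (p.boundary ℝ)) (hne : (S ∩ p.exterior).Nonempty) :
    S ⊆ p.exterior := by
  obtain ⟨x, hxS, hx⟩ := hne
  intro y hy
  have hsub : S ⊆ (p.boundary ℝ)ᶜ := fun z hz => disjoint_left.1 hd hz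
  refine ⟨hsub hy, ?_⟩
  rw [← connectedComponentIn_eq (hS.subset_connectedComponentIn hxS hsub hy)]
  exact hx.2

/-- The ratio of the vectors to the end points of a side avoids the negative reals off the side. -/
theorem div_mem_slitPlane (p : Polygon ℂ (n + 2)) {i : Fin (n + 2)} {w : ℂ}
    (hw : w ∉ p.edgeSet ℝ i) : (p (i + 1) - w) / (p i - w) ∈ Complex.slitPlane := by
  have h0 : p i - w ≠ 0 := fun h => hw (by rw [← sub_eq_zero.1 h]; exact p.vertex_mem_edgeSet i)
  rw [Complex.mem_slitPlane_iff_not_le_zero]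
  intro hle
  apply hw
  rw [Complex.le_def] at hle
  set c : ℝ := -((p (i + 1) - w) / (p i - w)).re with hc
  have hc0 : 0 ≤ c := by
    have := hle.1
    simp only [Complex.zero_re] at this
    linarith
  have heq : (p (i + 1) - w) / (p i - w) = ((-c : ℝ) : ℂ) := by
    apply Complex.ext
    · simp [hc]
    · have := hle.2
      simpa using this
  have h1 : p (i + 1) - w = ((-c : ℝ) : ℂ) * (p i - w) := by
    rw [← heq, div_mul_cancel₀ _ h0]
  have hc1 : (1 + c : ℂ) ≠ 0 := by
    have : (1 + c : ℝ) ≠ 0 := by positivity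
    exact_mod_cast this
  rw [mem_edgeSet_iff]
  refine ⟨1 / (1 + c), ⟨by positivity, by rw [div_le_one (by positivity)]; linarith⟩, ?_⟩
  push_cast at h1 ⊢
  field_simp
  linear_combination -h1

/-- The total change of the logarithm along the polygon, as seen from a point. -/
noncomputable def windingLog (p : Polygon ℂ (n + 2)) (w : ℂ) : ℂ :=
  ∑ i, Complex.log ((p (i + 1) - w) / (p i - w))

theorem hasDerivAt_log_side (p : Polygon ℂ (n + 2)) {i : Fin (n + 2)} {w : ℂ}
    (hw : w ∉ p.edgeSet ℝ i) :
    HasDerivAt (fun w => Complex.log ((p (i + 1) - w) / (p i - w)))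
      ((p i - w)⁻¹ - (p (i + 1) - w)⁻¹) w := by
  have h0 : p i - w ≠ 0 := fun h => hw (by rw [← sub_eq_zero.1 h]; exact p.vertex_mem_edgeSet i)
  have h1 : p (i + 1) - w ≠ 0 := fun h =>
    hw (by rw [← sub_eq_zero.1 h]; exact p.vertex_mem_edgeSet' i)
  have hd := (((hasDerivAt_id' w).const_sub (p (i + 1))).fun_div
    ((hasDerivAt_id' w).const_sub (p i)) h0).clog (p.div_mem_slitPlane hw)
  convert hd using 1
  field_simp
  ring

/-- The derivatives of the logarithms telescope around the cycle of vertices, so `windingLog` is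
locally constant off the boundary. -/
theorem hasDerivAt_windingLog (p : Polygon ℂ (n + 2)) {w : ℂ} (hw : w ∉ p.boundary ℝ) :
    HasDerivAt p.windingLog 0 w := by
  have h1 : HasDerivAt p.windingLog (∑ i, ((p i - w)⁻¹ - (p (i + 1) - w)⁻¹)) w := by
    unfold windingLog
    exact HasDerivAt.fun_sum fun i _ => p.hasDerivAt_log_side
      fun h => hw (p.edgeSet_subset_boundary i h)
  have h2 : ∑ i, ((p i - w)⁻¹ - (p (i + 1) - w)⁻¹) = 0 := by
    rw [Finset.sum_sub_distrib, sub_eq_zero]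
    exact (Equiv.sum_comp (Equiv.addRight (1 : Fin (n + 2))) fun i => (p i - w)⁻¹).symm
  rwa [h2] at h1

/-- The logarithm jumps across a side. -/
theorem not_eventually_windingLog_eq (hp : p.IsSimple) (i : Fin (n + 2)) {s : ℝ}
    (hs : s ∈ Ioo (0 : ℝ) 1) :
    ¬ ∀ᶠ ε : ℝ in 𝓝[>] 0,
      p.windingLog (p i + (s + ε * Complex.I) * (p (i + 1) - p i)) =
      p.windingLog (p i + (s - ε * Complex.I) * (p (i + 1) - p i)) := by
  intro hev
  set d := p (i + 1) - p i with hd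
  have hd0 : d ≠ 0 := hp.side_ne_zero i
  set L : Fin (n + 2) → ℂ → ℂ := fun j w => Complex.log ((p (j + 1) - w) / (p j - w)) with hL
  have hs0 := hs.1
  have hs1 : 0 < 1 - s := by linarith [hs.2]
  have hplus : Tendsto (fun ε : ℝ => p i + (s + ε * Complex.I) * d) (𝓝[>] 0) (𝓝 (p i + s * d)) := by
    have : Continuous fun ε : ℝ => p i + (s + ε * Complex.I) * d := by fun_prop
    simpa using (this.tendsto 0).mono_left (nhdsWithin_le_nhds (s := Ioi (0 : ℝ)))
  have hminus : Tendsto (fun ε : ℝ => p i + (s - ε * Complex.I) * d) (𝓝[>] 0)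
      (𝓝 (p i + s * d)) := by
    have : Continuous fun ε : ℝ => p i + (s - ε * Complex.I) * d := by fun_prop
    simpa using (this.tendsto 0).mono_left (nhdsWithin_le_nhds (s := Ioi (0 : ℝ)))
  have hother : ∀ j ∈ Finset.univ.erase i, Tendsto (fun ε : ℝ =>
      L j (p i + (s + ε * Complex.I) * d) - L j (p i + (s - ε * Complex.I) * d)) (𝓝[>] 0)
      (𝓝 0) := by
    intro j hj
    have hne : p i + s * d ∉ p.edgeSet ℝ j := fun h => by
      rcases hp.eq_of_mem_edgeSet ⟨hs.1.le, hs.2⟩ h with h1 | h1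
      · exact Finset.ne_of_mem_erase hj h1
      · exact hs.1.ne' h1.1
    have hc := (p.hasDerivAt_log_side hne).continuousAt.tendsto
    have := (hc.comp hplus).sub (hc.comp hminus)
    rw [sub_self] at this
    exact this
  -- In the coordinate along side i the ratio of end vectors tends to -(1 - s)/s, a point of the
  -- branch cut, from above for σ = 1 and from below for σ = -1. The other logarithms are continuous
  -- there, so the total jump is 2πi.
  have hri : ∀ σ : ℝ, Tendsto (fun ε : ℝ => ((1 - s : ℂ) - σ * ε * Complex.I) /
      (-s - σ * ε * Complex.I)) (𝓝[>] 0) (𝓝 ((-((1 - s) / s) : ℝ) : ℂ)) := by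
    intro σ
    have hden : (-s - σ * (0 : ℝ) * Complex.I : ℂ) ≠ 0 := by
      simpa using hs0.ne'
    have hc : ContinuousAt (fun ε : ℝ => ((1 - s : ℂ) - σ * ε * Complex.I) /
      (-s - σ * ε * Complex.I)) 0 := by
      refine ContinuousAt.div (by fun_prop) (by fun_prop) hden
    have := hc.tendsto.mono_left (nhdsWithin_le_nhds (s := Ioi (0 : ℝ)))
    convert this using 2
    have : (s : ℂ) ≠ 0 := by exact_mod_cast hs0.ne'
    push_cast
    simp only [mul_zero, zero_mul, sub_zero]
    field_simp
  have hval : ∀ σ ε : ℝ, L i (p i + (s + σ * ε * Complex.I) * d) =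
      Complex.log (((1 - s : ℂ) - σ * ε * Complex.I) / (-s - σ * ε * Complex.I)) := by
    intro σ ε
    rw [hL]
    simp only
    congr 1
    rw [show p (i + 1) - (p i + (s + σ * ε * Complex.I) * d) =
      ((1 - s : ℂ) - σ * ε * Complex.I) * d by rw [hd]; ring,
      show p i - (p i + (s + σ * ε * Complex.I) * d) = (-s - σ * ε * Complex.I) * d by ring,
      mul_div_mul_right _ _ hd0]
  have him : ∀ σ ε : ℝ, (((1 - s : ℂ) - σ * ε * Complex.I) / (-s - σ * ε * Complex.I)).im =
      σ * ε / (s ^ 2 + (σ * ε) ^ 2) := by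
    intro σ ε
    have hns : Complex.normSq (-s - σ * ε * Complex.I) = s ^ 2 + (σ * ε) ^ 2 := by
      rw [Complex.normSq_apply]
      simp
      ring
    rw [Complex.div_im, hns]
    simp
    ring
  have hneg : -((1 - s) / s) < 0 := neg_neg_of_pos (div_pos hs1 hs0)
  have hipos : Tendsto (fun ε : ℝ => L i (p i + (s + ε * Complex.I) * d)) (𝓝[>] 0)
      (𝓝 (Real.log ‖((-((1 - s) / s) : ℝ) : ℂ)‖ + Real.pi * Complex.I)) := by
    have h1 := Complex.continuousWithinAt_log_of_re_neg_of_im_zero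
      (z := ((-((1 - s) / s) : ℝ) : ℂ)) (by rwa [Complex.ofReal_re]) (Complex.ofReal_im _)
    have h2 : Complex.log ((-((1 - s) / s) : ℝ) : ℂ) =
        Real.log ‖((-((1 - s) / s) : ℝ) : ℂ)‖ + Real.pi * Complex.I := by
      rw [Complex.log, Complex.arg_ofReal_of_neg hneg]
    have h3 := h1.tendsto
    rw [h2] at h3
    have h4 := h3.comp (tendsto_nhdsWithin_iff.2 ⟨hri 1, by
      filter_upwards [self_mem_nhdsWithin] with ε hε
      have hε : 0 < ε := hε
      have := him 1 ε
      show 0 ≤ _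
      rw [this]
      positivity⟩)
    refine h4.congr fun ε => ?_
    have := hval 1 ε
    simp only [Complex.ofReal_one, one_mul] at this ⊢
    rw [this]
    simp
  have hineg : Tendsto (fun ε : ℝ => L i (p i + (s - ε * Complex.I) * d)) (𝓝[>] 0)
      (𝓝 (Real.log ‖((-((1 - s) / s) : ℝ) : ℂ)‖ - Real.pi * Complex.I)) := by
    have h1 := Complex.tendsto_log_nhdsWithin_im_neg_of_re_neg_of_im_zero
      (z := ((-((1 - s) / s) : ℝ) : ℂ)) (by rwa [Complex.ofReal_re]) (Complex.ofReal_im _)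
    have h4 := h1.comp (tendsto_nhdsWithin_iff.2 ⟨hri (-1), by
      filter_upwards [self_mem_nhdsWithin] with ε hε
      have hε : 0 < ε := hε
      have := him (-1) ε
      show (_ : ℂ).im < 0
      rw [this]
      refine div_neg_of_neg_of_pos (by linarith) (by positivity)⟩)
    refine h4.congr fun ε => ?_
    have := hval (-1) ε
    simp only [Complex.ofReal_neg, Complex.ofReal_one, neg_mul, one_mul] at this ⊢
    rw [sub_eq_add_neg (s : ℂ), this]
    simp
  have hsum := tendsto_finsetSum (Finset.univ.erase i) hother
  rw [Finset.sum_const_zero] at hsum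
  have htot := (hipos.sub hineg).add hsum
  have hzero : Tendsto (fun _ : ℝ => (0 : ℂ)) (𝓝[>] 0) (𝓝 0) := tendsto_const_nhds
  have heq := tendsto_nhds_unique (htot.congr' (by
    filter_upwards [hev] with ε hε
    have h5 : L i (p i + (s + ε * Complex.I) * d) - L i (p i + (s - ε * Complex.I) * d) +
        ∑ j ∈ Finset.univ.erase i, (L j (p i + (s + ε * Complex.I) * d) -
          L j (p i + (s - ε * Complex.I) * d)) =
        p.windingLog (p i + (s + ε * Complex.I) * d) -
          p.windingLog (p i + (s - ε * Complex.I) * d) := by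
      rw [Finset.add_sum_erase _ (fun j => L j (p i + (s + ε * Complex.I) * d) -
          L j (p i + (s - ε * Complex.I) * d)) (Finset.mem_univ i), Finset.sum_sub_distrib]
      rfl
    rw [h5, hε, sub_self])) hzero
  have : (Real.pi : ℂ) * Complex.I = 0 := by linear_combination heq / 2
  have hpi : (Real.pi : ℂ) ≠ 0 := by exact_mod_cast Real.pi_ne_zero
  exact mul_ne_zero hpi Complex.I_ne_zero this

/-- The exterior of a simple polygon, if connected, lies on one side of each of its sides. -/
theorem IsSimple.isOneSided_exterior (hp : p.IsSimple) (ho : IsOpen p.exterior)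
    (hc : IsPreconnected p.exterior) : IsOneSided (p.boundary ℝ) p.exterior := by
  refine ⟨p.disjoint_exterior_boundary,
    fun S hS hd hne => p.subset_exterior_of_isPreconnected hS hd hne, ?_⟩
  intro w₀ hw₀ r hr hsub
  obtain ⟨i, s, hs, rfl⟩ := p.exists_edgePath_eq hw₀
  set d := p (i + 1) - p i with hd
  have hd0 : d ≠ 0 := hp.side_ne_zero i
  -- The given point may be a vertex; it is replaced by an interior point of a side within the same
  -- ball, where the jump is available.
  obtain ⟨s', hs', hball⟩ : ∃ s' ∈ Ioo (0 : ℝ) 1, p i + s' * d ∈ ball (p i + s * d) r := by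
    have hcont : Continuous fun x : ℝ => p i + x * d := by fun_prop
    have h1 : ∀ᶠ x : ℝ in 𝓝[>] s, p i + x * d ∈ ball (p i + s * d) r :=
      nhdsWithin_le_nhds (hcont.continuousAt.eventually (ball_mem_nhds _ hr))
    have h2 : ∀ᶠ x : ℝ in 𝓝[>] s, x ∈ Ioo s 1 := Ioo_mem_nhdsGT hs.2
    obtain ⟨x, hx1, hx2⟩ := (h1.and h2).exists
    exact ⟨x, ⟨lt_of_le_of_lt hs.1 hx2.1, hx2.2⟩, hx1⟩
  have hmem : ∀ σ : ℝ, σ ≠ 0 → ∀ᶠ ε : ℝ in 𝓝[>] 0,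
      p i + (s' + σ * ε * Complex.I) * d ∈ p.exterior := by
    intro σ hσ
    have hcont : Continuous fun ε : ℝ => p i + (s' + σ * ε * Complex.I) * d := by fun_prop
    have htend : Tendsto (fun ε : ℝ => p i + (s' + σ * ε * Complex.I) * d) (𝓝[>] 0)
        (𝓝 (p i + s' * d)) := by
      simpa using (hcont.tendsto 0).mono_left (nhdsWithin_le_nhds (s := Ioi (0 : ℝ)))
    have hK := (p.isClosed_other_edges {i}ᶜ).isOpen_compl.mem_nhds (x := p i + s' * d) (by
      intro h
      obtain ⟨j, hj, h⟩ := mem_iUnion₂.1 h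
      rcases hp.eq_of_mem_edgeSet ⟨hs'.1.le, hs'.2⟩ h with h1 | h1
      · exact hj h1
      · exact hs'.1.ne' h1.1)
    filter_upwards [htend.eventually (isOpen_ball.mem_nhds hball), htend.eventually hK,
      self_mem_nhdsWithin] with ε h1 h2 h3
    have h3 : 0 < ε := h3
    refine hsub ⟨h1, fun hΓ => ?_⟩
    rcases (p.mem_boundary_iff_of_split {i}ᶜ _).1 hΓ with ⟨j, hj, h4⟩ | h4
    · rw [compl_compl, mem_singleton_iff] at hj
      subst hj
      obtain ⟨t, -, ht⟩ := (p.mem_edgeSet_iff j _).1 h4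
      have h5 : (s' + σ * ε * Complex.I : ℂ) = t :=
        mul_right_cancel₀ hd0 (add_left_cancel ht)
      have h6 := congrArg Complex.im h5
      simp at h6
      rcases h6 with h6 | h6
      · exact hσ h6
      · exact h3.ne' h6
    · exact h2 h4
  apply not_eventually_windingLog_eq hp i hs'
  filter_upwards [hmem 1 one_ne_zero, hmem (-1) (by norm_num)] with ε h1 h2
  have hdisj := disjoint_left.1 p.disjoint_exterior_boundary
  refine ho.is_const_of_deriv_eq_zero hc
    (fun w hw => (p.hasDerivAt_windingLog (hdisj hw)).differentiableAt.differentiableWithinAt)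
    (fun w hw => (p.hasDerivAt_windingLog (hdisj hw)).deriv) ?_ ?_
  · simpa using h1
  · simp only [Complex.ofReal_neg, Complex.ofReal_one, neg_mul, one_mul, ← sub_eq_add_neg] at h2
    exact h2

theorem IsConvexVertex.not_isConcaveVertex {i : Fin (n + 2)} (h : p.IsConvexVertex i) :
    ¬ p.IsConcaveVertex i := by
  rintro ⟨r₂, hr₂, h₂⟩
  obtain ⟨r₁, hr₁, h₁⟩ := h
  have hcont : Continuous fun ε : ℝ => p i + ε * (p (i - 1) - p i) + ε * (p (i + 1) - p i) := by
    fun_prop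
  have htend : Tendsto (fun ε : ℝ => p i + ε * (p (i - 1) - p i) + ε * (p (i + 1) - p i))
      (𝓝[>] 0) (𝓝 (p i)) := by
    simpa using (hcont.tendsto 0).mono_left (nhdsWithin_le_nhds (s := Ioi (0 : ℝ)))
  obtain ⟨ε, hb₁, hb₂, hε⟩ := ((htend.eventually (ball_mem_nhds _ hr₁)).and
    ((htend.eventually (ball_mem_nhds _ hr₂)).and self_mem_nhdsWithin)).exists
  have hε : 0 < ε := hε
  exact (h₁.symm.subset ⟨⟨ε, ε, hε.le, hε.le, rfl⟩, hb₁⟩).1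
    (h₂.symm.subset ⟨⟨ε, ε, hε, hε, rfl⟩, hb₂⟩).1

theorem IsSimple.closure_exterior_diff (hp : p.IsSimple) (hv : p.HasNondegenerateVertices ℝ)
    (ho : IsOpen p.exterior) (hc : IsPreconnected p.exterior) (hne : p.exterior.Nonempty) :
    closure p.exterior \ p.exterior = p.boundary ℝ := by
  refine (hp.isOneSided_exterior ho hc).closure_diff_eq p.isClosed_boundary
    p.isPreconnected_boundary ho hne ⟨p 0, p.vertex_mem_boundary 0⟩ fun w hw => ?_
  obtain ⟨i, s, hs, rfl⟩ := p.exists_edgePath_eq hw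
  rcases hs.1.eq_or_lt with rfl | h
  · obtain ⟨u, γ, r, h, -⟩ := hp.exists_isCornerAt_vertex hv i
    exact ⟨u, γ, r, by simpa using h⟩
  · obtain ⟨u, r, h⟩ := hp.exists_isCornerAt_side i ⟨h, hs.2⟩
    exact ⟨u, _, r, h⟩

/-- Near a point of the boundary, the exterior of a simple polygon is a sector. Its angle is `a π`
with `a = 1` off the vertices, `a < 1` at concave and `1 < a` at convex vertices. -/
theorem IsSimple.exists_angle (hp : p.IsSimple) (hv : p.HasNondegenerateVertices ℝ)
    (ho : IsOpen p.exterior) (hc : IsPreconnected p.exterior) (hne : p.exterior.Nonempty)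
    {w : ℂ} (hw : w ∈ p.boundary ℝ) :
    ∃ a : ℝ, (0 < a ∧ a < 2 ∧ ∃ u r, ‖u‖ = 1 ∧ 0 < r ∧
      p.exterior ∩ ball w r = circularSector w u (a * Real.pi) r) ∧
      (w ∉ range p.vertices → a = 1) ∧
      ∀ i, p i = w → (a < 1 ∧ p.IsConcaveVertex i) ∨ (1 < a ∧ p.IsConvexVertex i) := by
  have hE := hp.isOneSided_exterior ho hc
  have hπ := Real.pi_pos
  have hcl : w ∈ closure p.exterior :=
    ((hp.closure_exterior_diff hv ho hc hne).symm.subset hw).1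
  by_cases hwv : w ∈ range p.vertices
  · obtain ⟨i, rfl⟩ := hwv
    obtain ⟨u, γ, r, hcorner, hγ, ρ₁, ρ₂, hρ₁, hρ₂, hd⟩ := hp.exists_isCornerAt_vertex hv i
    have hu := hcorner.norm_eq
    have hr := hcorner.pos
    have hγ0 := hcorner.angle_pos
    have hopen : ∀ w, w ∈ p.openSector i ↔ ∃ x y : ℝ, 0 < x ∧ 0 < y ∧
        w = p i + x * (ρ₁ * u) + y * (ρ₂ * (u * Complex.exp (γ * Complex.I))) := by
      intro w
      rcases hd with ⟨h1, h2⟩ | ⟨h1, h2⟩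
      · rw [openSector, h1, h2]; rfl
      · rw [openSector, h1, h2]
        constructor
        · rintro ⟨s, t, hs, ht, rfl⟩; exact ⟨t, s, ht, hs, by ring⟩
        · rintro ⟨s, t, hs, ht, rfl⟩; exact ⟨t, s, ht, hs, by ring⟩
    have hclosed : ∀ w, w ∈ p.closedSector i ↔ ∃ x y : ℝ, 0 ≤ x ∧ 0 ≤ y ∧
        w = p i + x * (ρ₁ * u) + y * (ρ₂ * (u * Complex.exp (γ * Complex.I))) := by
      intro w
      rcases hd with ⟨h1, h2⟩ | ⟨h1, h2⟩
      · rw [closedSector, h1, h2]; rfl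
      · rw [closedSector, h1, h2]
        constructor
        · rintro ⟨s, t, hs, ht, rfl⟩; exact ⟨t, s, ht, hs, by ring⟩
        · rintro ⟨s, t, hs, ht, rfl⟩; exact ⟨t, s, ht, hs, by ring⟩
    have hpole := fun (s φ : ℝ) (hs : 0 < s) (h0 : 0 ≤ φ) (h1 : φ < 2 * Real.pi) =>
      mem_open_cone_iff (w₀ := p i) hu hγ0 hγ hρ₁ hρ₂ hs h0 h1
    -- The exterior is either the sector of angle γ < π between the sides, and the vertex is
    -- concave, or the complementary one of angle 2π - γ, and the vertex is convex.
    rcases hE.inter_ball_eq hcorner hcl with h | h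
    · refine ⟨γ / Real.pi, ⟨by positivity, by rw [div_lt_iff₀ hπ]; linarith, u, r, hu, hr, ?_⟩,
        fun h => absurd (mem_range_self i) h, fun j hj => Or.inl ⟨by rwa [div_lt_one hπ], ?_⟩⟩
      · rw [h, div_mul_cancel₀ _ hπ.ne']
      · obtain rfl := hp.injective hj
        refine ⟨r, hr, h.trans ?_⟩
        ext w
        constructor
        · rintro ⟨s, φ, h1, h2, h3, h4, rfl⟩
          refine ⟨(hopen _).2 ((hpole s φ h1 h3.le (by linarith)).1.2 ⟨h3, h4⟩), ?_⟩
          rw [mem_ball, norm_polar_sub hu _ h1.le]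
          exact h2
        · rintro ⟨hw1, hw2⟩
          obtain ⟨φ, h0, h1, h2⟩ := exists_polar_around hu (p j) w
          have hs : 0 < ‖w - p j‖ := by
            rw [norm_pos_iff, sub_ne_zero]
            rintro rfl
            obtain ⟨x, y, hx, hy, hxy⟩ := (hopen _).1 hw1
            -- If the open cone contained its apex, then -xρ₁u would be a positive multiple of the
            -- second side, so the angle π would belong to the closed cone of opening γ < π.
            have := (hpole (x * ρ₁) Real.pi (by positivity) hπ.le (by linarith)).2.1
              ⟨0, y, le_rfl, hy.le, by
                rw [Complex.exp_pi_mul_I]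
                push_cast
                linear_combination hxy⟩
            linarith
          rw [h2] at hw1
          obtain ⟨h3, h4⟩ := (hpole _ φ hs h0 h1).1.1 ((hopen _).1 hw1)
          exact ⟨_, φ, hs, by rwa [← dist_eq_norm], h3, h4, h2⟩
    · refine ⟨2 - γ / Real.pi, ⟨?_, ?_, u * Complex.exp (γ * Complex.I), r, ?_, hr, ?_⟩,
        fun h => absurd (mem_range_self i) h, fun j hj => Or.inr ⟨?_, ?_⟩⟩
      · have : γ / Real.pi < 2 := by rw [div_lt_iff₀ hπ]; linarith
        linarith
      · have : 0 < γ / Real.pi := by positivity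
        linarith
      · rw [norm_mul, hu, Complex.norm_exp_ofReal_mul_I, one_mul]
      · rw [h, sub_mul, div_mul_cancel₀ _ hπ.ne']
      · have : γ / Real.pi < 1 := by rwa [div_lt_one hπ]
        linarith
      · obtain rfl := hp.injective hj
        refine ⟨r, hr, ?_⟩
        have key : ∀ w ∈ ball (p j) r, w ∈ p.exterior ↔ w ∉ p.closedSector j := by
          intro w hw
          have h' : w ∈ p.exterior ↔ w ∈ circularSector (p j)
              (u * Complex.exp (γ * Complex.I)) (2 * Real.pi - γ) r := by
            have := Set.ext_iff.1 h w
            rw [mem_inter_iff] at this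
            exact ⟨fun h => this.1 ⟨h, hw⟩, fun h => (this.2 h).1⟩
          rw [h', IsCornerAt.mem_sector_right_iff]
          constructor
          · rintro ⟨s, φ, h1, h2, h3, h4, rfl⟩ h5
            have := (hpole s φ h1 (by linarith) h4).2.1 ((hclosed _).1 h5)
            linarith
          · intro h5
            obtain ⟨φ, h0, h1, h2⟩ := exists_polar_around hu (p j) w
            have hs : 0 < ‖w - p j‖ := by
              rw [norm_pos_iff, sub_ne_zero]
              rintro rfl
              exact h5 ⟨0, 0, le_rfl, le_rfl, by simp⟩
            refine ⟨_, φ, hs, by rwa [← dist_eq_norm], ?_, h1, h2⟩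
            by_contra! h6
            apply h5
            rw [h2]
            exact (hclosed _).2 ((hpole _ φ hs h0 h1).2.2 h6)
        ext w
        constructor
        · rintro ⟨h1, h2⟩
          exact ⟨by_contra fun h3 => h1 ((key w h2).2 h3), h2⟩
        · rintro ⟨h1, h2⟩
          exact ⟨fun h3 => (key w h2).1 h3 h1, h2⟩
  · obtain ⟨i, s, hs, rfl⟩ := p.exists_edgePath_eq hw
    have hs0 : 0 < s := by
      refine lt_of_le_of_ne hs.1 ?_
      rintro rfl
      exact hwv ⟨i, by simp⟩
    obtain ⟨u, r, hcorner⟩ := hp.exists_isCornerAt_side i ⟨hs0, hs.2⟩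
    refine ⟨1, ⟨one_pos, one_lt_two, ?_⟩, fun _ => rfl, fun j hj => absurd ⟨j, hj⟩ hwv⟩
    rw [one_mul]
    rcases hE.inter_ball_eq hcorner hcl with h | h
    · exact ⟨u, r, hcorner.norm_eq, hcorner.pos, h⟩
    · refine ⟨_, r, ?_, hcorner.pos, h.trans (by rw [two_mul, add_sub_cancel_right])⟩
      rw [norm_mul, hcorner.norm_eq, Complex.norm_exp_ofReal_mul_I, one_mul]

end Polygon

/-! ### Counting roots of polynomials in the unit disk -/

namespace Polynomial

/-- The number of roots of a polynomial in the open unit disk, with multiplicities. -/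
noncomputable def diskRootCount (F : Polynomial ℂ) : ℕ :=
  F.roots.countP fun z => ‖z‖ < 1

/-- By Cauchy, a point inside the circle contributes 2πi and a point outside contributes 0. Applied
to the roots of F this is the argument principle, by partial fractions of F'/F. -/
theorem circleIntegral_sum_one_div_sub (M : Multiset ℂ) (hM : ∀ r ∈ M, ‖r‖ ≠ 1) :
    CircleIntegrable (fun z => (M.map fun r => 1 / (z - r)).sum) 0 1 ∧
    ∮ z in C(0, 1), (M.map fun r => 1 / (z - r)).sum =
      2 * Real.pi * Complex.I * (M.countP fun z => ‖z‖ < 1 : ℕ) := by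
  induction M using Multiset.induction with
  | empty => simp [circleIntegral]
  | cons r M ih =>
    obtain ⟨ih1, ih2⟩ := ih fun s hs => hM s (Multiset.mem_cons_of_mem hs)
    have hr := hM r (Multiset.mem_cons_self r M)
    have hcont : ∀ z : ℂ, ‖z‖ = 1 → z - r ≠ 0 := by
      rintro z hz h
      rw [sub_eq_zero.1 h] at hz
      exact hr hz
    have hint : CircleIntegrable (fun z => 1 / (z - r)) 0 1 := by
      refine ContinuousOn.circleIntegrable zero_le_one ?_
      refine continuousOn_const.div (continuousOn_id.sub continuousOn_const) fun z hz => hcont z ?_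
      simpa using hz
    simp only [Multiset.map_cons, Multiset.sum_cons]
    refine ⟨hint.add ih1, ?_⟩
    rw [circleIntegral.integral_add hint ih1, ih2]
    rcases lt_or_gt_of_ne hr with h | h
    · rw [Multiset.countP_cons_of_pos (p := fun z : ℂ => ‖z‖ < 1) _ h]
      have := circleIntegral.integral_sub_inv_of_mem_ball (c := 0) (R := 1) (w := r) (by simpa using h)
      simp only [one_div]
      rw [this]
      push_cast
      ring
    · rw [Multiset.countP_cons_of_neg (p := fun z : ℂ => ‖z‖ < 1) _ h.not_gt]
      have : ∮ z in C(0, 1), 1 / (z - r) = 0 := by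
        refine DiffContOnCl.circleIntegral_eq_zero zero_le_one
          (DifferentiableOn.diffContOnCl (s := ball 0 1) ?_)
        rw [closure_ball _ one_ne_zero]
        intro z hz
        refine DifferentiableAt.differentiableWithinAt ?_
        refine (differentiableAt_const _).div (differentiableAt_id.sub_const _) fun h0 => ?_
        rw [mem_closedBall_zero_iff, sub_eq_zero.1 h0] at hz
        linarith
      rw [this, zero_add]

/-- The argument principle for polynomials. -/
theorem circleIntegral_derivative_div (F : Polynomial ℂ) (hF : ∀ z : ℂ, ‖z‖ = 1 → F.eval z ≠ 0) :
    CircleIntegrable (fun z => F.derivative.eval z / F.eval z) 0 1 ∧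
    ∮ z in C(0, 1), F.derivative.eval z / F.eval z =
      2 * Real.pi * Complex.I * (F.diskRootCount : ℕ) := by
  have hroots : ∀ r ∈ F.roots, ‖r‖ ≠ 1 := fun r hr h => hF r h (isRoot_of_mem_roots hr)
  have heq : EqOn (fun z => F.derivative.eval z / F.eval z)
      (fun z => (F.roots.map fun r => 1 / (z - r)).sum) (sphere 0 1) := fun z hz =>
    (IsAlgClosed.splits F).eval_derivative_div_eval_of_ne_zero (hF z (by simpa using hz))
  obtain ⟨h1, h2⟩ := circleIntegral_sum_one_div_sub F.roots hroots
  refine ⟨ContinuousOn.circleIntegrable zero_le_one ?_, ?_⟩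
  · exact F.derivative.continuous.continuousOn.div F.continuous.continuousOn
      fun z hz => hF z (by simpa using hz)
  · rw [circleIntegral.integral_congr zero_le_one heq, h2]
    rfl

/-- **Rouché's theorem** for polynomials, in its symmetric form. -/
theorem diskRootCount_eq_of_norm_sub_lt {F G : Polynomial ℂ}
    (h : ∀ z : ℂ, ‖z‖ = 1 → ‖F.eval z - G.eval z‖ < ‖F.eval z‖ + ‖G.eval z‖) :
    F.diskRootCount = G.diskRootCount := by
  have hF : ∀ z : ℂ, ‖z‖ = 1 → F.eval z ≠ 0 := fun z hz h0 => by
    have := h z hz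
    simp [h0] at this
  have hG : ∀ z : ℂ, ‖z‖ = 1 → G.eval z ≠ 0 := fun z hz h0 => by
    have := h z hz
    simp [h0] at this
  obtain ⟨iF, eF⟩ := F.circleIntegral_derivative_div hF
  obtain ⟨iG, eG⟩ := G.circleIntegral_derivative_div hG
  have hzero : ∮ z in C(0, 1), (F.derivative.eval z / F.eval z - G.derivative.eval z / G.eval z)
      = 0 := by
    refine circleIntegral.integral_eq_zero_of_hasDerivWithinAt
      (f := fun z => Complex.log (F.eval z / G.eval z)) zero_le_one fun z hz => ?_
    have hz1 : ‖z‖ = 1 := by simpa using hz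
    have hFz := hF z hz1
    have hGz := hG z hz1
    -- A negative value of F/G would force |F - G| = |F| + |G|. So log(F/G) is a primitive of the
    -- integrand along the whole circle.
    have hslit : F.eval z / G.eval z ∈ Complex.slitPlane := by
      by_contra hs
      rw [Complex.mem_slitPlane_iff_arg, not_and_or, not_not, not_not] at hs
      have h3 := h z hz1
      rcases hs with hs | hs
      · have h1 := (Complex.arg_eq_pi_iff.1 hs)
        have h4 : F.eval z / G.eval z = -‖F.eval z / G.eval z‖ := by
          have := Complex.norm_mul_exp_arg_mul_I (F.eval z / G.eval z)
          rw [hs, Complex.exp_pi_mul_I] at this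
          rw [← this]; simp
        have h5 : F.eval z - G.eval z = -G.eval z * ((‖F.eval z / G.eval z‖ + 1 : ℝ) : ℂ) := by
          push_cast
          field_simp at h4 ⊢
          linear_combination h4
        rw [h5, norm_mul, norm_neg, Complex.norm_real, Real.norm_of_nonneg (by positivity),
          norm_div] at h3
        have : 0 < ‖G.eval z‖ := norm_pos_iff.2 hGz
        field_simp at h3
        linarith
      · exact div_ne_zero hFz hGz hs
    have hd := ((F.hasDerivAt z).fun_div (G.hasDerivAt z) hGz).clog hslit
    refine (hd.congr_deriv ?_).hasDerivWithinAt
    field_simp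
  rw [circleIntegral.integral_sub iF iG, eF, eG, ← mul_sub, mul_eq_zero] at hzero
  have hne : (2 * Real.pi * Complex.I : ℂ) ≠ 0 := by
    simp [Real.pi_ne_zero]
  have := hzero.resolve_left hne
  exact_mod_cast sub_eq_zero.1 this

theorem diskRootCount_mul {F G : Polynomial ℂ} (hF : F ≠ 0) (hG : G ≠ 0) :
    (F * G).diskRootCount = F.diskRootCount + G.diskRootCount := by
  rw [diskRootCount, roots_mul (mul_ne_zero hF hG), Multiset.countP_add]
  rfl

theorem diskRootCount_C_mul (F : Polynomial ℂ) {c : ℂ} (hc : c ≠ 0) :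
    (C c * F).diskRootCount = F.diskRootCount := by
  rw [diskRootCount, roots_C_mul _ hc]
  rfl

theorem diskRootCount_eq_zero {F : Polynomial ℂ} (h : ∀ z : ℂ, ‖z‖ < 1 → F.eval z ≠ 0) :
    F.diskRootCount = 0 :=
  Multiset.countP_eq_zero.2 fun z hz h1 => h z h1 (isRoot_of_mem_roots hz)

theorem diskRootCount_eq_natDegree {F : Polynomial ℂ} (h : ∀ z : ℂ, 1 ≤ ‖z‖ → F.eval z ≠ 0) :
    F.diskRootCount = F.natDegree := by
  rw [(IsAlgClosed.splits F).natDegree_eq_card_roots]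
  exact Multiset.countP_eq_card.2 fun z hz => not_le.1 fun h1 =>
    h z h1 (isRoot_of_mem_roots hz)

/-- The multiplicities of the roots in the disk add up to the number of roots. -/
theorem tsum_rootMultiplicity (F : Polynomial ℂ) :
    ∑' z : ball (0 : ℂ) 1, (F.rootMultiplicity (z : ℂ) : ℕ∞) = F.diskRootCount := by
  classical
  rw [tsum_subtype (ball (0 : ℂ) 1) fun z => (F.rootMultiplicity z : ℕ∞),
    tsum_eq_sum (s := (F.roots.filter fun z => ‖z‖ < 1).toFinset)]
  · rw [diskRootCount, Multiset.countP_eq_card_filter, ← Multiset.toFinset_sum_count_eq]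
    push_cast
    refine Finset.sum_congr rfl fun z hz => ?_
    have hz1 := (Multiset.mem_filter.1 (Multiset.mem_toFinset.1 hz)).2
    rw [indicator_of_mem (by simpa using hz1), Multiset.count_filter_of_pos (p := fun z : ℂ => ‖z‖ < 1) hz1, count_roots]
  · intro z hz
    rw [indicator_apply_eq_zero]
    intro h
    by_contra h0
    refine hz (Multiset.mem_toFinset.2 (Multiset.mem_filter.2 ⟨?_, by simpa using h⟩))
    rw [← Multiset.count_pos, count_roots]
    exact Nat.pos_of_ne_zero fun h1 => h0 (by rw [h1]; rfl)

end Polynomial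

/-! ### The polynomials A and B of the Schwarz–Christoffel formula -/

namespace Polynomial

variable {ι : Type*}

/-- The monic polynomial with simple roots at the nodes `ζ i`. -/
noncomputable def nodePoly (ζ : ι → ℂ) (s : Finset ι) : Polynomial ℂ :=
  ∏ j ∈ s, (X - C (ζ j))

variable {ζ : ι → ℂ} {ν : ι → ℝ} {s : Finset ι} {z : ℂ}

theorem eval_nodePoly (z : ℂ) : (nodePoly ζ s).eval z = ∏ j ∈ s, (z - ζ j) := by
  simp [nodePoly, eval_prod]

theorem eval_nodePoly_ne_zero (h : ∀ j ∈ s, z ≠ ζ j) : (nodePoly ζ s).eval z ≠ 0 := by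
  rw [eval_nodePoly]
  exact Finset.prod_ne_zero_iff.2 fun j hj => sub_ne_zero.2 (h j hj)

theorem monic_nodePoly : (nodePoly ζ s).Monic :=
  monic_prod_of_monic _ _ fun i _ => monic_X_sub_C (ζ i)

theorem natDegree_nodePoly : (nodePoly ζ s).natDegree = s.card := by
  rw [nodePoly, natDegree_prod_of_monic _ _ fun i _ => monic_X_sub_C (ζ i)]
  simp

theorem coeff_nodePoly : (nodePoly ζ s).coeff s.card = 1 := by
  rw [← natDegree_nodePoly (ζ := ζ) (s := s), monic_nodePoly.coeff_natDegree]

theorem nodePoly_union [DecidableEq ι] {t : Finset ι} (h : Disjoint s t) :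
    nodePoly ζ (s ∪ t) = nodePoly ζ s * nodePoly ζ t := Finset.prod_union h

variable [DecidableEq ι]

/-- The numerator of `∑ i, (ν i / 2) (z + ζ i) / (z - ζ i)` over the denominator `nodePoly`. -/
noncomputable def herglotzPoly (ζ : ι → ℂ) (ν : ι → ℝ) (s : Finset ι) : Polynomial ℂ :=
  ∑ i ∈ s, C ((ν i : ℂ) / 2) * ((X + C (ζ i)) * nodePoly ζ (s.erase i))

theorem eval_herglotzPoly (z : ℂ) : (herglotzPoly ζ ν s).eval z =
    ∑ i ∈ s, (ν i : ℂ) / 2 * ((z + ζ i) * ∏ j ∈ s.erase i, (z - ζ j)) := by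
  simp [herglotzPoly, eval_finsetSum, eval_nodePoly]

theorem eval_herglotzPoly_eq_mul (h : ∀ j ∈ s, z ≠ ζ j) : (herglotzPoly ζ ν s).eval z =
    (nodePoly ζ s).eval z * ∑ i ∈ s, (ν i : ℂ) / 2 * ((z + ζ i) / (z - ζ i)) := by
  rw [eval_herglotzPoly, eval_nodePoly, Finset.mul_sum]
  refine Finset.sum_congr rfl fun i hi => ?_
  rw [← Finset.mul_prod_erase s _ hi]
  have := sub_ne_zero.2 (h i hi)
  field_simp

/-- Since |ζ| = 1, Re((z + ζ) conj(z - ζ)) = |z|² - 1. With weights of one sign, the sign of Re(A/B)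
is therefore decided by the side of the circle on which z lies. -/
theorem re_herglotzPoly_mul_conj (hζ : ∀ i ∈ s, ‖ζ i‖ = 1) (z : ℂ) :
    ((herglotzPoly ζ ν s).eval z * starRingEnd ℂ ((nodePoly ζ s).eval z)).re =
      (‖z‖ ^ 2 - 1) * ∑ i ∈ s, ν i / 2 * Complex.normSq (∏ j ∈ s.erase i, (z - ζ j)) := by
  rw [eval_herglotzPoly, eval_nodePoly, Finset.sum_mul, Complex.re_sum, Finset.mul_sum]
  refine Finset.sum_congr rfl fun i hi => ?_
  rw [← Finset.mul_prod_erase s _ hi, map_mul]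
  set p := ∏ j ∈ s.erase i, (z - ζ j)
  have h1 : (ν i : ℂ) / 2 * ((z + ζ i) * p) * (starRingEnd ℂ (z - ζ i) * starRingEnd ℂ p) =
      ((ν i / 2 * Complex.normSq p : ℝ) : ℂ) * ((z + ζ i) * starRingEnd ℂ (z - ζ i)) := by
    push_cast
    rw [← Complex.mul_conj]
    ring
  rw [h1, Complex.re_ofReal_mul]
  have h2 : ((z + ζ i) * starRingEnd ℂ (z - ζ i)).re = ‖z‖ ^ 2 - ‖ζ i‖ ^ 2 := by
    rw [Complex.sq_norm, Complex.sq_norm, Complex.normSq_apply, Complex.normSq_apply]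
    simp
    ring
  rw [h2, hζ i hi]
  ring

theorem re_herglotzPoly_mul_conj_of_norm_eq_one (hζ : ∀ i ∈ s, ‖ζ i‖ = 1) (hz : ‖z‖ = 1) :
    ((herglotzPoly ζ ν s).eval z * starRingEnd ℂ ((nodePoly ζ s).eval z)).re = 0 := by
  rw [re_herglotzPoly_mul_conj hζ, hz]
  ring

/-- At a node only its own summand survives, and it is nonzero because the nodes are distinct. -/
theorem herglotzPoly_ne_zero_or (hζi : InjOn ζ s) (hζ : ∀ i ∈ s, ‖ζ i‖ = 1)
    (hν : ∀ i ∈ s, ν i ≠ 0) (z : ℂ) :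
    (herglotzPoly ζ ν s).eval z ≠ 0 ∨ (nodePoly ζ s).eval z ≠ 0 := by
  by_cases h : ∃ i ∈ s, z = ζ i
  · left
    obtain ⟨i, hi, rfl⟩ := h
    rw [eval_herglotzPoly, Finset.sum_eq_single_of_mem i hi]
    · refine mul_ne_zero (div_ne_zero (by exact_mod_cast hν i hi) two_ne_zero) (mul_ne_zero ?_ ?_)
      · rw [← two_mul]
        refine mul_ne_zero two_ne_zero (norm_pos_iff.1 ?_)
        rw [hζ i hi]
        exact one_pos
      · refine Finset.prod_ne_zero_iff.2 fun j hj => sub_ne_zero.2 fun h => ?_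
        exact (Finset.mem_erase.1 hj).1 (hζi (Finset.mem_erase.1 hj).2 hi h.symm)
    · intro j hj hji
      rw [Finset.prod_eq_zero (Finset.mem_erase.2 ⟨hji.symm, hi⟩) (sub_self _), mul_zero, mul_zero]
  · right
    push Not at h
    exact eval_nodePoly_ne_zero h

theorem natDegree_herglotzPoly_term {i : ι} (hi : i ∈ s) :
    ((X + C (ζ i)) * nodePoly ζ (s.erase i)).Monic ∧
      ((X + C (ζ i)) * nodePoly ζ (s.erase i)).natDegree = s.card := by
  refine ⟨(monic_X_add_C _).mul monic_nodePoly, ?_⟩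
  rw [(monic_X_add_C _).natDegree_mul monic_nodePoly, natDegree_X_add_C, natDegree_nodePoly,
    Finset.card_erase_of_mem hi]
  have := Finset.card_pos.2 ⟨i, hi⟩
  omega

theorem natDegree_herglotzPoly_le : (herglotzPoly ζ ν s).natDegree ≤ s.card :=
  natDegree_sum_le_of_forall_le _ _ fun _ hi =>
    (natDegree_C_mul_le _ _).trans (natDegree_herglotzPoly_term hi).2.le

theorem coeff_herglotzPoly : (herglotzPoly ζ ν s).coeff s.card = ((∑ i ∈ s, ν i / 2 : ℝ) : ℂ) := by
  rw [herglotzPoly, finsetSum_coeff]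
  push_cast
  refine Finset.sum_congr rfl fun i hi => ?_
  obtain ⟨h1, h2⟩ := natDegree_herglotzPoly_term (ζ := ζ) hi
  rw [coeff_C_mul, ← h2, h1.coeff_natDegree, mul_one]

theorem herglotzPoly_union {t : Finset ι} (h : Disjoint s t) :
    herglotzPoly ζ ν (s ∪ t) =
      herglotzPoly ζ ν s * nodePoly ζ t + herglotzPoly ζ ν t * nodePoly ζ s := by
  rw [herglotzPoly, Finset.sum_union h, herglotzPoly, herglotzPoly, Finset.sum_mul, Finset.sum_mul]
  congr 1
  · refine Finset.sum_congr rfl fun i hi => ?_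
    have h1 : (s ∪ t).erase i = s.erase i ∪ t := by
      rw [Finset.erase_union_distrib, Finset.erase_eq_of_notMem (Finset.disjoint_left.1 h hi)]
    rw [h1, nodePoly_union (Finset.disjoint_of_subset_left (Finset.erase_subset _ _) h)]
    ring
  · refine Finset.sum_congr rfl fun i hi => ?_
    have h1 : (s ∪ t).erase i = s ∪ t.erase i := by
      rw [Finset.erase_union_distrib, Finset.erase_eq_of_notMem (Finset.disjoint_right.1 h hi)]
    rw [h1, nodePoly_union (Finset.disjoint_of_subset_right (Finset.erase_subset _ _) h)]
    ring

/-- The polynomial whose roots are the poles of the best Möbius approximation has as many roots in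
the disk as there are negative weights. -/
theorem diskRootCount_nodePoly_sub_herglotzPoly {P M : Finset ι} (hd : Disjoint P M)
    (hζi : InjOn ζ (P ∪ M : Finset ι)) (hζ : ∀ i ∈ P ∪ M, ‖ζ i‖ = 1) (hP : ∀ i ∈ P, 0 < ν i)
    (hM : ∀ i ∈ M, ν i < 0) :
    (nodePoly ζ (P ∪ M) - herglotzPoly ζ ν (P ∪ M)).diskRootCount = M.card ∧
    ∀ z : ℂ, ‖z‖ = 1 → (nodePoly ζ (P ∪ M) - herglotzPoly ζ ν (P ∪ M)).eval z ≠ 0 := by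
  have hζP : ∀ i ∈ P, ‖ζ i‖ = 1 := fun i hi => hζ i (Finset.mem_union_left _ hi)
  have hζM : ∀ i ∈ M, ‖ζ i‖ = 1 := fun i hi => hζ i (Finset.mem_union_right _ hi)
  have hζiP : InjOn ζ P := hζi.mono (by simp)
  have hζiM : InjOn ζ M := hζi.mono (by simp)
  have hνne : ∀ i ∈ P ∪ M, ν i ≠ 0 := fun i hi => by
    rcases Finset.mem_union.1 hi with h | h
    · exact (hP i h).ne'
    · exact (hM i h).ne
  set T := nodePoly ζ (P ∪ M) - herglotzPoly ζ ν (P ∪ M) with hT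
  have hne : ∀ z : ℂ, ‖z‖ = 1 → T.eval z ≠ 0 := by
    intro z hz h0
    rw [hT, eval_sub, sub_eq_zero] at h0
    have h1 := re_herglotzPoly_mul_conj_of_norm_eq_one (ν := ν) hζ hz
    rw [h0, Complex.mul_conj, Complex.ofReal_re, Complex.normSq_eq_zero] at h1
    rcases herglotzPoly_ne_zero_or hζi hζ hνne z with h | h
    · exact h h1
    · exact h (h0.trans h1)
  refine ⟨?_, hne⟩
  -- With x = A_P/B_P and y = A_M/B_M one has T/B = 1 - x - y, and (2 - x)(1 - y) - 2(1 - x - y) =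
  -- x(1 + y); the factor 2 is chosen for this. On the circle x and y are imaginary, so |x| ≤ |2 -
  -- x| and |1 + y| = |1 - y|: Rouché compares F₁F₂ with 2T. F₁ has all its |M| zeros in the disk,
  -- F₂ has none there.
  set F₁ := nodePoly ζ M - herglotzPoly ζ ν M with hF₁
  set F₂ := C 2 * nodePoly ζ P - herglotzPoly ζ ν P with hF₂
  have hF₁ne : ∀ z : ℂ, 1 ≤ ‖z‖ → F₁.eval z ≠ 0 := by
    intro z hz h0
    rw [hF₁, eval_sub, sub_eq_zero] at h0
    have h1 := re_herglotzPoly_mul_conj (ν := ν) hζM z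
    rw [← h0, Complex.mul_conj, Complex.ofReal_re] at h1
    have h2 : (‖z‖ ^ 2 - 1) * ∑ i ∈ M, ν i / 2 * Complex.normSq (∏ j ∈ M.erase i, (z - ζ j)) ≤ 0 := by
      refine mul_nonpos_of_nonneg_of_nonpos (by nlinarith) (Finset.sum_nonpos fun i hi => ?_)
      exact mul_nonpos_of_nonpos_of_nonneg (by linarith [hM i hi]) (Complex.normSq_nonneg _)
    have h3 : (nodePoly ζ M).eval z = 0 :=
      Complex.normSq_eq_zero.1 (le_antisymm (h1 ▸ h2) (Complex.normSq_nonneg _))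
    rcases herglotzPoly_ne_zero_or hζiM hζM (fun i hi => (hM i hi).ne) z with h | h
    · exact h (h0 ▸ h3)
    · exact h h3
  have hF₂ne : ∀ z : ℂ, ‖z‖ < 1 → F₂.eval z ≠ 0 := by
    intro z hz h0
    rw [hF₂, eval_sub, eval_mul, eval_C, sub_eq_zero] at h0
    have h1 := re_herglotzPoly_mul_conj (ν := ν) hζP z
    rw [← h0, mul_assoc, Complex.mul_conj] at h1
    have h2 : (‖z‖ ^ 2 - 1) * ∑ i ∈ P, ν i / 2 * Complex.normSq (∏ j ∈ P.erase i, (z - ζ j)) ≤ 0 := by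
      refine mul_nonpos_of_nonpos_of_nonneg (by nlinarith [norm_nonneg z])
        (Finset.sum_nonneg fun i hi => ?_)
      exact mul_nonneg (by linarith [hP i hi]) (Complex.normSq_nonneg _)
    have h3 : (nodePoly ζ P).eval z ≠ 0 := eval_nodePoly_ne_zero fun j hj h => by
      rw [h, hζP j hj] at hz
      exact lt_irrefl _ hz
    have h4 := Complex.normSq_pos.2 h3
    have h5 : (2 * (Complex.normSq ((nodePoly ζ P).eval z) : ℂ)).re =
      2 * Complex.normSq ((nodePoly ζ P).eval z) := by simp
    linarith
  have hF₂ne' : ∀ z : ℂ, ‖z‖ = 1 →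
      ‖(herglotzPoly ζ ν P).eval z‖ ≤ ‖F₂.eval z‖ ∧
      ‖(nodePoly ζ M).eval z + (herglotzPoly ζ ν M).eval z‖ = ‖F₁.eval z‖ := by
    intro z hz
    have h1 := re_herglotzPoly_mul_conj_of_norm_eq_one (ν := ν) hζP hz
    have h2 := re_herglotzPoly_mul_conj_of_norm_eq_one (ν := ν) hζM hz
    constructor
    · rw [← sq_le_sq₀ (norm_nonneg _) (norm_nonneg _), Complex.sq_norm, Complex.sq_norm, hF₂,
        eval_sub, eval_mul, eval_C, ← Complex.normSq_neg (2 * _ - _), neg_sub,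
        Complex.normSq_sub]
      have : (eval z (herglotzPoly ζ ν P) * starRingEnd ℂ (2 * eval z (nodePoly ζ P))).re = 0 := by
        rw [map_mul, Complex.conj_ofNat, mul_left_comm, show (2 : ℂ) = ((2 : ℝ) : ℂ) by norm_num,
          Complex.re_ofReal_mul, h1, mul_zero]
      rw [this]
      linarith [Complex.normSq_nonneg (2 * eval z (nodePoly ζ P))]
    · rw [← sq_eq_sq₀ (norm_nonneg _) (norm_nonneg _), Complex.sq_norm, Complex.sq_norm, hF₁,
        eval_sub, ← Complex.normSq_neg (_ - _), neg_sub, Complex.normSq_sub, add_comm,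
        Complex.normSq_add, h2]
      ring
  have hcoeff : F₁.coeff M.card = ((1 - ∑ i ∈ M, ν i / 2 : ℝ) : ℂ) := by
    rw [hF₁, coeff_sub, coeff_nodePoly, coeff_herglotzPoly]
    push_cast
    ring
  have hcoeff0 : F₁.coeff M.card ≠ 0 := by
    rw [hcoeff]
    have : ∑ i ∈ M, ν i / 2 ≤ 0 := Finset.sum_nonpos fun i hi => by linarith [hM i hi]
    exact_mod_cast (by linarith : (0 : ℝ) < 1 - ∑ i ∈ M, ν i / 2).ne'
  have hdeg : F₁.natDegree = M.card := by
    refine natDegree_eq_of_le_of_coeff_ne_zero ?_ hcoeff0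
    exact (natDegree_sub_le _ _).trans (max_le natDegree_nodePoly.le natDegree_herglotzPoly_le)
  have h2 : (2 : ℂ) ≠ 0 := two_ne_zero
  rw [← hdeg, ← diskRootCount_eq_natDegree hF₁ne, ← diskRootCount_C_mul T h2]
  have hF₁0 : F₁ ≠ 0 := fun h => hF₁ne 1 (by simp) (by rw [h, eval_zero])
  have hF₂0 : F₂ ≠ 0 := fun h => hF₂ne 0 (by simp) (by rw [h, eval_zero])
  have hsum : (F₁ * F₂).diskRootCount = F₁.diskRootCount := by
    rw [diskRootCount_mul hF₁0 hF₂0, diskRootCount_eq_zero hF₂ne, add_zero]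
  rw [← hsum]
  symm
  refine diskRootCount_eq_of_norm_sub_lt fun z hz => ?_
  have h3 : (F₁ * F₂).eval z - (C 2 * T).eval z =
      (herglotzPoly ζ ν P).eval z * ((nodePoly ζ M).eval z + (herglotzPoly ζ ν M).eval z) := by
    rw [hT, nodePoly_union hd, herglotzPoly_union hd, hF₁, hF₂]
    simp only [eval_mul, eval_sub, eval_add, eval_C]
    ring
  obtain ⟨h4, h5⟩ := hF₂ne' z hz
  have h6 : 0 < ‖(C 2 * T).eval z‖ := by
    rw [norm_pos_iff, eval_mul, eval_C]
    exact mul_ne_zero h2 (hne z hz)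
  rw [h3, norm_mul, h5, eval_mul, norm_mul]
  nlinarith [norm_nonneg (F₁.eval z)]

/-- The two combinations of the polynomials are reflections of each other in the unit circle. -/
theorem nodePoly_add_herglotzPoly_eq (hζ : ∀ i ∈ s, ‖ζ i‖ = 1) (hz : z ≠ 0) :
    (nodePoly ζ s + herglotzPoly ζ ν s).eval z = (∏ i ∈ s, (-ζ i)) * z ^ s.card *
      starRingEnd ℂ ((nodePoly ζ s - herglotzPoly ζ ν s).eval (starRingEnd ℂ z)⁻¹) := by
  have hconj : ∀ i ∈ s, ζ i * starRingEnd ℂ (ζ i) = 1 := fun i hi => by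
    rw [Complex.mul_conj, Complex.normSq_eq_norm_sq, hζ i hi]; simp
  -- This is z - ζ = -ζz(1/z - conj ζ). The factor z + ζ = ζz(1/z + conj ζ) comes with the opposite
  -- sign, which turns B - A into B + A.
  have hfac : ∀ t ⊆ s, (∏ i ∈ t, (-ζ i)) * z ^ t.card *
      ∏ j ∈ t, (z⁻¹ - starRingEnd ℂ (ζ j)) = ∏ j ∈ t, (z - ζ j) := by
    intro t ht
    rw [← Finset.prod_const, ← Finset.prod_mul_distrib, ← Finset.prod_mul_distrib]
    refine Finset.prod_congr rfl fun j hj => ?_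
    have := hconj j (ht hj)
    field_simp
    linear_combination z * this
  rw [eval_add, eval_sub, map_sub, eval_nodePoly, eval_nodePoly, eval_herglotzPoly,
    eval_herglotzPoly, map_prod, map_sum, mul_sub, sub_eq_add_neg]
  simp only [map_sub, map_inv₀, Complex.conj_conj, map_mul, map_div₀, map_add, map_prod,
    Complex.conj_ofReal, Complex.conj_ofNat]
  rw [hfac s subset_rfl, Finset.mul_sum, ← Finset.sum_neg_distrib]
  congr 1
  refine Finset.sum_congr rfl fun i hi => ?_
  rw [← hfac _ (Finset.erase_subset i s), ← Finset.mul_prod_erase s (fun i => -ζ i) hi,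
    ← Finset.card_erase_add_one hi]
  have := hconj i hi
  generalize ∏ j ∈ s.erase i, (z⁻¹ - starRingEnd ℂ (ζ j)) = p
  generalize ∏ x ∈ s.erase i, -ζ x = q
  rw [pow_succ]
  field_simp
  linear_combination (-(ν i * z * q * p)) * this

end Polynomial

/-! ### Blaschke quotients from reflected polynomials -/

namespace Polynomial

theorem multiset_prod_map_reflect (R : Multiset ℂ) {z : ℂ} (hz : z ≠ 0) :
    z ^ R.card * (R.map fun r => z⁻¹ - starRingEnd ℂ r).prod =
      (R.map fun r => 1 - starRingEnd ℂ r * z).prod := by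
  rw [← Multiset.prod_replicate, ← Multiset.map_const', ← Multiset.prod_map_mul]
  refine congrArg Multiset.prod (Multiset.map_congr rfl fun r _ => ?_)
  rw [mul_sub, mul_inv_cancel₀ hz, mul_comm z]

/-- A quotient `S / T`, where `S` is the reflection of `T` in the unit circle, is a quotient of
finite Blaschke products. -/
theorem exists_blaschke_of_reflect {S T : Polynomial ℂ} {N : ℕ} {κ : ℂ} (hκ : ‖κ‖ = 1)
    (hdeg : T.natDegree ≤ N)
    (hST : ∀ z : ℂ, z ≠ 0 → S.eval z = κ * z ^ N * starRingEnd ℂ (T.eval (starRingEnd ℂ z)⁻¹))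
    (hS : Tendsto (fun z => S.eval z / z) (𝓝[≠] 0) (𝓝 0))
    (hT : ∀ z : ℂ, ‖z‖ = 1 → T.eval z ≠ 0)
    (hTS : ∀ z : ℂ, ‖z‖ < 1 → T.eval z = 0 → S.eval z ≠ 0) :
    ∃ (u : ℂ) (K M : Multiset ℂ), ‖u‖ = 1 ∧ (∀ a ∈ K, ‖a‖ < 1) ∧ (∀ a ∈ M, ‖a‖ < 1) ∧
      M.card = T.diskRootCount ∧ N = K.card + M.card + 2 ∧ (0 : ℂ) ∉ M ∧ (∀ a ∈ M, a ∉ K) ∧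
      ∀ z : ℂ, ‖z‖ < 1 → (T.eval z = 0 ↔ z ∈ M) ∧ (z ≠ 0 → S.eval z / T.eval z =
        u * z ^ 2 * (K.map fun a => (z - a) / (1 - starRingEnd ℂ a * z)).prod /
          (M.map fun a => (z - a) / (1 - starRingEnd ℂ a * z)).prod) := by
  have hT0 : T ≠ 0 := fun h => hT 1 (by simp) (by rw [h, eval_zero])
  set c := T.leadingCoeff with hc
  have hc0 : c ≠ 0 := leadingCoeff_ne_zero.2 hT0
  have hcard : T.roots.card = T.natDegree :=
    (IsAlgClosed.splits T).natDegree_eq_card_roots.symm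
  have hTz : ∀ z, T.eval z = c * (T.roots.map fun r => z - r).prod := fun z =>
    (IsAlgClosed.splits T).eval_eq_prod_roots z
  obtain ⟨e, he⟩ := Nat.exists_eq_add_of_le hdeg
  have hSz : ∀ z : ℂ, z ≠ 0 → S.eval z = κ * starRingEnd ℂ c * z ^ e *
      (T.roots.map fun r => 1 - starRingEnd ℂ r * z).prod := by
    intro z hz
    rw [hST z hz, hTz, ← multiset_prod_map_reflect _ hz, he, hcard, map_mul, map_multiset_prod,
      Multiset.map_map]
    have : (T.roots.map ((starRingEnd ℂ : ℂ → ℂ) ∘ fun r => (starRingEnd ℂ z)⁻¹ - r)) =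
        T.roots.map fun r => z⁻¹ - starRingEnd ℂ r :=
      Multiset.map_congr rfl fun r _ => by simp
    rw [this]
    ring
  have hcz : starRingEnd ℂ c ≠ 0 := by simpa using hc0
  have hκ0 : κ ≠ 0 := norm_pos_iff.1 (by rw [hκ]; exact one_pos)
  -- S is a nonzero constant times z^e times a product equal to 1 at the origin, so S(z)/z → 0
  -- forces e ≥ 2. Here e = N - deg T.
  have he2 : 2 ≤ e := by
    by_contra! hlt
    have h1 : Tendsto (fun z : ℂ => S.eval z / z * z ^ (1 - e)) (𝓝[≠] 0) (𝓝 (0 * 0 ^ (1 - e))) :=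
      hS.mul ((continuous_pow _).continuousAt.tendsto.mono_left nhdsWithin_le_nhds)
    rw [zero_mul] at h1
    have hcont : Continuous fun z : ℂ => κ * starRingEnd ℂ c *
        (T.roots.map fun r => 1 - starRingEnd ℂ r * z).prod :=
      continuous_const.mul (continuous_multiset_prod _ fun r _ => by fun_prop)
    have h2 : Tendsto (fun z : ℂ => κ * starRingEnd ℂ c *
        (T.roots.map fun r => 1 - starRingEnd ℂ r * z).prod) (𝓝[≠] 0) (𝓝 (κ * starRingEnd ℂ c)) := by
      have := (hcont.tendsto 0).mono_left (nhdsWithin_le_nhds (s := {0}ᶜ))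
      simpa using this
    refine mul_ne_zero hκ0 hcz (tendsto_nhds_unique (h2.congr' ?_) h1)
    filter_upwards [self_mem_nhdsWithin] with z hz
    have hz : z ≠ 0 := hz
    rw [hSz z hz]
    interval_cases e <;> simp [field]
  obtain ⟨e, rfl⟩ := Nat.exists_eq_add_of_le he2
  have hS0 : S.eval 0 = 0 := by
    have h1 : Tendsto (fun z : ℂ => S.eval z / z * z) (𝓝[≠] 0) (𝓝 (0 * 0)) :=
      hS.mul (tendsto_id.mono_left nhdsWithin_le_nhds)
    rw [zero_mul] at h1
    have h2 : Tendsto (fun z : ℂ => S.eval z) (𝓝[≠] 0) (𝓝 (S.eval 0)) :=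
      (S.continuous.tendsto 0).mono_left nhdsWithin_le_nhds
    refine tendsto_nhds_unique (h2.congr' ?_) h1
    filter_upwards [self_mem_nhdsWithin] with z hz
    exact (div_mul_cancel₀ _ hz).symm
  set M := T.roots.filter fun z => ‖z‖ < 1 with hM
  set O := T.roots.filter fun z => ¬ ‖z‖ < 1 with hO
  have hMO : M + O = T.roots := Multiset.filter_add_not _ _
  have hO1 : ∀ r ∈ O, 1 < ‖r‖ := fun r hr => by
    obtain ⟨h1, h2⟩ := Multiset.mem_filter.1 hr
    exact lt_of_le_of_ne (not_lt.1 h2) fun h => hT r h.symm (isRoot_of_mem_roots h1)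
  have hM1 : ∀ r ∈ M, ‖r‖ < 1 := fun r hr => (Multiset.mem_filter.1 hr).2
  have hMT : ∀ r ∈ M, T.eval r = 0 := fun r hr =>
    isRoot_of_mem_roots (Multiset.mem_filter.1 hr).1
  have hM0 : (0 : ℂ) ∉ M := fun h => hTS 0 (hM1 0 h) (hMT 0 h) hS0
  have hO0 : ∀ r ∈ O, r ≠ 0 := fun r hr => norm_pos_iff.1 (one_pos.trans (hO1 r hr))
  -- The zeros `M` of T inside give the denominator. A zero r outside gives (1 - conj r · z)/(z -
  -- r), which is conj r / r times the Blaschke factor with zero 1/conj r. The e zeros at 0 (after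
  -- removing z²) complete the numerator.
  refine ⟨κ * (starRingEnd ℂ c / c) * (O.map fun r => starRingEnd ℂ r / r).prod,
    Multiset.replicate e 0 + O.map fun r => (starRingEnd ℂ r)⁻¹, M, ?_, ?_, hM1, ?_, ?_, hM0, ?_,
    fun z hz => ⟨⟨fun h => Multiset.mem_filter.2 ⟨(mem_roots hT0).2 h, hz⟩, hMT z⟩, fun hz0 => ?_⟩⟩
  · have h1 : ‖(O.map fun r => starRingEnd ℂ r / r).prod‖ = 1 := by
      rw [← coe_nnnorm, ← nnnormHom_apply, map_multiset_prod, Multiset.map_map,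
        Multiset.prod_eq_one, NNReal.coe_one]
      intro x hx
      obtain ⟨r, hr, rfl⟩ := Multiset.mem_map.1 hx
      rw [Function.comp_apply, nnnormHom_apply, nnnorm_div, ← NNReal.coe_inj, NNReal.coe_div,
        coe_nnnorm, coe_nnnorm, Complex.norm_conj]
      exact div_self (norm_ne_zero_iff.2 (hO0 r hr))
    rw [norm_mul, norm_mul, norm_div, Complex.norm_conj, h1, hκ,
      div_self (norm_ne_zero_iff.2 hc0), mul_one, mul_one]
  · intro a ha
    rcases Multiset.mem_add.1 ha with h | h
    · rw [Multiset.eq_of_mem_replicate h, norm_zero]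
      exact one_pos
    · obtain ⟨r, hr, rfl⟩ := Multiset.mem_map.1 h
      rw [norm_inv, Complex.norm_conj]
      exact inv_lt_one_of_one_lt₀ (hO1 r hr)
  · rw [diskRootCount, Multiset.countP_eq_card_filter]
  · rw [he, ← hcard, ← hMO]
    simp only [Multiset.card_add, Multiset.card_replicate, Multiset.card_map]
    omega
  · intro a ha hK
    rcases Multiset.mem_add.1 hK with h | h
    · rw [Multiset.eq_of_mem_replicate h] at ha
      exact hM0 ha
    · obtain ⟨r, hr, rfl⟩ := Multiset.mem_map.1 h
      have hr0 : starRingEnd ℂ r ≠ 0 := by simpa using hO0 r hr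
      refine hTS _ (hM1 _ ha) (hMT _ ha) ?_
      rw [hSz _ (inv_ne_zero hr0), Multiset.prod_eq_zero, mul_zero]
      refine Multiset.mem_map.2 ⟨r, (Multiset.mem_filter.1 hr).1, ?_⟩
      rw [mul_inv_cancel₀ hr0, sub_self]
  · rw [hSz z hz0, hTz, ← hMO]
    have h1 : (O.map ((fun a => z - a) ∘ fun r => (starRingEnd ℂ r)⁻¹)).prod =
        (O.map fun r => 1 - starRingEnd ℂ r * z).prod * (O.map fun r => -(starRingEnd ℂ r)⁻¹).prod := by
      rw [← Multiset.prod_map_mul]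
      refine congrArg Multiset.prod (Multiset.map_congr rfl fun r hr => ?_)
      have hr0 : starRingEnd ℂ r ≠ 0 := by simpa using hO0 r hr
      simp only [Function.comp_apply]
      field_simp
      ring
    have h2 : (O.map ((fun a => 1 - starRingEnd ℂ a * z) ∘ fun r => (starRingEnd ℂ r)⁻¹)).prod =
        (O.map fun r => z - r).prod * (O.map fun r => -r⁻¹).prod := by
      rw [← Multiset.prod_map_mul]
      refine congrArg Multiset.prod (Multiset.map_congr rfl fun r hr => ?_)
      have hr0 := hO0 r hr
      simp only [Function.comp_apply, map_inv₀, Complex.conj_conj]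
      field_simp
      ring
    have h3 : (O.map fun r => starRingEnd ℂ r).prod * (O.map fun r => -(starRingEnd ℂ r)⁻¹).prod =
        (O.map fun r => r).prod * (O.map fun r => -r⁻¹).prod := by
      rw [← Multiset.prod_map_mul, ← Multiset.prod_map_mul]
      refine congrArg Multiset.prod (Multiset.map_congr rfl fun r hr => ?_)
      have hr0 := hO0 r hr
      have hr0' : starRingEnd ℂ r ≠ 0 := by simpa using hr0
      field_simp
    have h4 : (O.map fun r => -r⁻¹).prod ≠ 0 := by
      refine Multiset.prod_ne_zero fun h => ?_
      obtain ⟨r, hr, h⟩ := Multiset.mem_map.1 h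
      exact neg_ne_zero.2 (inv_ne_zero (hO0 r hr)) h
    have h5 : (O.map fun r => r).prod ≠ 0 := by
      refine Multiset.prod_ne_zero fun h => ?_
      obtain ⟨r, hr, h⟩ := Multiset.mem_map.1 h
      exact hO0 r hr h
    have hK : (O.map ((fun a => (z - a) / (1 - starRingEnd ℂ a * z)) ∘
        fun r => (starRingEnd ℂ r)⁻¹)).prod =
        ((O.map fun r => 1 - starRingEnd ℂ r * z).prod *
          (O.map fun r => -(starRingEnd ℂ r)⁻¹).prod) /
        ((O.map fun r => z - r).prod * (O.map fun r => -r⁻¹).prod) := by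
      rw [← h1, ← h2, ← Multiset.prod_map_div]
      rfl
    have hM' : (M.map fun a => (z - a) / (1 - starRingEnd ℂ a * z)).prod =
        (M.map fun a => z - a).prod / (M.map fun a => 1 - starRingEnd ℂ a * z).prod :=
      Multiset.prod_map_div
    have hO' : (O.map fun r => starRingEnd ℂ r / r).prod =
        (O.map fun r => starRingEnd ℂ r).prod / (O.map fun r => r).prod :=
      Multiset.prod_map_div
    simp only [Multiset.map_add, Multiset.prod_add]
    rw [Multiset.map_replicate, Multiset.prod_replicate,
      Multiset.map_map, hK, hM', hO', map_zero, sub_zero, zero_mul, sub_zero, div_one]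
    clear h1 h2 hK hM' hO'
    generalize (O.map fun r => starRingEnd ℂ r).prod = x1 at *
    generalize (O.map fun r => -(starRingEnd ℂ r)⁻¹).prod = x2 at *
    generalize (O.map fun r => r).prod = x3 at *
    generalize (O.map fun r => -r⁻¹).prod = x4 at *
    generalize (O.map fun r => 1 - starRingEnd ℂ r * z).prod = x5 at *
    generalize (O.map fun r => z - r).prod = x6 at *
    generalize (M.map fun r => 1 - starRingEnd ℂ r * z).prod = x7 at *
    generalize (M.map fun r => z - r).prod = x8 at *
    have h6 : x1 / x3 * (x2 / x4) = 1 := by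
      field_simp
      exact h3
    have h7 : κ * (starRingEnd ℂ c / c) * (x1 / x3) * z ^ 2 * (z ^ e * (x5 * x2 / (x6 * x4))) /
      (x8 / x7) = κ * (starRingEnd ℂ c / c) * z ^ 2 * (z ^ e * (x5 / x6)) /
      (x8 / x7) * (x1 / x3 * (x2 / x4)) := by ring
    rw [h7, h6, mul_one, div_div_eq_mul_div]
    ring

end Polynomial

/-! ### Value distribution of quotients of Blaschke products -/

namespace Polynomial

theorem norm_sub_eq_norm_one_sub_conj_mul {z : ℂ} (hz : ‖z‖ = 1) (a : ℂ) :
    ‖z - a‖ = ‖1 - starRingEnd ℂ a * z‖ := by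
  have h : starRingEnd ℂ z * (z - a) = starRingEnd ℂ (1 - starRingEnd ℂ a * z) := by
    have : z * starRingEnd ℂ z = 1 := by
      rw [Complex.mul_conj, Complex.normSq_eq_norm_sq, hz]; simp
    simp only [map_sub, map_one, map_mul, Complex.conj_conj]
    linear_combination this
  rw [← Complex.norm_conj (1 - _), ← h, norm_mul, Complex.norm_conj, hz, one_mul]

theorem one_sub_conj_mul_ne_zero {a z : ℂ} (ha : ‖a‖ < 1) (hz : ‖z‖ ≤ 1) :
    1 - starRingEnd ℂ a * z ≠ 0 := by
  intro h
  have h1 : ‖starRingEnd ℂ a * z‖ = 1 := by rw [← sub_eq_zero.1 h, norm_one]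
  rw [norm_mul, Complex.norm_conj] at h1
  nlinarith [norm_nonneg a, norm_nonneg z]

/-- The numerator `∏ (X - a)` of a finite Blaschke product. -/
noncomputable def blaschkeNum (R : Multiset ℂ) : Polynomial ℂ := (R.map fun a => X - C a).prod

/-- The denominator `∏ (1 - conj a X)` of a finite Blaschke product. -/
noncomputable def blaschkeDen (R : Multiset ℂ) : Polynomial ℂ :=
  (R.map fun a => 1 - C (starRingEnd ℂ a) * X).prod

variable {R K M : Multiset ℂ} {z : ℂ}

theorem eval_blaschkeNum (R : Multiset ℂ) (z : ℂ) :
    (blaschkeNum R).eval z = (R.map fun a => z - a).prod := by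
  rw [blaschkeNum, eval_multiset_prod, Multiset.map_map]
  simp

theorem eval_blaschkeDen (R : Multiset ℂ) (z : ℂ) :
    (blaschkeDen R).eval z = (R.map fun a => 1 - starRingEnd ℂ a * z).prod := by
  rw [blaschkeDen, eval_multiset_prod, Multiset.map_map]
  simp

theorem eval_blaschkeDen_ne_zero (hR : ∀ a ∈ R, ‖a‖ < 1) (hz : ‖z‖ ≤ 1) :
    (blaschkeDen R).eval z ≠ 0 := by
  rw [eval_blaschkeDen]
  refine Multiset.prod_ne_zero fun h => ?_
  obtain ⟨a, ha, h⟩ := Multiset.mem_map.1 h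
  exact one_sub_conj_mul_ne_zero (hR a ha) hz h

theorem eval_blaschkeNum_eq_zero : (blaschkeNum R).eval z = 0 ↔ z ∈ R := by
  rw [eval_blaschkeNum, Multiset.prod_eq_zero_iff, Multiset.mem_map]
  constructor
  · rintro ⟨a, ha, h⟩
    rwa [sub_eq_zero.1 h]
  · exact fun h => ⟨z, h, sub_self z⟩

theorem norm_eval_blaschkeNum (R : Multiset ℂ) (hz : ‖z‖ = 1) :
    ‖(blaschkeNum R).eval z‖ = ‖(blaschkeDen R).eval z‖ := by
  rw [eval_blaschkeNum, eval_blaschkeDen]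
  induction R using Multiset.induction with
  | empty => simp
  | cons a R ih =>
    rw [Multiset.map_cons, Multiset.map_cons, Multiset.prod_cons, Multiset.prod_cons, norm_mul,
      norm_mul, ih, norm_sub_eq_norm_one_sub_conj_mul hz]

theorem diskRootCount_blaschkeNum (hR : ∀ a ∈ R, ‖a‖ < 1) :
    (blaschkeNum R).diskRootCount = R.card := by
  rw [diskRootCount, blaschkeNum, roots_multiset_prod_X_sub_C]
  exact Multiset.countP_eq_card.2 hR

theorem diskRootCount_blaschkeDen (hR : ∀ a ∈ R, ‖a‖ < 1) :
    (blaschkeDen R).diskRootCount = 0 :=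
  diskRootCount_eq_zero fun _ hz => eval_blaschkeDen_ne_zero hR hz.le

theorem blaschkeDen_ne_zero (hR : ∀ a ∈ R, ‖a‖ < 1) : blaschkeDen R ≠ 0 := fun h =>
  eval_blaschkeDen_ne_zero hR (z := 0) (by simp) (by rw [h, eval_zero])

theorem blaschkeNum_ne_zero : blaschkeNum R ≠ 0 :=
  (monic_multiset_prod_of_monic _ _ fun a _ => monic_X_sub_C a).ne_zero

theorem exists_eq_pow_rootMultiplicity_mul_eval_ne_zero {Q : Polynomial ℂ} (hQ : Q ≠ 0) (z : ℂ) :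
    ∃ q : Polynomial ℂ, q.eval z ≠ 0 ∧
      ∀ w, Q.eval w = (w - z) ^ Q.rootMultiplicity z * q.eval w := by
  obtain ⟨q, hq, hd⟩ := Q.exists_eq_pow_rootMultiplicity_mul_and_not_dvd hQ z
  refine ⟨q, fun h => hd (dvd_iff_isRoot.2 h), fun w => ?_⟩
  conv_lhs => rw [hq]
  simp

/-- The order of a quotient in lowest terms. -/
theorem map_toNat_meromorphicOrderAt {Q D : Polynomial ℂ} (hQ : Q ≠ 0) (hD : D ≠ 0) {g : ℂ → ℂ}
    (hg : ∀ᶠ w in 𝓝[≠] z, g w = Q.eval w / D.eval w) (hz : Q.eval z ≠ 0 ∨ D.eval z ≠ 0) :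
    WithTop.map Int.toNat (meromorphicOrderAt g z) = (Q.rootMultiplicity z : ℕ∞) := by
  obtain ⟨q, hq, hQq⟩ := exists_eq_pow_rootMultiplicity_mul_eval_ne_zero hQ z
  obtain ⟨d, hd, hDd⟩ := exists_eq_pow_rootMultiplicity_mul_eval_ne_zero hD z
  have hqa : AnalyticAt ℂ (fun w => q.eval w) z := q.differentiable.analyticAt z
  have hda : AnalyticAt ℂ (fun w => d.eval w) z := d.differentiable.analyticAt z
  have heq : ∀ᶠ w in 𝓝[≠] z, g w =
      (w - z) ^ ((Q.rootMultiplicity z : ℤ) - D.rootMultiplicity z) • (q.eval w / d.eval w) := by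
    filter_upwards [hg, self_mem_nhdsWithin] with w hw hwz
    have hwz : w - z ≠ 0 := sub_ne_zero.2 hwz
    rw [hw, hQq, hDd, zpow_sub₀ hwz, zpow_natCast, zpow_natCast, smul_eq_mul]
    rw [mul_div_mul_comm]
  have han : AnalyticAt ℂ (fun w => q.eval w / d.eval w) z := hqa.fun_div hda hd
  have hmer : MeromorphicAt g z := by
    refine MeromorphicAt.congr (f := fun w =>
      (w - z) ^ ((Q.rootMultiplicity z : ℤ) - D.rootMultiplicity z) • (q.eval w / d.eval w)) ?_ ?_
    · exact (((MeromorphicAt.id z).sub (MeromorphicAt.const z z)).zpow _).smul han.meromorphicAt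
    · filter_upwards [heq] with w hw using hw.symm
  have hord := (meromorphicOrderAt_eq_int_iff hmer).2 ⟨_, han, div_ne_zero hq hd, heq⟩
  rw [hord]
  -- In lowest terms one of the two multiplicities is zero, and at a pole `toNat` truncates the
  -- negative order to 0.
  have : ((Q.rootMultiplicity z : ℤ) - D.rootMultiplicity z).toNat = Q.rootMultiplicity z := by
    rcases hz with h | h
    · rw [rootMultiplicity_eq_zero h]
      omega
    · rw [rootMultiplicity_eq_zero (p := D) h]
      omega
  exact congrArg (fun n : ℕ => (n : ℕ∞)) this

/-- Value distribution of a quotient of finite Blaschke products without common zeros. -/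
theorem valueCount_of_blaschke {g : ℂ → ℂ} {u : ℂ} (hu : ‖u‖ = 1) (hK : ∀ a ∈ K, ‖a‖ < 1)
    (hM : ∀ a ∈ M, ‖a‖ < 1) (hd : ∀ a ∈ M, a ∉ K)
    (hg : ∀ z : ℂ, ‖z‖ < 1 → z ≠ 0 → z ∉ M → g z =
      u * (K.map fun a => (z - a) / (1 - starRingEnd ℂ a * z)).prod /
        (M.map fun a => (z - a) / (1 - starRingEnd ℂ a * z)).prod) :
    (∀ b : ℂ, 1 < ‖b‖ → valueCount g b = M.card) ∧
    (∀ b : ℂ, ‖b‖ < 1 → valueCount g b = K.card) := by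
  have hu0 : u ≠ 0 := norm_pos_iff.1 (by rw [hu]; exact one_pos)
  set A := C u * (blaschkeNum K * blaschkeDen M) with hA
  set D := blaschkeNum M * blaschkeDen K with hD
  have hD0 : D ≠ 0 := mul_ne_zero blaschkeNum_ne_zero (blaschkeDen_ne_zero hK)
  have hAc : A.diskRootCount = K.card := by
    rw [hA, diskRootCount_C_mul _ hu0, diskRootCount_mul blaschkeNum_ne_zero
      (blaschkeDen_ne_zero hM), diskRootCount_blaschkeNum hK, diskRootCount_blaschkeDen hM, add_zero]
  have hDc : D.diskRootCount = M.card := by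
    rw [hD, diskRootCount_mul blaschkeNum_ne_zero
      (blaschkeDen_ne_zero hK), diskRootCount_blaschkeNum hM, diskRootCount_blaschkeDen hK, add_zero]
  have hcirc : ∀ z : ℂ, ‖z‖ = 1 → ‖A.eval z‖ = ‖D.eval z‖ ∧ 0 < ‖D.eval z‖ := by
    intro z hz
    have h1 := norm_pos_iff.2 (eval_blaschkeDen_ne_zero hK hz.le)
    have h2 := norm_pos_iff.2 (eval_blaschkeDen_ne_zero hM hz.le)
    rw [hA, hD, eval_mul, eval_mul, eval_mul, eval_C, norm_mul, norm_mul, norm_mul, hu,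
      norm_eval_blaschkeNum _ hz, norm_eval_blaschkeNum _ hz]
    exact ⟨by ring, by positivity⟩
  have hne : ∀ z : ℂ, ‖z‖ < 1 → D.eval z = 0 → A.eval z ≠ 0 := by
    intro z hz h0
    rw [hD, eval_mul, mul_eq_zero, eval_blaschkeNum_eq_zero] at h0
    have hzM := h0.resolve_right (eval_blaschkeDen_ne_zero hK hz.le)
    rw [hA, eval_mul, eval_mul, eval_C]
    refine mul_ne_zero hu0 (mul_ne_zero ?_ (eval_blaschkeDen_ne_zero hM hz.le))
    rw [Ne, eval_blaschkeNum_eq_zero]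
    exact hd z hzM
  -- g - b = (A - bD)/D is in lowest terms in the disk because A and D have no common zero there.
  -- Punctured neighbourhoods avoid 0 and the zeros of D, where nothing is assumed about g.
  have hmult : ∀ b : ℂ, A - C b * D ≠ 0 → valueCount g b = (A - C b * D).diskRootCount := by
    intro b hQ
    rw [valueCount, ← tsum_rootMultiplicity]
    refine tsum_congr fun z => ?_
    have hz : ‖(z : ℂ)‖ < 1 := mem_ball_zero_iff.1 z.2
    refine map_toNat_meromorphicOrderAt hQ hD0 ?_ ?_
    · have h1 : ∀ᶠ w : ℂ in 𝓝[≠] (z : ℂ), ‖w‖ < 1 :=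
        nhdsWithin_le_nhds (continuous_norm.continuousAt.eventually (gt_mem_nhds hz))
      have h2 : ∀ᶠ w : ℂ in 𝓝[≠] (z : ℂ), w ∉ insert 0 {w : ℂ | D.eval w = 0} := by
        have hfin : (insert 0 {w : ℂ | D.eval w = 0}).Finite :=
          (D.finite_setOfPred_isRoot hD0).insert 0
        have hcl : IsClosed {w : ℂ | w ∈ insert 0 {w : ℂ | D.eval w = 0} ∧ w ≠ z} :=
          (hfin.subset fun _ h => h.1).isClosed
        filter_upwards [nhdsWithin_le_nhds (hcl.isOpen_compl.mem_nhds fun h => h.2 rfl),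
          self_mem_nhdsWithin] with w h3 h4 h5
        exact h3 ⟨h5, h4⟩
      filter_upwards [h1, h2] with w hw hw2
      rw [mem_insert_iff, not_or] at hw2
      obtain ⟨hw0, hwD⟩ := hw2
      have hwD : D.eval w ≠ 0 := hwD
      have hwM : w ∉ M := fun h => hwD (by
        rw [hD, eval_mul, eval_blaschkeNum_eq_zero.2 h, zero_mul])
      rw [hg w hw hw0 hwM, eval_sub, eval_mul (p := C b), eval_C, sub_div, mul_div_cancel_right₀ _ hwD]
      congr 1
      rw [Multiset.prod_map_div, Multiset.prod_map_div, ← eval_blaschkeNum, ← eval_blaschkeNum,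
        ← eval_blaschkeDen, ← eval_blaschkeDen, hA, hD, eval_mul, eval_mul, eval_mul, eval_C]
      rw [mul_div_assoc, mul_div_assoc, div_div_div_eq]
      ring
    · by_cases h : D.eval (z : ℂ) = 0
      · left
        rw [eval_sub, eval_mul (p := C b), h, mul_zero, sub_zero]
        exact hne z hz h
      · exact Or.inr h
  have hQ0 : ∀ b : ℂ, ‖b‖ ≠ 1 → A - C b * D ≠ 0 := by
    intro b hb h
    obtain ⟨h1, h2⟩ := hcirc 1 (by simp)
    rw [sub_eq_zero.1 h, eval_mul, eval_C, norm_mul] at h1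
    exact hb (mul_right_cancel₀ h2.ne' (h1.trans (one_mul _).symm))
  -- On the circle |A| = |D|, so A - bD is compared with -bD when |b| > 1 and with A when |b| < 1.
  constructor
  · intro b hb
    have hb0 : b ≠ 0 := norm_pos_iff.1 (one_pos.trans hb)
    rw [hmult b (hQ0 b hb.ne'), ← hDc, ← diskRootCount_C_mul D (neg_ne_zero.2 hb0)]
    congr 1
    refine diskRootCount_eq_of_norm_sub_lt fun z hz => ?_
    obtain ⟨h1, h2⟩ := hcirc z hz
    have h3 : (A - C b * D).eval z - (C (-b) * D).eval z = A.eval z := by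
      simp
    rw [h3, h1, eval_mul (p := C (-b)), eval_C, norm_mul, norm_neg]
    nlinarith [norm_nonneg ((A - C b * D).eval z)]
  · intro b hb
    rw [hmult b (hQ0 b hb.ne), ← hAc]
    congr 1
    refine diskRootCount_eq_of_norm_sub_lt fun z hz => ?_
    obtain ⟨h1, h2⟩ := hcirc z hz
    have h3 : (A - C b * D).eval z - A.eval z = -(b * D.eval z) := by
      simp
    rw [h3, norm_neg, norm_mul, h1]
    nlinarith [norm_nonneg ((A - C b * D).eval z)]

end Polynomial

/-! ### The pole of the best Möbius approximation and the main theorem -/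

theorem isPreconnected_puncturedBall : IsPreconnected (ball (0 : ℂ) 1 \ {0}) := by
  have h1 : ball (0 : ℂ) 1 \ {0} = Complex.exp '' {w | w.re < 0} := by
    ext z
    constructor
    · rintro ⟨hz, hz0⟩
      have hz0 : z ≠ 0 := hz0
      refine ⟨Complex.log z, ?_, Complex.exp_log hz0⟩
      show (Complex.log z).re < 0
      rw [Complex.log_re]
      exact Real.log_neg (norm_pos_iff.2 hz0) (mem_ball_zero_iff.1 hz)
    · rintro ⟨w, hw, rfl⟩
      refine ⟨?_, Complex.exp_ne_zero w⟩
      rw [mem_ball_zero_iff, Complex.norm_exp]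
      exact (Real.exp_lt_exp.2 hw).trans_eq Real.exp_zero
  rw [h1]
  exact (convex_halfSpace_re_lt 0).isPreconnected.image _ Complex.continuous_exp.continuousOn

theorem IsConformalOntoExterior.isUnivalentWithPole {N : ℕ} {p : Polygon ℂ N} {f : ℂ → ℂ}
    (hf : IsConformalOntoExterior p f) : IsUnivalentWithPole f :=
  ⟨hf.differentiableOn, hf.injOn, hf.tendsto_infinity⟩

theorem isBlaschkeProduct_of_multiset {c : ℂ} (hc : ‖c‖ = 1) {R : Multiset ℂ}
    (hR : ∀ a ∈ R, ‖a‖ < 1) : IsBlaschkeProduct R.card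
      fun z => c * (R.map fun a => (z - a) / (1 - starRingEnd ℂ a * z)).prod := by
  obtain ⟨l, rfl⟩ : ∃ l : List ℂ, R = l := ⟨R.toList, R.coe_toList.symm⟩
  rw [Multiset.coe_card]
  refine ⟨c, fun i => l.get i, hc, fun i => hR _ (by simp), fun z => ?_⟩
  beta_reduce
  rw [Multiset.map_coe, Multiset.prod_coe, ← List.prod_ofFn]
  congr 2
  apply List.ext_get <;> simp

open Polynomial in
/-- The pole of the best Möbius approximation in terms of a Schwarz–Christoffel formula. -/
theorem IsUnivalentWithPole.exists_bmaPole_eq {f : ℂ → ℂ} (hf : IsUnivalentWithPole f) {N : ℕ}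
    {ζ : Fin N → ℂ} (hζi : Function.Injective ζ) (hζ : ∀ i, ‖ζ i‖ = 1) {ν : Fin N → ℝ}
    (hν : ∀ i, ν i ≠ 0)
    (h : ∀ z ∈ ball (0 : ℂ) 1 \ {0}, negOneSubPreSchwarzian f z =
      ∑ i, (ν i : ℂ) / 2 * ((ζ i + z) / (ζ i - z))) :
    ∃ (u : ℂ) (K M : Multiset ℂ), ‖u‖ = 1 ∧ (∀ a ∈ K, ‖a‖ < 1) ∧ (∀ a ∈ M, ‖a‖ < 1) ∧
      M.card = {i | ν i < 0}.ncard ∧ N = K.card + M.card + 2 ∧ (0 : ℂ) ∉ M ∧ (∀ a ∈ M, a ∉ K) ∧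
      ∀ z : ℂ, ‖z‖ < 1 → z ≠ 0 → (deriv (deriv f) z = 0 ↔ z ∈ M) ∧
        (z ∉ M → bmaPole f z =
          u * z ^ 3 * (K.map fun a => (z - a) / (1 - starRingEnd ℂ a * z)).prod /
            (M.map fun a => (z - a) / (1 - starRingEnd ℂ a * z)).prod) := by
  set P : Finset (Fin N) := Finset.univ.filter fun i => 0 < ν i with hP
  set Q : Finset (Fin N) := Finset.univ.filter fun i => ν i < 0 with hQ
  have hPQ : P ∪ Q = Finset.univ := by
    refine Finset.eq_univ_iff_forall.2 fun i => ?_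
    rcases lt_or_gt_of_ne (hν i) with h | h
    · exact Finset.mem_union_right _ (by simpa [hQ] using h)
    · exact Finset.mem_union_left _ (by simpa [hP] using h)
  have hd : Disjoint P Q := Finset.disjoint_left.2 fun i h1 h2 =>
    lt_asymm (Finset.mem_filter.1 h1).2 (Finset.mem_filter.1 h2).2
  obtain ⟨hcount, hcirc⟩ := diskRootCount_nodePoly_sub_herglotzPoly (ζ := ζ) (ν := ν) hd
    hζi.injOn (fun i _ => hζ i) (fun i hi => (Finset.mem_filter.1 hi).2)
    (fun i hi => (Finset.mem_filter.1 hi).2)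
  rw [hPQ] at hcount hcirc
  set B := nodePoly ζ Finset.univ with hB
  set A := herglotzPoly ζ ν Finset.univ with hA
  have hBz : ∀ z : ℂ, ‖z‖ < 1 → B.eval z ≠ 0 := fun z hz =>
    eval_nodePoly_ne_zero fun j _ h => by rw [h, hζ j] at hz; exact lt_irrefl _ hz
  have hh : ∀ z : ℂ, ‖z‖ < 1 → z ≠ 0 → B.eval z * negOneSubPreSchwarzian f z = -A.eval z := by
    intro z hz hz0
    rw [h z ⟨mem_ball_zero_iff.2 hz, hz0⟩, hA, eval_herglotzPoly_eq_mul, ← mul_neg,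
      ← Finset.sum_neg_distrib]
    · congr 1
      refine Finset.sum_congr rfl fun i _ => ?_
      rw [← mul_neg, ← div_neg, neg_sub, add_comm]
    · rintro j - h
      rw [h, hζ j] at hz
      exact lt_irrefl _ hz
  have hsmall : ∀ᶠ z : ℂ in 𝓝[≠] 0, ‖z‖ < 1 ∧ z ≠ 0 := by
    filter_upwards [nhdsWithin_le_nhds (ball_mem_nhds (0 : ℂ) one_pos), self_mem_nhdsWithin]
      with z h1 h2 using ⟨mem_ball_zero_iff.1 h1, h2⟩
  -- S(z)/z → 0 because S = -B(h - 1) and (h - 1)/z → 0. A common zero of S and T in the disk would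
  -- be a zero of B, but the nodes lie on the circle.
  obtain ⟨u, K, M, hu, hK, hM, hMc, hN, h0, hMK, hz⟩ := exists_blaschke_of_reflect
    (S := B + A) (T := B - A) (N := N) (κ := ∏ i, (-ζ i))
    (by rw [norm_prod]; exact Finset.prod_eq_one fun i _ => by rw [norm_neg, hζ i])
    ((natDegree_sub_le _ _).trans (max_le (by simp [hB, natDegree_nodePoly])
      (natDegree_herglotzPoly_le.trans (by simp))))
    (fun z hz => by
      simpa using nodePoly_add_herglotzPoly_eq (ζ := ζ) (ν := ν) (s := Finset.univ)
        (fun i _ => hζ i) hz)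
    (by
      have h1 := (((B.continuous.tendsto 0).mono_left (nhdsWithin_le_nhds (s := {0}ᶜ))).mul
        hf.tendsto_negOneSubPreSchwarzian_zero).neg
      rw [mul_zero, neg_zero] at h1
      refine h1.congr' ?_
      filter_upwards [hsmall] with z hz
      have := hh z hz.1 hz.2
      rw [eval_add, ← mul_div_assoc, ← neg_div]
      congr 1
      linear_combination -this)
    hcirc
    (fun z hz h1 h2 => hBz z hz (by
      rw [eval_sub] at h1
      rw [eval_add] at h2
      linear_combination (h1 + h2) / 2))
  refine ⟨-u, K, M, by rwa [norm_neg], hK, hM, ?_, hN, h0, hMK, fun z hz1 hz0 => ?_⟩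
  · rw [hMc, hcount, Set.ncard_eq_toFinset_card', hQ]
    congr 1
    ext i
    simp
  · obtain ⟨h1, h2⟩ := hz z hz1
    have hf' : deriv f z ≠ 0 := hf.deriv_ne_zero ⟨mem_ball_zero_iff.2 hz1, hz0⟩
    have hBn := hBz z hz1
    have hT : (B - A).eval z * deriv f z = -(B.eval z * z * deriv (deriv f) z) := by
      have := hh z hz1 hz0
      rw [negOneSubPreSchwarzian] at this
      rw [eval_sub]
      field_simp at this
      linear_combination -this
    have hiff : deriv (deriv f) z = 0 ↔ z ∈ M := by
      rw [← h1]
      constructor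
      · intro h
        rw [h, mul_zero, neg_zero] at hT
        exact (mul_eq_zero.1 hT).resolve_right hf'
      · intro h
        rw [h, zero_mul, eq_comm, neg_eq_zero] at hT
        exact (mul_eq_zero.1 hT).resolve_left (mul_ne_zero hBn hz0)
    refine ⟨hiff, fun hzM => ?_⟩
    have hf'' : deriv (deriv f) z ≠ 0 := fun h => hzM (hiff.1 h)
    have hTz : (B - A).eval z ≠ 0 := fun h => hzM (h1.1 h)
    have hS : (B + A).eval z = 2 * B.eval z - (B - A).eval z := by
      rw [eval_add, eval_sub]; ring
    -- This is P_f = z(h - 1)/(h + 1) with h = -A/B.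
    have h3 : bmaPole f z = -z * ((B + A).eval z / (B - A).eval z) := by
      rw [bmaPole, hS]
      field_simp
      linear_combination 2 * hT
    rw [h3, h2 hz0]
    ring

/-- At a zero of f'' division by zero gives `bmaPole` a finite value in place of ∞. So the formula
is asserted where `Bm` does not vanish, and the equivalence identifies the remaining points as those
where P_f = ∞. -/
theorem theorem4p14 (n : ℕ) (p : Polygon ℂ (n + 2)) (hsimple : p.IsSimple)
    (hvert : p.HasNondegenerateVertices ℝ)
    (f : ℂ → ℂ) (hf : IsConformalOntoExterior p f) :
    ∃ k m : ℕ,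
      {i | p.IsConvexVertex i}.ncard = k + 2 ∧
      {i | p.IsConcaveVertex i}.ncard = m ∧
      (∃ Bk Bm : ℂ → ℂ, IsBlaschkeProduct k Bk ∧ IsBlaschkeProduct m Bm ∧
        (∀ z ∈ ball (0 : ℂ) 1, ¬ (Bk z = 0 ∧ Bm z = 0)) ∧
        ∀ z ∈ ball (0 : ℂ) 1, z ≠ 0 →
          (deriv (deriv f) z = 0 ↔ Bm z = 0) ∧
          (Bm z ≠ 0 → bmaPole f z = z ^ 3 * Bk z / Bm z)) ∧
      (∀ b : ℂ, 1 < ‖b‖ → valueCount (bmaPole f) b = m) ∧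
      (∀ a : ℂ, ‖a‖ < 1 → valueCount (bmaPole f) a = (k + 3 : ℕ)) := by
  have hU := hf.isUnivalentWithPole
  have hE := hf.image_eq
  have ho : IsOpen p.exterior := hE ▸ hU.isOpen_image
  -- Connectedness of the exterior comes from the map f; the Jordan curve theorem is not needed.
  have hc : IsPreconnected p.exterior := by
    rw [← hE]
    exact isPreconnected_puncturedBall.image _ hf.differentiableOn.continuousOn
  have hne : p.exterior.Nonempty := by
    rw [← hE]
    exact Nonempty.image _ ⟨1 / 2, mem_ball_zero_iff.2 (by norm_num), by norm_num⟩
  have hcl := hsimple.closure_exterior_diff hvert ho hc hne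
  have hang := fun (w : ℂ) (hw : w ∈ p.boundary ℝ) => hsimple.exists_angle hvert ho hc hne hw
  choose! a ha1 ha2 ha3 using hang
  obtain ⟨ζ, hζi, hζ, hsum, hform⟩ := hU.exists_schwarzChristoffel hsimple.injective (a := a)
    (by rw [hE, hcl]; exact p.vertex_mem_boundary) (by rw [hE, hcl]; exact ha1)
    (by rw [hE, hcl]; exact ha2)
  have hvtx := fun i => ha3 (p i) (p.vertex_mem_boundary i) i rfl
  have hconvex : ∀ i, p.IsConvexVertex i ↔ ¬ a (p i) - 1 < 0 := by
    intro i
    rcases hvtx i with ⟨h1, h2⟩ | ⟨h1, h2⟩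
    · exact ⟨fun h => absurd h2 h.not_isConcaveVertex, fun h => absurd (by linarith) h⟩
    · exact ⟨fun _ => by linarith, fun _ => h2⟩
  have hconcave : ∀ i, p.IsConcaveVertex i ↔ a (p i) - 1 < 0 := by
    intro i
    rcases hvtx i with ⟨h1, h2⟩ | ⟨h1, h2⟩
    · exact ⟨fun _ => by linarith, fun _ => h2⟩
    · exact ⟨fun h => absurd h h2.not_isConcaveVertex, fun h => by linarith⟩
  obtain ⟨u, K, M, hu, hK, hM, hMc, hN, h0, hMK, hz⟩ := hU.exists_bmaPole_eq hζi hζ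
    (ν := fun i => a (p i) - 1)
    (fun i => by rcases hvtx i with ⟨h1, -⟩ | ⟨h1, -⟩ <;> intro h <;> linarith) hform
  have hcon : {i | p.IsConcaveVertex i} = {i | a (p i) - 1 < 0} := by
    ext i; exact hconcave i
  have hvex : {i | p.IsConvexVertex i} = {i | a (p i) - 1 < 0}ᶜ := by
    ext i; exact hconvex i
  have hBm : ∀ z : ℂ, ‖z‖ < 1 →
      (1 * (M.map fun a => (z - a) / (1 - starRingEnd ℂ a * z)).prod = 0 ↔ z ∈ M) := by
    intro z hz
    rw [one_mul, Multiset.prod_eq_zero_iff, Multiset.mem_map]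
    constructor
    · rintro ⟨a, ha, h⟩
      rcases div_eq_zero_iff.1 h with h | h
      · rwa [sub_eq_zero.1 h]
      · exact absurd h (Polynomial.one_sub_conj_mul_ne_zero (hM a ha) hz.le)
    · exact fun h => ⟨z, h, by rw [sub_self, zero_div]⟩
  refine ⟨K.card, M.card, ?_, by rw [hcon, ← hMc], ⟨_, _, isBlaschkeProduct_of_multiset hu hK,
    isBlaschkeProduct_of_multiset norm_one hM, ?_, ?_⟩, ?_⟩
  -- Every vertex is convex or concave, and n + 2 = |K| + |M| + 2, so |K| + 2 vertices are convex.
  · have h1 := Set.ncard_add_ncard_compl {i | a (p i) - 1 < 0}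
    rw [← hMc, ← hvex, Nat.card_eq_fintype_card, Fintype.card_fin] at h1
    omega
  · rintro z hz1 ⟨h1, h2⟩
    have hz1 := mem_ball_zero_iff.1 hz1
    have hzM := (hBm z hz1).1 h2
    have hu0 : u ≠ 0 := norm_pos_iff.1 (by rw [hu]; exact one_pos)
    rw [mul_eq_zero, Multiset.prod_eq_zero_iff, Multiset.mem_map] at h1
    obtain ⟨a, ha, h⟩ := h1.resolve_left hu0
    rcases div_eq_zero_iff.1 h with h | h
    · rw [sub_eq_zero.1 h] at hzM
      exact hMK a hzM ha
    · exact Polynomial.one_sub_conj_mul_ne_zero (hK a ha) hz1.le h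
  · intro z hz1 hz0
    have hz1 := mem_ball_zero_iff.1 hz1
    obtain ⟨h1, h2⟩ := hz z hz1 hz0
    refine ⟨h1.trans (hBm z hz1).symm, fun h => ?_⟩
    rw [h2 fun h3 => h ((hBm z hz1).2 h3)]
    ring
  -- The factor z³ is absorbed as three Blaschke zeros at the origin. They do not cancel, as 0 is
  -- not in `M`; hence the count k + 3.
  · have := Polynomial.valueCount_of_blaschke (g := bmaPole f) (K := K + Multiset.replicate 3 0) hu
      (fun a ha => by
        rcases Multiset.mem_add.1 ha with h | h
        · exact hK a h
        · rw [Multiset.eq_of_mem_replicate h, norm_zero]; exact one_pos) hM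
      (fun a ha h => by
        rcases Multiset.mem_add.1 h with h | h
        · exact hMK a ha h
        · rw [Multiset.eq_of_mem_replicate h] at ha; exact h0 ha)
      (fun z hz1 hz0 hzM => by
        rw [(hz z hz1 hz0).2 hzM, Multiset.map_add, Multiset.prod_add, Multiset.map_replicate,
          Multiset.prod_replicate, map_zero, sub_zero, zero_mul, sub_zero, div_one]
        ring)
    rwa [Multiset.card_add, Multiset.card_replicate] at this
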